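/- Let $H$ be a Hilbert space, and let $L:D(L)\subset H\to H$ generate an analytic semigroup $(S_t)_{t\ge 0}$ with $|S_tu|\le Me^{-\nu t}|u|$ for all $t\ge 0$, $u\in H$ and some constants $M,\nu>0$. For $\gamma>0$ put $(-L)^{-\gamma}=\frac1{\Gamma(\gamma)}\int_0^\infty r^{\gamma-1}S_r\,dr$ and let $(-L)^\gamma$ be its inverse; let $H_\gamma=D((-L)^\gamma)$ with $|u|_\gamma=|(-L)^\gamma u|$, let $H_{-\gamma}$ be the completion of $H$ for $|u|_{-\gamma}=|(-L)^{-\gamma}u|$, and $H_0=H$. Write $H_\gamma^e=\mathcal L(\mathbb R^e,H_\gamma)$. Let $(\Omega,\mathcal F,(\mathcal F_t)_{t\ge0},\mathbb P)$ be a filtered probability space satisfying the usual conditions, let $m\in[2,\infty]$, and for $T>0$ consider processes on $[0,T]$ up to modification. For a process $Y$ set $\delta Y_{s,t}=Y_t-Y_s$ and $\hat\delta Y_{s,t}=Y_t-S_{t-s}Y_s$; let $$\|A\|_{\beta,m,\gamma}=\sup_{0\le s<t\le T}\frac{\|A_{s,t}\|_{L^m(\Omega,H_\gamma)}}{|t-s|^{\beta}},\qquad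 \|Y\|_{0,m,\gamma}=\sup_{t\in[0,T]}\|Y_t\|_{L^m(\Omega,H_\gamma)},$$ and likewise for values in $H_\gamma^e$. Let $C^\beta L_mH_\gamma$ (resp. $\hat C^\beta L_mH_\gamma$) be the space of measurable adapted processes $Y\in CL_mH_\gamma:=C([0,T],L^m(\Omega,H_\gamma))$ with $\|\delta Y\|_{\beta,m,\gamma}<\infty$ (resp. $\|\hat\delta Y\|_{\beta,m,\gamma}<\infty$), and let $E^\beta L_mH_\gamma=C^\beta L_mH_{\gamma-\beta}\cap CL_mH_\gamma$ with norm $\|Y\|_{E^\beta L_mH_\gamma}=\|\delta Y\|_{\beta,m,\gamma-\beta}+\|Y\|_{0,m,\gamma}$; the spaces $E^\beta L_mH^e_\gamma$ are defined in the same way. For $\eta:[0,T]\to\mathbb R^e$ let $|\delta\eta|_\alpha=\sup_{0\le s<t\le T}|\eta_t-\eta_s|/|t-s|^\alpha$, and let $C^\alpha([0,T],\mathbb R^e)$ be the space of continuous $\eta$ with $|\delta\eta|_\alpha<\infty$. Let $\alpha\in(\frac12,1)$, $\beta\in(1-\alpha,\alpha)$ and $\gamma\in\mathbb R$. (i) For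 all $T>0$, $\eta\in C^\alpha([0,T],\mathbb R^e)$ and $Y\in E^\beta L_mH_\gamma^e$ there is a unique $Z=:\int_0^\cdot S_{\cdot-r}Y_r\,d\eta_r\in\hat C^\alpha L_mH_{\gamma-\beta}$ with $Z_0=0$ such that for all $0\le s\le t\le T$ $$\hat\delta Z_{s,t}=\lim_{|\pi|\to0}\sum_{[r,v]\in\pi}S_{t-r}Y_r(\eta_v-\eta_r)\quad\text{in }L^m(\Omega,H_{\gamma-\beta}),$$ where $\pi$ runs over the partitions of $[s,t]$ and $|\pi|$ is the mesh size. (ii) For every $\theta\in[0,\alpha)$ one has $Z\in\hat C^{\alpha-\theta}L_mH_{\gamma+\theta}\cap E^\beta L_mH_{\gamma+\theta}$, the map $(\eta,Y)\mapsto Z$ from $C^\alpha([0,T],\mathbb R^e)\times E^\beta L_mH^e_\gamma$ to $E^\beta L_mH_{\gamma+\theta}$ is bilinear, and for every $T_0>0$ there is a constant $C>0$ such that for all $T\in(0,T_0]$, all $\eta$ and all $Y$ $$\|\hat\delta Z\|_{\alpha-\theta,m,\gamma+\theta}\le C\,\|Y\|_{E^\beta L_mH_\gamma}|\delta\eta|_\alpha,\qquad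 \|Z\|_{E^\beta L_mH_{\gamma+\theta}}\le C\,T^{\alpha-(\beta\vee\theta)}\|Y\|_{E^\beta L_mH_\gamma}|\delta\eta|_\alpha.$$ -/

import Mathlib

open MeasureTheory Set Filter Topology
open scoped NNReal ENNReal

set_option linter.unusedSectionVars false

noncomputable section

namespace YoungConv

/-! ### Complexification of a real Hilbert space -/

/-- The complexification `H ⊕ iH` of a real Hilbert space; the pair `(x, y)` stands for `x + iy`,
and `‖x + iy‖² = ‖x‖² + ‖y‖²`. -/
def Cplx (H : Type*) : Type _ := WithLp 2 (H × H)

section Cplx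

variable {H : Type*} [NormedAddCommGroup H] [InnerProductSpace ℝ H]

instance : NormedAddCommGroup (Cplx H) := inferInstanceAs (NormedAddCommGroup (WithLp 2 (H × H)))

/-- The element `x + iy` of the complexification. -/
def Cplx.mk (x y : H) : Cplx H := WithLp.toLp 2 (x, y)

/-- Real part. -/
def Cplx.re (v : Cplx H) : H := WithLp.fst v

/-- Imaginary part. -/
def Cplx.im (v : Cplx H) : H := WithLp.snd v

theorem Cplx.ext' {v w : Cplx H} (h₁ : v.re = w.re) (h₂ : v.im = w.im) : v = w :=
  WithLp.ofLp_injective 2 (Prod.ext h₁ h₂)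

theorem Cplx.norm_sq (v : Cplx H) : ‖v‖ ^ 2 = ‖v.re‖ ^ 2 + ‖v.im‖ ^ 2 :=
  WithLp.prod_norm_sq_eq_of_L2 (α := H) (β := H) v

instance : SMul ℂ (Cplx H) where
  smul z v := Cplx.mk (z.re • v.re - z.im • v.im) (z.re • v.im + z.im • v.re)

theorem Cplx.smul_re (z : ℂ) (v : Cplx H) : (z • v).re = z.re • v.re - z.im • v.im := rfl

theorem Cplx.smul_im (z : ℂ) (v : Cplx H) : (z • v).im = z.re • v.im + z.im • v.re := rfl

theorem Cplx.add_re (v w : Cplx H) : (v + w).re = v.re + w.re := rfl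

theorem Cplx.add_im (v w : Cplx H) : (v + w).im = v.im + w.im := rfl

theorem Cplx.sub_re (v w : Cplx H) : (v - w).re = v.re - w.re := rfl

theorem Cplx.zero_re : (0 : Cplx H).re = 0 := rfl

theorem Cplx.zero_im : (0 : Cplx H).im = 0 := rfl

instance : Module ℂ (Cplx H) where
  one_smul v := Cplx.ext' (by simp [Cplx.smul_re]) (by simp [Cplx.smul_im])
  mul_smul z w v := Cplx.ext'
    (by simp only [Cplx.smul_re, Cplx.smul_im, Complex.mul_re, Complex.mul_im]; module)
    (by simp only [Cplx.smul_re, Cplx.smul_im, Complex.mul_re, Complex.mul_im]; module)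
  smul_zero z := Cplx.ext'
    (by simp [Cplx.smul_re, Cplx.zero_re, Cplx.zero_im])
    (by simp [Cplx.smul_im, Cplx.zero_re, Cplx.zero_im])
  smul_add z v w := Cplx.ext'
    (by simp only [Cplx.smul_re, Cplx.add_re, Cplx.add_im]; module)
    (by simp only [Cplx.smul_im, Cplx.add_re, Cplx.add_im]; module)
  add_smul z w v := Cplx.ext'
    (by simp only [Cplx.smul_re, Cplx.add_re, Complex.add_re, Complex.add_im]; module)
    (by simp only [Cplx.smul_im, Cplx.add_im, Complex.add_re, Complex.add_im]; module)
  zero_smul v := Cplx.ext'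
    (by simp [Cplx.smul_re, Cplx.zero_re]) (by simp [Cplx.smul_im, Cplx.zero_im])

instance : NormedSpace ℂ (Cplx H) where
  norm_smul_le z v := by
    refine le_of_eq ?_
    rw [← sq_eq_sq₀ (norm_nonneg _) (by positivity), mul_pow, Cplx.norm_sq, Cplx.norm_sq v,
      Cplx.smul_re, Cplx.smul_im, norm_sub_sq_real, norm_add_sq_real, Complex.sq_norm,
      Complex.normSq_apply]
    simp only [norm_smul, real_inner_smul_left, real_inner_smul_right, mul_pow, Real.norm_eq_abs,
      sq_abs, real_inner_comm v.re v.im]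
    ring

theorem Cplx.norm_mk_zero (x : H) : ‖Cplx.mk x 0‖ = ‖x‖ := by
  rw [← sq_eq_sq₀ (norm_nonneg _) (norm_nonneg _), Cplx.norm_sq]
  simp [Cplx.mk, Cplx.re, Cplx.im]

end Cplx

/-! ### Analytic semigroups and their generators -/

section Semigroup

variable {H : Type*} [NormedAddCommGroup H] [InnerProductSpace ℝ H]

/-- The open sector `{z ≠ 0 : |arg z| < φ}`. -/
def sector (φ : ℝ) : Set ℂ := {z | z ≠ 0 ∧ |z.arg| < φ}

/-- `(S t)_{t ≥ 0}` is an analytic semigroup of bounded operators on the real Hilbert space `H`: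
a strongly continuous semigroup which extends (on the complexification of `H`) to a holomorphic
family on a sector around the positive half line that satisfies the semigroup law and is strongly
continuous at `0`. The values of `S` at negative times play no role. -/
structure IsAnalyticSemigroup (S : ℝ → H →L[ℝ] H) : Prop where
  map_zero : S 0 = ContinuousLinearMap.id ℝ H
  map_add : ∀ s t : ℝ, 0 ≤ s → 0 ≤ t → S (s + t) = S s ∘L S t
  continuousOn : ∀ x : H, ContinuousOn (fun t => S t x) (Ici 0)
  analytic : ∃ φ : ℝ, 0 < φ ∧ φ ≤ Real.pi / 2 ∧ ∃ U : ℂ → Cplx H →L[ℂ] Cplx H,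
    DifferentiableOn ℂ U (sector φ) ∧
    (∀ z ∈ sector φ, ∀ w ∈ sector φ, U (z + w) = U z ∘L U w) ∧
    (∀ v : Cplx H, Tendsto (fun z => U z v) (𝓝[sector φ] 0) (𝓝 v)) ∧
    ∀ t : ℝ, 0 < t → ∀ x : H, U (t : ℂ) (Cplx.mk x 0) = Cplx.mk (S t x) 0

/-- `L`, with its domain, is the infinitesimal generator of `(S t)_{t ≥ 0}`. -/
def IsGenerator (L : H →ₗ.[ℝ] H) (S : ℝ → H →L[ℝ] H) : Prop :=
  ∀ x y : H, (x, y) ∈ L.graph ↔ Tendsto (fun t : ℝ => t⁻¹ • (S t x - x)) (𝓝[>] 0) (𝓝 y)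

/-- `|S_t u| ≲ e^{-νt} |u|` for some `ν > 0`. -/
def IsExpStable (S : ℝ → H →L[ℝ] H) : Prop :=
  ∃ M ν : ℝ, 0 < ν ∧ ∀ t : ℝ, 0 ≤ t → ‖S t‖ ≤ M * Real.exp (-(ν * t))

/-- The negative fractional power `(-L)^{-γ} = Γ(γ)⁻¹ ∫₀^∞ r^{γ-1} S_r dr` for `γ > 0`, and the
identity for `γ = 0`, where `L` is the generator of `S` (used for `γ ≥ 0` only). -/
def negPow (S : ℝ → H →L[ℝ] H) (γ : ℝ) : H →L[ℝ] H :=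
  if γ = 0 then ContinuousLinearMap.id ℝ H
  else (Real.Gamma γ)⁻¹ • ∫ r in Ioi (0 : ℝ), r ^ (γ - 1) • S r

end Semigroup

/-! ### Basic facts on negative powers, which justify the description of the scale below -/

section NegPow

variable {H : Type*} [NormedAddCommGroup H] [InnerProductSpace ℝ H] {S : ℝ → H →L[ℝ] H}

theorem IsAnalyticSemigroup.continuousOn_norm (hS : IsAnalyticSemigroup S) :
    ContinuousOn S (Ioi 0) := by
  obtain ⟨φ, hφ, -, U, hU, -, -, hUS⟩ := hS.analytic
  have hmem : ∀ t : ℝ, 0 < t → (t : ℂ) ∈ sector φ := fun t ht =>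
    ⟨by exact_mod_cast ht.ne', by rw [Complex.arg_ofReal_of_nonneg ht.le]; simpa using hφ⟩
  have hc : ContinuousOn (fun t : ℝ => U (t : ℂ)) (Ioi 0) :=
    hU.continuousOn.comp Complex.continuous_ofReal.continuousOn fun t ht => hmem t ht
  rw [Metric.continuousOn_iff] at hc ⊢
  intro b hb ε hε
  obtain ⟨δ, hδ, h⟩ := hc b hb ε hε
  refine ⟨δ, hδ, fun a ha hab => lt_of_le_of_lt ?_ (h a ha hab)⟩
  rw [dist_eq_norm, dist_eq_norm]
  refine ContinuousLinearMap.opNorm_le_bound _ (norm_nonneg _) fun x => ?_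
  have e : (U (a : ℂ) - U (b : ℂ)) (Cplx.mk x 0) = Cplx.mk ((S a - S b) x) 0 := by
    rw [sub_apply, hUS a ha x, hUS b hb x]
    exact Cplx.ext' rfl (sub_zero (0 : H))
  calc ‖(S a - S b) x‖ = ‖(U (a : ℂ) - U (b : ℂ)) (Cplx.mk x 0)‖ := by
        rw [e, Cplx.norm_mk_zero]
    _ ≤ _ := by
        refine (ContinuousLinearMap.le_opNorm _ _).trans_eq ?_
        rw [Cplx.norm_mk_zero]

theorem integrableOn_negPow (hS : IsAnalyticSemigroup S) (hν : IsExpStable S) {γ : ℝ}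
    (hγ : 0 < γ) : IntegrableOn (fun r : ℝ => r ^ (γ - 1) • S r) (Ioi 0) := by
  obtain ⟨M, ν, hν0, hM⟩ := hν
  have h1 : IntegrableOn (fun r : ℝ => M * (r ^ (γ - 1) * Real.exp (-ν * r ^ (1 : ℝ)))) (Ioi 0) :=
    (integrableOn_rpow_mul_exp_neg_mul_rpow (by linarith) one_pos hν0).const_mul M
  refine Integrable.mono' h1 ?_ ?_
  · have hp : ContinuousOn (fun r : ℝ => r ^ (γ - 1)) (Ioi 0) := fun r hr =>
      (Real.continuousAt_rpow_const _ _ (Or.inl (ne_of_gt hr))).continuousWithinAt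
    have hq : ContinuousOn (fun r : ℝ => r ^ (γ - 1) • S r) (Ioi 0) :=
      hp.smul hS.continuousOn_norm
    exact hq.aestronglyMeasurable measurableSet_Ioi
  · refine (ae_restrict_iff' measurableSet_Ioi).2 (ae_of_all _ fun r hr => ?_)
    have hr : (0 : ℝ) < r := hr
    rw [norm_smul, Real.norm_of_nonneg (Real.rpow_nonneg hr.le _), Real.rpow_one]
    calc r ^ (γ - 1) * ‖S r‖ ≤ r ^ (γ - 1) * (M * Real.exp (-(ν * r))) := by
          gcongr; exact hM r hr.le
      _ = _ := by rw [neg_mul]; ring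

theorem integral_rpow_mul_rpow {a b x : ℝ} (ha : 0 < a) (hb : 0 < b) (hx : 0 < x) :
    ∫ t in (0 : ℝ)..x, t ^ (a - 1) * (x - t) ^ (b - 1) =
      x ^ (a + b - 1) * (Real.Gamma a * Real.Gamma b / Real.Gamma (a + b)) := by
  have h := Complex.betaIntegral_scaled (a : ℂ) (b : ℂ) hx
  have hG := Complex.Gamma_mul_Gamma_eq_betaIntegral (s := (a : ℂ)) (t := (b : ℂ))
    (by simpa using ha) (by simpa using hb)
  have hne : Real.Gamma (a + b) ≠ 0 := (Real.Gamma_pos_of_pos (by positivity)).ne'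
  have hB : Complex.betaIntegral a b =
      ((Real.Gamma a * Real.Gamma b / Real.Gamma (a + b) : ℝ) : ℂ) := by
    rw [← Complex.ofReal_add, Complex.Gamma_ofReal, Complex.Gamma_ofReal,
      Complex.Gamma_ofReal] at hG
    push_cast
    rw [hG, mul_comm, mul_div_assoc, div_self (by exact_mod_cast hne), mul_one]
  rw [hB] at h
  have hl : ∫ t in (0 : ℝ)..x, (t : ℂ) ^ ((a : ℂ) - 1) * ((x : ℂ) - t) ^ ((b : ℂ) - 1) =
      ((∫ t in (0 : ℝ)..x, t ^ (a - 1) * (x - t) ^ (b - 1) : ℝ) : ℂ) := by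
    rw [← intervalIntegral.integral_ofReal]
    refine intervalIntegral.integral_congr fun t ht => ?_
    rw [uIcc_of_le hx.le] at ht
    rw [Complex.ofReal_mul, Complex.ofReal_cpow ht.1, Complex.ofReal_cpow (sub_nonneg.2 ht.2)]
    push_cast
    rfl
  have hr : (x : ℂ) ^ ((a : ℂ) + b - 1) = ((x ^ (a + b - 1) : ℝ) : ℂ) := by
    rw [Complex.ofReal_cpow hx.le]; push_cast; rfl
  rw [hl, hr] at h
  exact_mod_cast h

theorem negPow_of_pos {γ : ℝ} (hγ : 0 < γ) :
    negPow S γ = (Real.Gamma γ)⁻¹ • ∫ r in Ioi (0 : ℝ), r ^ (γ - 1) • S r :=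
  if_neg hγ.ne'

theorem negPow_zero : negPow S 0 = ContinuousLinearMap.id ℝ H := if_pos rfl

variable [CompleteSpace H]

/-- `(-L)^{-a} (-L)^{-b} = (-L)^{-(a+b)}`. -/
theorem negPow_comp (hS : IsAnalyticSemigroup S) (hν : IsExpStable S) {a b : ℝ} (ha : 0 ≤ a)
    (hb : 0 ≤ b) : negPow S a ∘L negPow S b = negPow S (a + b) := by
  rcases ha.eq_or_lt with rfl | ha
  · rw [negPow_zero, zero_add]; rfl
  rcases hb.eq_or_lt with rfl | hb
  · rw [negPow_zero, add_zero]; rfl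
  have key := integral_posConvolution (integrableOn_negPow hS hν ha)
    (integrableOn_negPow hS hν hb) (ContinuousLinearMap.compL ℝ H H H)
  simp only [ContinuousLinearMap.compL_apply] at key
  have hne : Real.Gamma (a + b) ≠ 0 := (Real.Gamma_pos_of_pos (by positivity)).ne'
  have hna : Real.Gamma a ≠ 0 := (Real.Gamma_pos_of_pos ha).ne'
  have hnb : Real.Gamma b ≠ 0 := (Real.Gamma_pos_of_pos hb).ne'
  have hl : ∫ x in Ioi (0 : ℝ), ∫ t in (0 : ℝ)..x,
        (t ^ (a - 1) • S t) ∘L ((x - t) ^ (b - 1) • S (x - t)) =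
      (Real.Gamma a * Real.Gamma b / Real.Gamma (a + b)) •
        ∫ x in Ioi (0 : ℝ), x ^ (a + b - 1) • S x := by
    rw [← integral_smul]
    refine setIntegral_congr_fun measurableSet_Ioi fun x hx => ?_
    have hx : (0 : ℝ) < x := hx
    have : ∫ t in (0 : ℝ)..x, (t ^ (a - 1) • S t) ∘L ((x - t) ^ (b - 1) • S (x - t)) =
        ∫ t in (0 : ℝ)..x, (t ^ (a - 1) * (x - t) ^ (b - 1)) • S x := by
      refine intervalIntegral.integral_congr fun t ht => ?_
      rw [uIcc_of_le hx.le] at ht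
      have hadd := hS.map_add t (x - t) ht.1 (sub_nonneg.2 ht.2)
      rw [add_sub_cancel] at hadd
      rw [ContinuousLinearMap.smul_comp, ContinuousLinearMap.comp_smul, ← hadd, smul_smul]
    rw [this, intervalIntegral.integral_smul_const, integral_rpow_mul_rpow ha hb hx, smul_smul,
      mul_comm]
  rw [hl] at key
  rw [negPow_of_pos ha, negPow_of_pos hb, negPow_of_pos (add_pos ha hb),
    ContinuousLinearMap.smul_comp, ContinuousLinearMap.comp_smul, ← key, smul_smul, smul_smul]
  congr 1
  field_simp

/-- The semigroup commutes with the negative powers. -/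
theorem negPow_comm (hS : IsAnalyticSemigroup S) (hν : IsExpStable S) {γ t : ℝ} (hγ : 0 ≤ γ)
    (ht : 0 ≤ t) : negPow S γ ∘L S t = S t ∘L negPow S γ := by
  rcases hγ.eq_or_lt with rfl | hγ
  · rw [negPow_zero]; rfl
  have hi := integrableOn_negPow hS hν hγ
  have h1 := ((ContinuousLinearMap.compL ℝ H H H) (S t)).integral_comp_comm hi
  have h2 := (((ContinuousLinearMap.compL ℝ H H H).flip) (S t)).integral_comp_comm hi
  simp only [ContinuousLinearMap.compL_apply, ContinuousLinearMap.flip_apply] at h1 h2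
  rw [negPow_of_pos hγ, ContinuousLinearMap.smul_comp, ContinuousLinearMap.comp_smul, ← h1, ← h2]
  congr 1
  refine setIntegral_congr_fun measurableSet_Ioi fun r hr => ?_
  have hr : (0 : ℝ) < r := hr
  rw [ContinuousLinearMap.smul_comp, ContinuousLinearMap.comp_smul, ← hS.map_add r t hr.le ht,
    ← hS.map_add t r ht hr.le, add_comm]

theorem negPow_one_apply_sub (hS : IsAnalyticSemigroup S) (hν : IsExpStable S) {t : ℝ}
    (ht : 0 ≤ t) (x : H) :
    negPow S 1 (x - S t x) = ∫ r in (0 : ℝ)..t, S r x := by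
  have hi : IntegrableOn S (Ioi 0) := by
    simpa using integrableOn_negPow hS hν one_pos
  have hJ : ∀ y : H, negPow S 1 y = ∫ r in Ioi (0 : ℝ), S r y := fun y => by
    have h := (ContinuousLinearMap.apply ℝ H y).integral_comp_comm hi
    simp only [ContinuousLinearMap.apply_apply] at h
    rw [h, negPow_of_pos one_pos]
    simp
  have hix : IntegrableOn (fun r => S r x) (Ioi 0) :=
    (ContinuousLinearMap.apply ℝ H x).integrable_comp hi
  have hs : ∫ r in Ioi (0 : ℝ), S r (S t x) = ∫ r in Ioi t, S r x := by
    have h := (measurePreserving_add_right volume t).setIntegral_preimage_emb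
      (measurableEmbedding_addRight t) (fun r => S r x) (Ioi t)
    rw [preimage_add_const_Ioi, sub_self] at h
    rw [← h]
    refine setIntegral_congr_fun measurableSet_Ioi fun r hr => ?_
    rw [hS.map_add r t (le_of_lt hr) ht]; rfl
  rw [_root_.map_sub, hJ, hJ, hs, intervalIntegral.integral_Ioi_sub_Ioi hix ht]

theorem tendsto_average (hS : IsAnalyticSemigroup S) (x : H) :
    Tendsto (fun t : ℝ => t⁻¹ • ∫ r in (0 : ℝ)..t, S r x) (𝓝[>] 0) (𝓝 x) := by
  have hc := hS.continuousOn x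
  have h : HasDerivWithinAt (fun t : ℝ => ∫ r in (0 : ℝ)..t, S r x) (S 0 x) (Ici 0) 0 := by
    refine intervalIntegral.integral_hasDerivWithinAt_right (by simp)
      (s := Ici 0) (t := Ioi 0) ?_ ?_
    · refine ⟨Ioi 0, self_mem_nhdsWithin, ?_⟩
      exact (hc.mono Ioi_subset_Ici_self).aestronglyMeasurable measurableSet_Ioi
    · exact (hc 0 self_mem_Ici).mono Ioi_subset_Ici_self
  have h' := (hasDerivWithinAt_iff_tendsto_slope' (by simp)).1 h.Ioi_of_Ici
  rw [hS.map_zero] at h'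
  refine h'.congr fun t => ?_
  simp [slope_def_module]

theorem negPow_one_injective (hS : IsAnalyticSemigroup S) (hν : IsExpStable S) :
    Function.Injective (negPow S 1) := by
  refine (injective_iff_map_eq_zero _).2 fun x hx => ?_
  refine tendsto_nhds_unique (tendsto_average hS x) ?_
  refine tendsto_const_nhds.congr' ?_
  filter_upwards [self_mem_nhdsWithin] with t ht
  have hcomm : negPow S 1 (S t x) = S t (negPow S 1 x) :=
    DFunLike.congr_fun (negPow_comm hS hν zero_le_one (le_of_lt ht)) x
  rw [← negPow_one_apply_sub hS hν (le_of_lt ht), _root_.map_sub, hcomm, hx]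
  simp

theorem negPow_one_denseRange (hS : IsAnalyticSemigroup S) (hν : IsExpStable S) :
    DenseRange (negPow S 1) := fun x => by
  refine mem_closure_of_tendsto (tendsto_average hS x) ?_
  filter_upwards [self_mem_nhdsWithin] with t ht
  exact ⟨t⁻¹ • (x - S t x), by
    rw [_root_.map_smul, negPow_one_apply_sub hS hν (le_of_lt ht)]⟩

theorem negPow_nat (hS : IsAnalyticSemigroup S) (hν : IsExpStable S) (n : ℕ) :
    Function.Injective (negPow S n) ∧ DenseRange (negPow S n) := by
  induction n with
  | zero =>
    rw [Nat.cast_zero, negPow_zero]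
    exact ⟨fun _ _ h => h, fun x => subset_closure ⟨x, rfl⟩⟩
  | succ n ih =>
    rw [Nat.cast_succ, ← negPow_comp hS hν n.cast_nonneg zero_le_one,
      ContinuousLinearMap.coe_comp]
    exact ⟨ih.1.comp (negPow_one_injective hS hν),
      ih.2.comp (negPow_one_denseRange hS hν) (negPow S n).continuous⟩

theorem negPow_injective (hS : IsAnalyticSemigroup S) (hν : IsExpStable S) {γ : ℝ}
    (hγ : 0 ≤ γ) : Function.Injective (negPow S γ) := by
  obtain ⟨n, hn⟩ := exists_nat_ge γ
  have h := (negPow_nat hS hν n).1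
  rw [← sub_add_cancel (n : ℝ) γ, ← negPow_comp hS hν (sub_nonneg.2 hn) hγ,
    ContinuousLinearMap.coe_comp] at h
  exact h.of_comp

theorem negPow_denseRange (hS : IsAnalyticSemigroup S) (hν : IsExpStable S) {γ : ℝ}
    (hγ : 0 ≤ γ) : DenseRange (negPow S γ) := by
  obtain ⟨n, hn⟩ := exists_nat_ge γ
  have h := (negPow_nat hS hν n).2
  rw [← add_sub_cancel γ (n : ℝ), ← negPow_comp hS hν hγ (sub_nonneg.2 hn),
    ContinuousLinearMap.coe_comp] at h
  exact h.of_comp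

end NegPow

/-! ### The scale of spaces `H_γ` -/

section Scale

variable {H : Type*} [NormedAddCommGroup H] [InnerProductSpace ℝ H]

/-- The Hilbert space `H_γ`, `γ ∈ ℝ`, of the semigroup `S`, in the coordinate `x = (-L)^γ u`:
the vector `x : HScale S γ` stands for the element `u = (-L)^{-γ} x` of `H_γ`, with
`|u|_γ = |(-L)^γ u| = ‖x‖`.

* `γ > 0`: `u ↦ (-L)^γ u` is by definition an isometry of `D((-L)^γ)`, which is the range of the
  injective operator `(-L)^{-γ}`, onto `H`; see `embed_zero_of_pos`, `embed_injective`.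
* `γ = 0`: `HScale S 0` is `H`.
* `γ < 0`: `u ↦ (-L)^γ u` is an isometry of `H` with the norm `|(-L)^γ u|` onto a dense subspace
  of the complete space `H`, so that `H` is the completion of `H` for this norm; see
  `norm_embed_of_neg`, `embed_denseRange`.

The inclusions between these spaces are the maps `embed`. -/
def HScale (_S : ℝ → H →L[ℝ] H) (_γ : ℝ) : Type _ := H

variable (S : ℝ → H →L[ℝ] H)

instance (γ : ℝ) : NormedAddCommGroup (HScale S γ) := inferInstanceAs (NormedAddCommGroup H)

instance (γ : ℝ) : InnerProductSpace ℝ (HScale S γ) := inferInstanceAs (InnerProductSpace ℝ H)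

instance (γ : ℝ) [CompleteSpace H] : CompleteSpace (HScale S γ) :=
  inferInstanceAs (CompleteSpace H)

/-- The inclusion `H_{γ₂} ⊂ H_{γ₁}` for `γ₁ ≤ γ₂`: in the coordinates `(-L)^{γ₂} u` and
`(-L)^{γ₁} u` it is the operator `(-L)^{-(γ₂ - γ₁)}`. -/
def embed (γ₁ γ₂ : ℝ) : HScale S γ₂ →L[ℝ] HScale S γ₁ := negPow S (γ₂ - γ₁)

/-- The semigroup on `H_γ`; it commutes with the powers of `-L`, so it is given by the same
operator in the coordinate `(-L)^γ u` (see `embed_scaleSemigroup`). -/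
def scaleSemigroup (γ : ℝ) (t : ℝ) : HScale S γ →L[ℝ] HScale S γ := S t

/-- `H_γ^e = L(ℝ^e, H_γ)` with the operator norm. -/
abbrev HScaleE (e : ℕ) (γ : ℝ) : Type _ := EuclideanSpace ℝ (Fin e) →L[ℝ] HScale S γ

/-- The inclusion `H_{γ₂}^e ⊂ H_{γ₁}^e` for `γ₁ ≤ γ₂`. -/
def embedE (e : ℕ) (γ₁ γ₂ : ℝ) : HScaleE S e γ₂ →L[ℝ] HScaleE S e γ₁ :=
  ContinuousLinearMap.compL ℝ (EuclideanSpace ℝ (Fin e)) (HScale S γ₂) (HScale S γ₁)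
    (embed S γ₁ γ₂)

/-- The map `y ↦ S_τ (y v)` from `H_γ^e` to `H_γ`, for `v ∈ ℝ^e`. -/
def semigroupApply (e : ℕ) (γ τ : ℝ) (v : EuclideanSpace ℝ (Fin e)) :
    HScaleE S e γ →L[ℝ] HScale S γ :=
  scaleSemigroup S γ τ ∘L ContinuousLinearMap.apply ℝ (HScale S γ) v

end Scale

section ScaleFacts

variable {H : Type*} [NormedAddCommGroup H] [InnerProductSpace ℝ H] {S : ℝ → H →L[ℝ] H}

/-- For `γ > 0` the element of `H` represented by `x : HScale S γ` is `(-L)^{-γ} x`. -/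
theorem embed_zero_of_pos (γ : ℝ) (x : H) :
    (embed S 0 γ (x : HScale S γ) : H) = negPow S γ x := by
  have h : embed S 0 γ = negPow S γ := by rw [embed, sub_zero]; rfl
  exact DFunLike.congr_fun h x

/-- For `γ < 0` the norm of `u ∈ H` in `H_γ` is `|(-L)^γ u|`. -/
theorem norm_embed_of_neg (γ : ℝ) (u : H) :
    ‖embed S γ 0 (u : HScale S 0)‖ = ‖negPow S (-γ) u‖ := by
  have h : embed S γ 0 = negPow S (-γ) := by rw [embed, zero_sub]; rfl
  exact congrArg norm (DFunLike.congr_fun h u)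

variable [CompleteSpace H]

theorem embed_injective (hS : IsAnalyticSemigroup S) (hν : IsExpStable S) {γ₁ γ₂ : ℝ}
    (h : γ₁ ≤ γ₂) : Function.Injective (embed S γ₁ γ₂) :=
  negPow_injective hS hν (sub_nonneg.2 h)

theorem embed_denseRange (hS : IsAnalyticSemigroup S) (hν : IsExpStable S) {γ₁ γ₂ : ℝ}
    (h : γ₁ ≤ γ₂) : DenseRange (embed S γ₁ γ₂) :=
  negPow_denseRange hS hν (sub_nonneg.2 h)

/-- The inclusions are compatible with each other. -/
theorem embed_comp (hS : IsAnalyticSemigroup S) (hν : IsExpStable S) {γ₁ γ₂ γ₃ : ℝ}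
    (h₁ : γ₁ ≤ γ₂) (h₂ : γ₂ ≤ γ₃) :
    embed S γ₁ γ₂ ∘L embed S γ₂ γ₃ = embed S γ₁ γ₃ := by
  have h := negPow_comp hS hν (sub_nonneg.2 h₁) (sub_nonneg.2 h₂)
  rw [sub_add_sub_comm, add_comm γ₂ γ₃, add_sub_add_right_eq_sub] at h
  exact h

/-- The semigroups on the spaces of the scale are restrictions of each other. -/
theorem embed_scaleSemigroup (hS : IsAnalyticSemigroup S) (hν : IsExpStable S) {γ₁ γ₂ t : ℝ}
    (h : γ₁ ≤ γ₂) (ht : 0 ≤ t) :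
    embed S γ₁ γ₂ ∘L scaleSemigroup S γ₂ t = scaleSemigroup S γ₁ t ∘L embed S γ₁ γ₂ :=
  negPow_comm hS hν (sub_nonneg.2 h) ht

end ScaleFacts

/-! ### Increments and Hölder type spaces of processes -/

section Increments

variable {T : ℝ} {V : Type*} [NormedAddCommGroup V] [NormedSpace ℝ V]

/-- The increment `δY_{s,t} = Y_t - Y_s`. -/
def incr (Y : Icc (0 : ℝ) T → V) (s t : Icc (0 : ℝ) T) : V := Y t - Y s

/-- The mild increment `Y_t - U_{t-s} Y_s`, for operators `U_τ` on the space of values. -/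
def mildIncr (U : ℝ → V →L[ℝ] V) (Y : Icc (0 : ℝ) T → V) (s t : Icc (0 : ℝ) T) : V :=
  Y t - U ((t : ℝ) - s) (Y s)

/-- `sup_{0 ≤ s < t ≤ T} ‖A_{s,t}‖ / |t - s|^β`, in `[0, ∞]`. -/
def holderNorm (β : ℝ) (A : Icc (0 : ℝ) T → Icc (0 : ℝ) T → V) : ℝ≥0∞ :=
  ⨆ (s : Icc (0 : ℝ) T) (t : Icc (0 : ℝ) T) (_ : s < t),
    ‖A s t‖ₑ / ENNReal.ofReal (((t : ℝ) - s) ^ β)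

/-- `sup_{t ∈ [0,T]} ‖Y_t‖`, in `[0, ∞]`. -/
def supNorm (Y : Icc (0 : ℝ) T → V) : ℝ≥0∞ := ⨆ t, ‖Y t‖ₑ

theorem holderNorm_incr_add_le (β : ℝ) (Y Z : Icc (0 : ℝ) T → V) :
    holderNorm β (incr (Y + Z)) ≤ holderNorm β (incr Y) + holderNorm β (incr Z) := by
  refine iSup_le fun s => iSup_le fun t => iSup_le fun h => ?_
  have e : incr (Y + Z) s t = incr Y s t + incr Z s t := by
    simp only [incr, Pi.add_apply]; abel
  calc _ ≤ (‖incr Y s t‖ₑ + ‖incr Z s t‖ₑ) / ENNReal.ofReal (((t : ℝ) - s) ^ β) := by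
        rw [e]; gcongr; exact enorm_add_le _ _
    _ = _ := ENNReal.add_div
    _ ≤ _ := by
        gcongr
        · exact le_iSup₂_of_le s t (le_iSup_of_le h le_rfl)
        · exact le_iSup₂_of_le s t (le_iSup_of_le h le_rfl)

theorem holderNorm_incr_smul_le (β c : ℝ) (Y : Icc (0 : ℝ) T → V) :
    holderNorm β (incr (c • Y)) ≤ ‖c‖ₑ * holderNorm β (incr Y) := by
  refine iSup_le fun s => iSup_le fun t => iSup_le fun h => ?_
  have e : incr (c • Y) s t = c • incr Y s t := by
    simp only [incr, Pi.smul_apply, smul_sub]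
  rw [e, enorm_smul, mul_div_assoc]
  gcongr
  exact le_iSup₂_of_le s t (le_iSup_of_le h le_rfl)

theorem holderNorm_incr_zero (β : ℝ) :
    holderNorm β (incr (0 : Icc (0 : ℝ) T → V)) = 0 := by
  simp [holderNorm, incr]

end Increments

/-- The space `C^α([0,T], ℝ^e)`. -/
def HolderPath (T α : ℝ) (e : ℕ) : Submodule ℝ (Icc (0 : ℝ) T → EuclideanSpace ℝ (Fin e)) where
  carrier := {η | Continuous η ∧ holderNorm α (incr η) < ⊤}
  zero_mem' := ⟨continuous_zero, by rw [holderNorm_incr_zero]; exact ENNReal.zero_lt_top⟩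
  add_mem' h h' := ⟨h.1.add h'.1,
    (holderNorm_incr_add_le _ _ _).trans_lt (ENNReal.add_lt_top.2 ⟨h.2, h'.2⟩)⟩
  smul_mem' c _ h := ⟨h.1.const_smul c,
    (holderNorm_incr_smul_le _ _ _).trans_lt (ENNReal.mul_lt_top enorm_lt_top h.2)⟩

section Processes

variable {Ω : Type*} {mΩ : MeasurableSpace Ω} {μ : Measure Ω} {m : ℝ≥0∞} {T : ℝ}
  {V V' : Type*} [NormedAddCommGroup V] [NormedSpace ℝ V]
  [NormedAddCommGroup V'] [NormedSpace ℝ V']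

/-- Processes are considered up to modification, that is, as paths `[0,T] → L^m(Ω, V)`.
Such a path is measurable and adapted if it is represented by a (jointly) measurable adapted
process `y : [0,T] × Ω → V`. -/
def IsMeasurableAdapted (ℱ : Filtration ℝ≥0 mΩ) (Y : Icc (0 : ℝ) T → Lp V m μ) : Prop :=
  ∃ y : Icc (0 : ℝ) T → Ω → V,
    StronglyMeasurable (fun p : Icc (0 : ℝ) T × Ω => y p.1 p.2) ∧
    (∀ t : Icc (0 : ℝ) T, StronglyMeasurable[ℱ ⟨(t : ℝ), t.2.1⟩] (y t)) ∧
    ∀ t : Icc (0 : ℝ) T, y t =ᵐ[μ] Y t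

variable [Fact (1 ≤ m)]

/-- The path `t ↦ f(Y_t)` in `L^m(Ω, V')`, for a bounded linear map `f : V → V'`. -/
def mapPath (f : V →L[ℝ] V') (Y : Icc (0 : ℝ) T → Lp V m μ) : Icc (0 : ℝ) T → Lp V' m μ :=
  fun t => f.compLpL m μ (Y t)

/-- Membership in `C^β L_m V`. -/
def MemC (ℱ : Filtration ℝ≥0 mΩ) (β : ℝ) (Y : Icc (0 : ℝ) T → Lp V m μ) : Prop :=
  Continuous Y ∧ IsMeasurableAdapted ℱ Y ∧ holderNorm β (incr Y) < ⊤

/-- The mild increment `Y_t - S_{t-s} Y_s` of a process with values in `H_γ`. -/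
def hatIncr {H : Type*} [NormedAddCommGroup H] [InnerProductSpace ℝ H] (S : ℝ → H →L[ℝ] H)
    {γ : ℝ} (Y : Icc (0 : ℝ) T → Lp (HScale S γ) m μ) :
    Icc (0 : ℝ) T → Icc (0 : ℝ) T → Lp (HScale S γ) m μ :=
  mildIncr (fun τ => (scaleSemigroup S γ τ).compLpL m μ) Y

/-- Membership in `Ĉ^β L_m H_γ`. -/
def MemHatC {H : Type*} [NormedAddCommGroup H] [InnerProductSpace ℝ H] (S : ℝ → H →L[ℝ] H)
    (ℱ : Filtration ℝ≥0 mΩ) (β : ℝ) {γ : ℝ} (Y : Icc (0 : ℝ) T → Lp (HScale S γ) m μ) : Prop :=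
  Continuous Y ∧ IsMeasurableAdapted ℱ Y ∧ holderNorm β (hatIncr S Y) < ⊤

theorem IsMeasurableAdapted.zero (ℱ : Filtration ℝ≥0 mΩ) :
    IsMeasurableAdapted ℱ (0 : Icc (0 : ℝ) T → Lp V m μ) :=
  ⟨0, stronglyMeasurable_zero, fun _ => stronglyMeasurable_zero,
    fun _ => (Lp.coeFn_zero V m μ).symm⟩

theorem IsMeasurableAdapted.add {ℱ : Filtration ℝ≥0 mΩ} {Y Z : Icc (0 : ℝ) T → Lp V m μ}
    (hY : IsMeasurableAdapted ℱ Y) (hZ : IsMeasurableAdapted ℱ Z) :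
    IsMeasurableAdapted ℱ (Y + Z) := by
  obtain ⟨y, h1, h2, h3⟩ := hY
  obtain ⟨z, k1, k2, k3⟩ := hZ
  exact ⟨fun t => y t + z t, h1.add k1, fun t => (h2 t).add (k2 t),
    fun t => ((h3 t).add (k3 t)).trans (Lp.coeFn_add (Y t) (Z t)).symm⟩

theorem IsMeasurableAdapted.smul {ℱ : Filtration ℝ≥0 mΩ} {Y : Icc (0 : ℝ) T → Lp V m μ}
    (hY : IsMeasurableAdapted ℱ Y) (c : ℝ) : IsMeasurableAdapted ℱ (c • Y) := by
  obtain ⟨y, h1, h2, h3⟩ := hY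
  exact ⟨fun t => c • y t, h1.const_smul c, fun t => (h2 t).const_smul c,
    fun t => ((h3 t).const_smul c).trans (Lp.coeFn_smul c (Y t)).symm⟩

theorem MemC.zero (ℱ : Filtration ℝ≥0 mΩ) (β : ℝ) :
    MemC ℱ β (0 : Icc (0 : ℝ) T → Lp V m μ) :=
  ⟨continuous_zero, .zero ℱ, by rw [holderNorm_incr_zero]; exact ENNReal.zero_lt_top⟩

theorem MemC.add {ℱ : Filtration ℝ≥0 mΩ} {β : ℝ} {Y Z : Icc (0 : ℝ) T → Lp V m μ}
    (hY : MemC ℱ β Y) (hZ : MemC ℱ β Z) : MemC ℱ β (Y + Z) :=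
  ⟨hY.1.add hZ.1, hY.2.1.add hZ.2.1,
    (holderNorm_incr_add_le _ _ _).trans_lt (ENNReal.add_lt_top.2 ⟨hY.2.2, hZ.2.2⟩)⟩

theorem MemC.smul {ℱ : Filtration ℝ≥0 mΩ} {β : ℝ} {Y : Icc (0 : ℝ) T → Lp V m μ}
    (hY : MemC ℱ β Y) (c : ℝ) : MemC ℱ β (c • Y) :=
  ⟨hY.1.const_smul c, hY.2.1.smul c,
    (holderNorm_incr_smul_le _ _ _).trans_lt (ENNReal.mul_lt_top enorm_lt_top hY.2.2)⟩

theorem mapPath_zero (f : V →L[ℝ] V') :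
    mapPath f (0 : Icc (0 : ℝ) T → Lp V m μ) = 0 :=
  funext fun _ => _root_.map_zero (f.compLpL m μ)

theorem mapPath_add (f : V →L[ℝ] V') (Y Z : Icc (0 : ℝ) T → Lp V m μ) :
    mapPath f (Y + Z) = mapPath f Y + mapPath f Z :=
  funext fun t => _root_.map_add (f.compLpL m μ) (Y t) (Z t)

theorem mapPath_smul (f : V →L[ℝ] V') (c : ℝ) (Y : Icc (0 : ℝ) T → Lp V m μ) :
    mapPath f (c • Y) = c • mapPath f Y :=
  funext fun t => _root_.map_smul (f.compLpL m μ) c (Y t)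

variable (μ m T) in
/-- The space `C^β L_m V' ∩ C L_m V` for an inclusion `ι : V → V'`. -/
def ESpace (ℱ : Filtration ℝ≥0 mΩ) (β : ℝ) (ι : V →L[ℝ] V') :
    Submodule ℝ (Icc (0 : ℝ) T → Lp V m μ) where
  carrier := {Y | MemC ℱ β (mapPath ι Y) ∧ Continuous Y}
  zero_mem' := ⟨by rw [mapPath_zero]; exact .zero ℱ β, continuous_zero⟩
  add_mem' h h' := ⟨by rw [mapPath_add]; exact h.1.add h'.1, h.2.add h'.2⟩
  smul_mem' c _ h := ⟨by rw [mapPath_smul]; exact h.1.smul c, h.2.const_smul c⟩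

/-- The norm `‖δY‖_{β,m,V'} + ‖Y‖_{0,m,V}` of `C^β L_m V' ∩ C L_m V`, in `[0, ∞]`. -/
def eSpaceNorm (β : ℝ) (ι : V →L[ℝ] V') (Y : Icc (0 : ℝ) T → Lp V m μ) : ℝ≥0∞ :=
  holderNorm β (incr (mapPath ι Y)) + supNorm Y

end Processes

/-! ### Riemann sums and the convolution -/

/-- A partition `s = r_0 < r_1 < ⋯ < r_n = t` of an interval. -/
structure IntervalPartition {I : Type*} [Preorder I] (s t : I) where
  /-- the number of subintervals -/
  n : ℕ
  /-- the partition points -/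
  pts : Fin (n + 1) → I
  strictMono : StrictMono pts
  first : pts 0 = s
  last : pts (Fin.last n) = t

/-- The mesh size of a partition (`0` if there is no subinterval). -/
def IntervalPartition.mesh {T : ℝ} {s t : Icc (0 : ℝ) T} (π : IntervalPartition s t) : ℝ :=
  ⨆ i : Fin π.n, ((π.pts i.succ : ℝ) - π.pts i.castSucc)

section Convolution

variable {Ω : Type*} {mΩ : MeasurableSpace Ω} {μ : Measure Ω} {m : ℝ≥0∞} [Fact (1 ≤ m)] {T : ℝ}
  {H : Type*} [NormedAddCommGroup H] [InnerProductSpace ℝ H]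

/-- The Riemann sum `∑_{[r,v] ∈ π} S_{t-r} Y_r δη_{r,v}` in `L^m(Ω, H_γ)`. -/
def riemannSum (S : ℝ → H →L[ℝ] H) {e : ℕ} {γ : ℝ}
    (η : Icc (0 : ℝ) T → EuclideanSpace ℝ (Fin e)) (Y : Icc (0 : ℝ) T → Lp (HScaleE S e γ) m μ)
    {s t : Icc (0 : ℝ) T} (π : IntervalPartition s t) : Lp (HScale S γ) m μ :=
  ∑ i : Fin π.n,
    (semigroupApply S e γ ((t : ℝ) - π.pts i.castSucc)
      (incr η (π.pts i.castSucc) (π.pts i.succ))).compLpL m μ (Y (π.pts i.castSucc))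

/-- `Z = ∫_0^· S_{·-r} Y_r dη_r`, as a process in `Ĉ^α L_m H_κ` with `κ ≤ γ`: `Z_0 = 0`, and for
all `0 ≤ s ≤ t ≤ T` the mild increment of `Z` is the limit in `L^m(Ω, H_κ)` of the Riemann sums
over the partitions of `[s,t]`, as the mesh size tends to `0`. -/
structure IsYoungConvolution (S : ℝ → H →L[ℝ] H) (ℱ : Filtration ℝ≥0 mΩ) (α : ℝ) {e : ℕ}
    {γ κ : ℝ} (η : Icc (0 : ℝ) T → EuclideanSpace ℝ (Fin e))
    (Y : Icc (0 : ℝ) T → Lp (HScaleE S e γ) m μ) (Z : Icc (0 : ℝ) T → Lp (HScale S κ) m μ) :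
    Prop where
  memHatC : MemHatC S ℱ α Z
  zero : ∀ t : Icc (0 : ℝ) T, (t : ℝ) = 0 → Z t = 0
  tendsto : ∀ s t : Icc (0 : ℝ) T, s ≤ t →
    Tendsto (fun π : IntervalPartition s t => (embed S κ γ).compLpL m μ (riemannSum S η Y π))
      (comap IntervalPartition.mesh (𝓝 0)) (𝓝 (hatIncr S Z s t))

end Convolution

end YoungConv

end

open YoungConv

open MeasureTheory Set Filter Topology
open scoped NNReal ENNReal

set_option linter.unusedSectionVars false

noncomputable section

namespace YoungConv

/-! ### Smoothing properties of analytic semigroups -/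

section Smoothing

variable {H : Type*} [NormedAddCommGroup H] [InnerProductSpace ℝ H] {S : ℝ → H →L[ℝ] H}

/-! For a fixed endpoint τ, the convolution is the Young integral of the germ Ξ^τ(u,v) = S_{τ-u} Y_u
(η_v - η_u). Its defect on u ≤ v ≤ w is S_{τ-v} applied to [(S_{v-u} - 1) Y_u - (Y_v - Y_u)](η_w -
η_v). In H_{γ-β} the bracket has order (v-u)^β: the operator S_{v-u} - 1 gains this power when β
degrees of space regularity are given up, and the increment of Y has it by assumption. The defect
thus has order α + β > 1 (`exists_germ_isAlmostAdditive`), and the sewing lemma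
(`IsAlmostAdditive.exists_isSewing`) gives a primitive g^τ. Its increments are limits of Riemann
sums, hence determined by the germ. So S_{t-τ} maps increments of g^τ to increments of g^t, the
process Z_t = g^t(t) - g^t(0) has mild increments g^t(t) - g^t(s), and measurability passes to the
limit. Uniqueness and bilinearity also follow from uniqueness of limits.

Space regularity uses the smoothing of S (`exists_lift`). The integral over [u,u+h] with endpoint
u+2h is S_h J, where J is a germ value in H_γ of size h^α plus a remainder in H_{γ-β} of size
h^{α+β}. Passing to H_{γ+θ} costs h^{-θ} and h^{-θ-β}, so both parts have size h^{α-θ}. Cutting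
[s,t] into pieces that halve towards t gives a geometric series, convergent because θ < α.

Time regularity comes from δZ_{s,t} = (mild increment) + (S_{t-s} - 1) Z_s, applied with several
space exponents to the same process (`exists_convolution`).

The bounds on S rest on the Cauchy estimate in a sector. Positive powers never appear as unbounded
operators: (-L)^θ S_t is represented by a bounded R with (-L)^{-θ} R = S_t, and injectivity of the
negative powers makes R unique. -/

instance [CompleteSpace H] : CompleteSpace (Cplx H) :=
  inferInstanceAs (CompleteSpace (WithLp 2 (H × H)))

theorem Cplx.norm_re_le (v : Cplx H) : ‖v.re‖ ≤ ‖v‖ := by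
  refine abs_le_of_sq_le_sq' ?_ (norm_nonneg _) |>.2
  rw [Cplx.norm_sq]
  exact le_add_of_nonneg_right (sq_nonneg _)

/-- The inclusion of a real Hilbert space into its complexification. -/
def Cplx.inclusion : H →L[ℝ] Cplx H :=
  LinearMap.mkContinuous
    { toFun := fun x => Cplx.mk x 0
      map_add' := fun x y => Cplx.ext' rfl (add_zero (0 : H)).symm
      map_smul' := fun r x => Cplx.ext'
        (by
          change r • x = ((r : ℂ)).re • x - ((r : ℂ)).im • (0 : H)
          simp)
        (by
          change (0 : H) = ((r : ℂ)).re • (0 : H) + ((r : ℂ)).im • x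
          simp) } 1
    fun x => by rw [one_mul]; exact (Cplx.norm_mk_zero x).le

/-- The real part, as a bounded operator. -/
def Cplx.reL : Cplx H →L[ℝ] H :=
  LinearMap.mkContinuous
    { toFun := fun v => v.re
      map_add' := fun _ _ => rfl
      map_smul' := fun r v => by
        change ((r : ℂ)).re • v.re - ((r : ℂ)).im • v.im = r • v.re
        simp } 1
    fun v => by
      rw [one_mul]
      exact Cplx.norm_re_le v

/-- The compression of a bounded operator on the complexification to the real part. -/
def Cplx.compress : (Cplx H →L[ℂ] Cplx H) →L[ℝ] (H →L[ℝ] H) :=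
  (ContinuousLinearMap.compL ℝ H (Cplx H) H Cplx.reL) ∘L
    ((ContinuousLinearMap.compL ℝ H (Cplx H) (Cplx H)).flip Cplx.inclusion) ∘L
      ContinuousLinearMap.restrictScalarsL ℂ (Cplx H) (Cplx H) ℝ ℝ

theorem Cplx.compress_apply (A : Cplx H →L[ℂ] Cplx H) (x : H) :
    Cplx.compress A x = (A (Cplx.mk x 0)).re := rfl

theorem Cplx.norm_compress_le (A : Cplx H →L[ℂ] Cplx H) : ‖Cplx.compress A‖ ≤ ‖A‖ := by
  refine ContinuousLinearMap.opNorm_le_bound _ (norm_nonneg _) fun x => ?_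
  rw [Cplx.compress_apply]
  refine (Cplx.norm_re_le _).trans ((A.le_opNorm _).trans_eq ?_)
  rw [Cplx.norm_mk_zero]

/-- Uniform boundedness: otherwise some z_n → 0 in D have ‖U z_n‖ > n, although U(z_n) v converges,
hence is bounded, for each v. -/
theorem exists_bound_near_zero [CompleteSpace H] {D : Set ℂ} {U : ℂ → Cplx H →L[ℂ] Cplx H}
    (hU : ∀ v : Cplx H, Tendsto (fun z => U z v) (𝓝[D] 0) (𝓝 v)) :
    ∃ δ K : ℝ, 0 < δ ∧ 0 ≤ K ∧ ∀ z ∈ D, ‖z‖ < δ → ‖U z‖ ≤ K := by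
  by_contra! hcon
  have hseq : ∀ n : ℕ, ∃ z ∈ D, ‖z‖ < 1 / ((n : ℝ) + 1) ∧ (n : ℝ) < ‖U z‖ := fun n =>
    hcon (1 / ((n : ℝ) + 1)) n (by positivity) (by positivity)
  choose z hz hz1 hz2 using hseq
  have hlim : Tendsto z atTop (𝓝[D] 0) := by
    refine tendsto_nhdsWithin_iff.2 ⟨?_, Eventually.of_forall hz⟩
    refine squeeze_zero_norm (fun n => (hz1 n).le) ?_
    exact tendsto_one_div_add_atTop_nhds_zero_nat
  obtain ⟨C, hC⟩ := banach_steinhaus (g := fun n => U (z n)) fun v => by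
    obtain ⟨C, hC⟩ := (Metric.isBounded_range_of_tendsto _
      ((hU v).comp hlim)).exists_norm_le
    exact ⟨C, fun n => hC _ ⟨n, rfl⟩⟩
  obtain ⟨n, hn⟩ := exists_nat_gt C
  exact absurd (hC n) (not_le.2 (hn.trans (hz2 n)))

/-- The sector is invariant under positive dilations, so a disc about 1, found by continuity of the
argument, suffices. Its radius scales with t, which turns the Cauchy estimate into a bound of order
1/t. -/
theorem exists_closedBall_subset_sector {φ : ℝ} (hφ : 0 < φ) :
    ∃ c : ℝ, 0 < c ∧ c < 1 ∧ ∀ t : ℝ, 0 < t →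
      Metric.closedBall (t : ℂ) (c * t) ⊆ sector φ := by
  have hcont : ContinuousAt Complex.arg 1 :=
    Complex.continuousAt_arg (by simp [Complex.slitPlane])
  obtain ⟨ε, hε, h⟩ := Metric.continuousAt_iff.1 hcont φ hφ
  refine ⟨min (ε / 2) (1 / 2), by positivity, by
    exact (min_le_right _ _).trans_lt (by norm_num), fun t ht z hz => ?_⟩
  have htc : (t : ℂ) ≠ 0 := by exact_mod_cast ht.ne'
  have hzt : z = (t : ℂ) * (z / t) := by
    field_simp
  have hd : dist (z / t) 1 ≤ min (ε / 2) (1 / 2) := by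
    rw [Metric.mem_closedBall, dist_eq_norm] at hz
    rw [dist_eq_norm, div_sub_one htc, norm_div, Complex.norm_real,
      Real.norm_of_nonneg ht.le, div_le_iff₀ ht]
    exact hz
  refine ⟨?_, ?_⟩
  · rintro rfl
    rw [zero_div, dist_zero_left, norm_one] at hd
    have := hd.trans (min_le_right _ _)
    norm_num at this
  · rw [hzt, Complex.arg_real_mul _ ht]
    have := h (hd.trans_lt ((min_le_left _ _).trans_lt (half_lt_self hε)))
    simpa [dist_eq_norm] using this

variable [CompleteSpace H]

/-- The derivative of an analytic semigroup is `O(1/t)` as `t → 0`. -/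
theorem IsAnalyticSemigroup.exists_hasDerivAt (hS : IsAnalyticSemigroup S) :
    ∃ δ C : ℝ, 0 < δ ∧ 0 ≤ C ∧ ∀ t : ℝ, 0 < t → t < δ →
      ∃ D : H →L[ℝ] H, HasDerivAt S D t ∧ ‖D‖ ≤ C / t := by
  obtain ⟨φ, hφ, -, U, hU, -, hU0, hUS⟩ := hS.analytic
  obtain ⟨δ, K, hδ, hK, hb⟩ := exists_bound_near_zero hU0
  obtain ⟨c, hc, hc1, hsub⟩ := exists_closedBall_subset_sector hφ
  -- Since c < 1, points of the disc of radius c t about t have norm below 2t < δ, where U is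
  -- bounded by K.
  refine ⟨δ / 2, K / c, by positivity, by positivity, fun t ht htδ => ?_⟩
  have hmem : Metric.closedBall (t : ℂ) (c * t) ∈ 𝓝 (t : ℂ) :=
    Metric.closedBall_mem_nhds _ (by positivity)
  have hdiff : DifferentiableAt ℂ U t :=
    (hU.mono (hsub t ht)).differentiableAt hmem
  have hder : HasDerivAt (fun s : ℝ => U (s : ℂ)) (deriv U t) t := by
    have h := hdiff.hasDerivAt.scomp t Complex.ofRealCLM.hasDerivAt
    simpa [Function.comp_def] using h
  refine ⟨Cplx.compress (deriv U t), ?_, ?_⟩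
  · have h1 := Cplx.compress.hasFDerivAt.comp_hasDerivAt t hder
    refine h1.congr_of_eventuallyEq ?_
    filter_upwards [Ioi_mem_nhds ht] with s hs
    ext x
    simp only [Function.comp_apply]
    rw [Cplx.compress_apply, hUS s hs x]
    rfl
  · have hcauchy : ‖deriv U t‖ ≤ K / (c * t) := by
      refine Complex.norm_deriv_le_of_forall_mem_sphere_norm_le (by positivity) ?_ ?_
      · refine DifferentiableOn.diffContOnCl ?_
        rw [closure_ball _ (by positivity)]
        exact hU.mono (hsub t ht)
      · intro z hz
        refine hb z (hsub t ht (Metric.sphere_subset_closedBall hz)) ?_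
        have h1 : ‖z‖ ≤ ‖(t : ℂ)‖ + ‖z - t‖ := by
          simpa using norm_add_le (t : ℂ) (z - t)
        rw [Complex.norm_real, Real.norm_of_nonneg ht.le, mem_sphere_iff_norm.1 hz] at h1
        nlinarith
    exact ((Cplx.norm_compress_le _).trans hcauchy).trans_eq (by field_simp)

/-- The operator (-L)^{-1} turns the difference quotient of -S at t into the average of S_r S_t x
over r in [0,h], which tends to S_t x. Thus -S'_t serves as (-L) S_t. -/
theorem negPow_one_comp_deriv (hS : IsAnalyticSemigroup S) (hν : IsExpStable S) {t : ℝ}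
    (ht : 0 < t) {D : H →L[ℝ] H} (hD : HasDerivAt S D t) : negPow S 1 ∘L (-D) = S t := by
  ext x
  have h1 : HasDerivAt (fun s => S s x) (D x) t :=
    (ContinuousLinearMap.apply ℝ H x).hasFDerivAt.comp_hasDerivAt t hD
  have h2 := h1.tendsto_slope_zero_right
  have h3 : Tendsto (fun h : ℝ => negPow S 1 (-(h⁻¹ • (S (t + h) x - S t x)))) (𝓝[>] 0)
      (𝓝 (negPow S 1 (-(D x)))) := ((negPow S 1).continuous.tendsto _).comp h2.neg
  refine tendsto_nhds_unique h3 ((tendsto_average hS (S t x)).congr' ?_)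
  filter_upwards [self_mem_nhdsWithin] with h hh
  have hh : 0 < h := hh
  rw [← negPow_one_apply_sub hS hν hh.le, ← _root_.map_smul, add_comm t h,
    hS.map_add h t hh.le ht.le, ← smul_neg, neg_sub]
  rfl

theorem exists_norm_le_of_isExpStable (hν : IsExpStable S) :
    ∃ M : ℝ, 0 < M ∧ ∀ t : ℝ, 0 ≤ t → ‖S t‖ ≤ M := by
  obtain ⟨M, ν, hν0, hM⟩ := hν
  refine ⟨|M| + 1, by positivity, fun t ht => (hM t ht).trans ?_⟩
  calc M * Real.exp (-(ν * t)) ≤ |M| * 1 := by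
        gcongr
        · exact le_abs_self M
        · exact Real.exp_le_one_iff.2 (by simpa using mul_nonneg hν0.le ht)
    _ ≤ _ := by linarith

/-- `‖(-L) S_t‖ ≤ C / t`. -/
theorem exists_smoothing_one (hS : IsAnalyticSemigroup S) (hν : IsExpStable S) :
    ∃ C : ℝ, 0 ≤ C ∧ ∀ t : ℝ, 0 < t →
      ∃ R : H →L[ℝ] H, negPow S 1 ∘L R = S t ∧ ‖R‖ ≤ C / t := by
  obtain ⟨δ, C, hδ, hC, hder⟩ := hS.exists_hasDerivAt
  obtain ⟨D, hD, -⟩ := hder (δ / 2) (by positivity) (by linarith)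
  have hν' := hν
  obtain ⟨M, ν, hν0, hM⟩ := hν'
  refine ⟨max C (‖D‖ * (|M| * (Real.exp (ν * (δ / 2)) / ν))), le_max_of_le_left hC,
    fun t ht => ?_⟩
  rcases lt_or_ge t δ with h | h
  · obtain ⟨D', hD', hn⟩ := hder t ht h
    refine ⟨-D', negPow_one_comp_deriv hS hν ht hD', ?_⟩
    rw [norm_neg]
    exact hn.trans (by gcongr; exact le_max_left _ _)
  -- Away from 0, S_t = S_{δ/2} S_{t-δ/2}: the first factor smooths, and the exponential decay of
  -- the second beats 1/t.
  · refine ⟨(-D) ∘L S (t - δ / 2), ?_, ?_⟩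
    · rw [← ContinuousLinearMap.comp_assoc, negPow_one_comp_deriv hS hν (by positivity) hD,
        ← hS.map_add _ _ (by positivity) (by linarith)]
      congr 1; ring
    · have h1 := hM (t - δ / 2) (by linarith)
      have h2 : Real.exp (-(ν * (t - δ / 2))) ≤ Real.exp (ν * (δ / 2)) / ν / t := by
        rw [div_div, le_div_iff₀ (by positivity),
          show -(ν * (t - δ / 2)) = -(ν * t) + ν * (δ / 2) by ring, Real.exp_add]
        have h3 : Real.exp (-(ν * t)) * (ν * t) ≤ 1 := by
          rw [Real.exp_neg, inv_mul_le_iff₀ (Real.exp_pos _), mul_one]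
          linarith [Real.add_one_le_exp (ν * t)]
        calc _ = (Real.exp (-(ν * t)) * (ν * t)) * Real.exp (ν * (δ / 2)) := by ring
          _ ≤ 1 * Real.exp (ν * (δ / 2)) := by gcongr
          _ = _ := one_mul _
      calc ‖(-D) ∘L S (t - δ / 2)‖ ≤ ‖-D‖ * ‖S (t - δ / 2)‖ :=
            ContinuousLinearMap.opNorm_comp_le _ _
        _ ≤ ‖D‖ * (|M| * (Real.exp (ν * (δ / 2)) / ν / t)) := by
            rw [norm_neg]
            gcongr
            exact h1.trans (by gcongr; exact le_abs_self M)
        _ = (‖D‖ * (|M| * (Real.exp (ν * (δ / 2)) / ν))) / t := by ring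
        _ ≤ _ := by gcongr; exact le_max_right _ _

/-- A bounded operator `R` with `(-L)^{-a} R = S_t` commutes with the negative powers. -/
theorem negPow_comp_eq_comp_negPow (hS : IsAnalyticSemigroup S) (hν : IsExpStable S)
    {a b t : ℝ} (ha : 0 ≤ a) (hb : 0 ≤ b) (ht : 0 ≤ t) {R : H →L[ℝ] H}
    (hR : negPow S a ∘L R = S t) : negPow S b ∘L R = R ∘L negPow S b := by
  ext x
  -- Equality is tested after the injective operator (-L)^{-a}, which turns R into S_t.
  apply negPow_injective hS hν ha
  have h1 := DFunLike.congr_fun (negPow_comp hS hν ha hb) (R x)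
  have h2 := DFunLike.congr_fun (negPow_comp hS hν hb ha) (R x)
  have h3 := DFunLike.congr_fun hR x
  have h4 := DFunLike.congr_fun hR (negPow S b x)
  have h5 := DFunLike.congr_fun (negPow_comm hS hν hb ht) x
  simp only [ContinuousLinearMap.comp_apply] at *
  rw [h1, add_comm, ← h2, h3, h4, h5]

/-- The two bounds cross at r = t. The constant one is integrable near 0 since p > 0, the other near
infinity since p < 1. -/
theorem norm_integral_rpow_smul_le {E : Type*} [NormedAddCommGroup E] [NormedSpace ℝ E]
    {f : ℝ → E} {p K t : ℝ} (hp : 0 < p) (hp1 : p < 1) (ht : 0 < t)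
    (h1 : ∀ r, 0 < r → ‖f r‖ ≤ K) (h2 : ∀ r, 0 < r → ‖f r‖ ≤ K * (t / r)) :
    ‖∫ r in Ioi (0 : ℝ), r ^ (p - 1) • f r‖ ≤ K * (1 / p + 1 / (1 - p)) * t ^ p := by
  set g : ℝ → ℝ := fun r => if r ≤ t then K * r ^ (p - 1) else K * t * r ^ (p - 2) with hg
  have hg1 : EqOn g (fun r => K * r ^ (p - 1)) (Ioc 0 t) := fun r hr => if_pos hr.2
  have hg2 : EqOn g (fun r => K * t * r ^ (p - 2)) (Ioi t) := fun r hr => if_neg (not_le.2 hr)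
  have hi1 : IntegrableOn g (Ioc 0 t) := by
    refine IntegrableOn.congr_fun ?_ hg1.symm measurableSet_Ioc
    have := (intervalIntegral.intervalIntegrable_rpow' (a := 0) (b := t)
      (r := p - 1) (by linarith)).1
    exact this.const_mul K
  have hi2 : IntegrableOn g (Ioi t) := by
    refine IntegrableOn.congr_fun ?_ hg2.symm measurableSet_Ioi
    exact (integrableOn_Ioi_rpow_of_lt (by linarith) ht).const_mul (K * t)
  have hu : Ioi (0 : ℝ) = Ioc 0 t ∪ Ioi t := (Ioc_union_Ioi_eq_Ioi ht.le).symm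
  have hi : IntegrableOn g (Ioi 0) := by rw [hu]; exact hi1.union hi2
  refine (norm_integral_le_of_norm_le hi ?_).trans_eq ?_
  · refine (ae_restrict_iff' measurableSet_Ioi).2 (ae_of_all _ fun r hr => ?_)
    have hr : 0 < r := hr
    rw [norm_smul, Real.norm_of_nonneg (Real.rpow_nonneg hr.le _)]
    simp only [hg]
    split_ifs with h
    · rw [mul_comm]; gcongr; exact h1 r hr
    · calc r ^ (p - 1) * ‖f r‖ ≤ r ^ (p - 1) * (K * (t / r)) := by gcongr; exact h2 r hr
        _ = K * t * (r ^ (p - 1) / r) := by ring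
        _ = _ := by rw [← Real.rpow_sub_one hr.ne']; congr 2; ring
  · rw [hu, setIntegral_union Ioc_disjoint_Ioi_same measurableSet_Ioi hi1 hi2,
      setIntegral_congr_fun measurableSet_Ioc hg1, setIntegral_congr_fun measurableSet_Ioi hg2,
      integral_const_mul, integral_const_mul, integral_Ioi_rpow_of_lt (by linarith) ht,
      ← intervalIntegral.integral_of_le ht.le, integral_rpow (Or.inl (by linarith)),
      show p - 2 + 1 = p - 1 by ring, show p - 1 + 1 = p by ring, Real.zero_rpow hp.ne',
      Real.rpow_sub_one ht.ne']
    have : p - 1 ≠ 0 := by linarith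
    have : 1 - p ≠ 0 := by linarith
    rw [show 1 - p = -(p - 1) by ring]
    field_simp
    ring

/-- `‖(-L)^θ S_t‖ ≤ C t^{-θ}` for `0 ≤ θ < 1`. -/
theorem exists_smoothing_lt_one (hS : IsAnalyticSemigroup S) (hν : IsExpStable S) {θ : ℝ}
    (hθ : 0 ≤ θ) (hθ1 : θ < 1) :
    ∃ C : ℝ, 0 ≤ C ∧ ∀ t : ℝ, 0 < t →
      ∃ R : H →L[ℝ] H, negPow S θ ∘L R = S t ∧ ‖R‖ ≤ C * t ^ (-θ) := by
  rcases hθ.eq_or_lt with rfl | hθ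
  · obtain ⟨M, hM0, hM⟩ := exists_norm_le_of_isExpStable hν
    exact ⟨M, hM0.le, fun t ht => ⟨S t, by rw [negPow_zero]; rfl, by simpa using hM t ht.le⟩⟩
  obtain ⟨C, hC, hR⟩ := exists_smoothing_one hS hν
  refine ⟨|(Real.Gamma (1 - θ))⁻¹| * (C * (1 / (1 - θ) + 1 / (1 - (1 - θ)))), by
    have : 0 < 1 - θ := by linarith
    have : 0 < 1 - (1 - θ) := by linarith
    positivity, fun t ht => ?_⟩
  obtain ⟨R, hR1, hR2⟩ := hR t ht
  -- The witness is (-L)^θ S_t = (-L)^{-(1-θ)} (-L) S_t.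
  refine ⟨negPow S (1 - θ) ∘L R, ?_, ?_⟩
  · rw [← ContinuousLinearMap.comp_assoc, negPow_comp hS hν hθ.le (by linarith),
      add_sub_cancel, hR1]
  -- By injectivity S_r R is (-L) S_{r+t}. The resulting bound lies below both C/t and (C/t)(t/r),
  -- as the splitting at r = t requires.
  · have hshift : ∀ r, 0 < r → ‖S r ∘L R‖ ≤ C / (r + t) := fun r hr => by
      obtain ⟨R', hR'1, hR'2⟩ := hR (r + t) (by positivity)
      have : S r ∘L R = R' := by
        ext x
        apply negPow_one_injective hS hν
        have e1 := DFunLike.congr_fun (negPow_comm hS hν zero_le_one hr.le) (R x)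
        have e2 := DFunLike.congr_fun hR1 x
        have e3 := DFunLike.congr_fun hR'1 x
        rw [hS.map_add r t hr.le ht.le] at e3
        simp only [ContinuousLinearMap.comp_apply] at *
        rw [e1, e2, e3]
      rw [this]
      exact hR'2
    have hint : (∫ r in Ioi (0 : ℝ), r ^ (1 - θ - 1) • S r) ∘L R =
        ∫ r in Ioi (0 : ℝ), r ^ (1 - θ - 1) • (S r ∘L R) := by
      have h := ((ContinuousLinearMap.compL ℝ H H H).flip R).integral_comp_comm
        (integrableOn_negPow hS hν (γ := 1 - θ) (by linarith))
      simp only [ContinuousLinearMap.compL_apply, ContinuousLinearMap.flip_apply] at h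
      rw [← h]
      rfl
    rw [negPow_of_pos (by linarith), ContinuousLinearMap.smul_comp, hint, norm_smul,
      Real.norm_eq_abs, mul_assoc]
    gcongr
    refine (norm_integral_rpow_smul_le (K := C / t) (t := t) (by linarith) (by linarith)
      ht (fun r hr => (hshift r hr).trans ?_)
      (fun r hr => (hshift r hr).trans ?_)).trans_eq ?_
    · gcongr; linarith
    · calc C / (r + t) ≤ C / r := by gcongr; linarith
        _ = _ := by field_simp
    · rw [Real.rpow_sub ht, Real.rpow_one, Real.rpow_neg ht.le]
      field_simp

/-- `‖(-L)^θ S_t‖ ≤ C t^{-θ}` for `0 ≤ θ < 2`. -/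
theorem exists_smoothing (hS : IsAnalyticSemigroup S) (hν : IsExpStable S) {θ : ℝ}
    (hθ : 0 ≤ θ) (hθ2 : θ < 2) :
    ∃ C : ℝ, 0 ≤ C ∧ ∀ t : ℝ, 0 < t →
      ∃ R : H →L[ℝ] H, negPow S θ ∘L R = S t ∧ ‖R‖ ≤ C * t ^ (-θ) := by
  -- Half of the power is taken from each factor of S_t = S_{t/2} S_{t/2}. Exponents above 1 matter
  -- because the lift from H_{γ-β} to H_{γ+θ} needs θ + β.
  obtain ⟨C, hC, hR⟩ := exists_smoothing_lt_one hS hν (θ := θ / 2) (by linarith) (by linarith)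
  refine ⟨C * C * 2 ^ θ, by positivity, fun t ht => ?_⟩
  obtain ⟨R, hR1, hR2⟩ := hR (t / 2) (by positivity)
  refine ⟨R ∘L R, ?_, ?_⟩
  · have hcomm := negPow_comp_eq_comp_negPow hS hν (b := θ / 2) (by linarith) (by linarith)
      (by linarith) hR1
    have hadd := hS.map_add (t / 2) (t / 2) (by linarith) (by linarith)
    rw [add_halves] at hadd
    have hsq := negPow_comp hS hν (a := θ / 2) (b := θ / 2) (by linarith) (by linarith)
    rw [add_halves] at hsq
    rw [hadd, ← hsq, ContinuousLinearMap.comp_assoc,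
      ← ContinuousLinearMap.comp_assoc (negPow S (θ / 2)) R R, hcomm,
      ContinuousLinearMap.comp_assoc, hR1, ← ContinuousLinearMap.comp_assoc, hR1]
  · calc ‖R ∘L R‖ ≤ ‖R‖ * ‖R‖ := ContinuousLinearMap.opNorm_comp_le _ _
      _ ≤ (C * (t / 2) ^ (-(θ / 2))) * (C * (t / 2) ^ (-(θ / 2))) := by gcongr
      _ = C * C * ((t / 2) ^ (-(θ / 2)) * (t / 2) ^ (-(θ / 2))) := by ring
      _ = _ := by
        rw [← Real.rpow_add (by positivity), show -(θ / 2) + -(θ / 2) = -θ by ring,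
          Real.div_rpow ht.le (by norm_num), Real.rpow_neg (by norm_num : (0 : ℝ) ≤ 2) θ]
        field_simp

/-- `‖(S_t - 1) (-L)^{-p}‖ ≤ C t^p` for `0 < p < 1`. -/
theorem exists_norm_sub_negPow_le (hS : IsAnalyticSemigroup S) (hν : IsExpStable S) {p : ℝ}
    (hp : 0 < p) (hp1 : p < 1) :
    ∃ C : ℝ, 0 ≤ C ∧ ∀ t : ℝ, 0 ≤ t →
      ‖S t ∘L negPow S p - negPow S p‖ ≤ C * t ^ p := by
  obtain ⟨M, hM0, hM⟩ := exists_norm_le_of_isExpStable hν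
  obtain ⟨C, hC, hR⟩ := exists_smoothing_one hS hν
  refine ⟨|(Real.Gamma p)⁻¹| * ((2 * M + C * M) * (1 / p + 1 / (1 - p))), by
    have : 0 < 1 - p := by linarith
    positivity, fun t ht => ?_⟩
  rcases ht.eq_or_lt with rfl | ht
  · have : (ContinuousLinearMap.id ℝ H) ∘L negPow S p = negPow S p := rfl
    rw [hS.map_zero, this, sub_self, norm_zero, Real.zero_rpow hp.ne', mul_zero]
  have hi := integrableOn_negPow hS hν hp
  have hint : S t ∘L (∫ r in Ioi (0 : ℝ), r ^ (p - 1) • S r) =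
      ∫ r in Ioi (0 : ℝ), r ^ (p - 1) • (S t ∘L S r) := by
    have h := (ContinuousLinearMap.compL ℝ H H H (S t)).integral_comp_comm hi
    simp only [ContinuousLinearMap.compL_apply] at h
    rw [← h]
    simp only [ContinuousLinearMap.comp_smul]
  have hi' : IntegrableOn (fun r : ℝ => r ^ (p - 1) • (S t ∘L S r)) (Ioi 0) := by
    have h := (ContinuousLinearMap.compL ℝ H H H (S t)).integrable_comp hi
    simp only [ContinuousLinearMap.compL_apply, ContinuousLinearMap.comp_smul] at h
    exact h
  -- The integrand S_{t+r} - S_r is bounded outright, and for large r has size t/r, because it is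
  -- -(-L)S_r applied to the integral of S over [0,t].
  have key : S t ∘L negPow S p - negPow S p =
      (Real.Gamma p)⁻¹ • ∫ r in Ioi (0 : ℝ), r ^ (p - 1) • (S t ∘L S r - S r) := by
    rw [negPow_of_pos hp, ContinuousLinearMap.comp_smul, hint, ← smul_sub, ← integral_sub hi' hi]
    simp only [smul_sub]
  rw [key, norm_smul, Real.norm_eq_abs, mul_assoc]
  gcongr
  refine norm_integral_rpow_smul_le hp hp1 ht (fun r hr => ?_) (fun r hr => ?_)
  · rw [← hS.map_add t r ht.le hr.le]
    refine (norm_sub_le _ _).trans ?_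
    have := hM (t + r) (by positivity)
    have := hM r hr.le
    have : 0 ≤ C * M := by positivity
    linarith
  · obtain ⟨R, hR1, hR2⟩ := hR r hr
    have hcomm := negPow_comp_eq_comp_negPow hS hν (b := 1) zero_le_one zero_le_one hr.le hR1
    have hbound : ‖S t ∘L S r - S r‖ ≤ C / r * (M * t) := by
      refine ContinuousLinearMap.opNorm_le_bound _ (by positivity) fun x => ?_
      have e : (S t ∘L S r - S r) x = -(R (∫ u in (0 : ℝ)..t, S u x)) := by
        rw [← negPow_one_apply_sub hS hν ht.le]
        have e1 := DFunLike.congr_fun hcomm (x - S t x)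
        have e2 := DFunLike.congr_fun hR1 (x - S t x)
        have e3 := DFunLike.congr_fun (hS.map_add t r ht.le hr.le) x
        have e4 := DFunLike.congr_fun (hS.map_add r t hr.le ht.le) x
        rw [add_comm t r] at e3
        simp only [ContinuousLinearMap.comp_apply, sub_apply] at *
        rw [← e1, e2, _root_.map_sub, neg_sub, ← e3, e4]
      rw [e, norm_neg]
      have h1 : ‖∫ u in (0 : ℝ)..t, S u x‖ ≤ M * ‖x‖ * |t - 0| := by
        refine intervalIntegral.norm_integral_le_of_norm_le_const fun u hu => ?_
        rw [uIoc_of_le ht.le] at hu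
        exact (ContinuousLinearMap.le_opNorm _ _).trans (by gcongr; exact hM u hu.1.le)
      rw [sub_zero, abs_of_pos ht] at h1
      calc ‖R (∫ u in (0 : ℝ)..t, S u x)‖ ≤ ‖R‖ * ‖∫ u in (0 : ℝ)..t, S u x‖ :=
            ContinuousLinearMap.le_opNorm _ _
        _ ≤ (C / r) * (M * ‖x‖ * t) := by gcongr
        _ = _ := by ring
    calc _ ≤ C / r * (M * t) := hbound
      _ = C * M * (t / r) := by ring
      _ ≤ _ := by gcongr; linarith

end Smoothing

/-! ### Sewing of almost additive germs -/

section Sewing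

variable {E : Type*} [NormedAddCommGroup E] {Ξ : ℝ → ℝ → E} {K ζ a b : ℝ}

/-- `Ξ` vanishes on the diagonal, and is additive on `[a, b]` up to an error `K |w - u| ^ ζ`. -/
structure IsAlmostAdditive (Ξ : ℝ → ℝ → E) (K ζ a b : ℝ) : Prop where
  diag : ∀ u, Ξ u u = 0
  defect : ∀ u v w, a ≤ u → u ≤ v → v ≤ w → w ≤ b →
    ‖Ξ u w - Ξ u v - Ξ v w‖ ≤ K * (w - u) ^ ζ

/-- The constant `2 / (1 - 2^{1-ζ})` of the sewing lemma. -/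
def sewingConst (ζ : ℝ) : ℝ := 2 / (1 - 2 ^ (1 - ζ))

theorem two_rpow_one_sub_lt_one (hζ : 1 < ζ) : (2 : ℝ) ^ (1 - ζ) < 1 :=
  Real.rpow_lt_one_of_one_lt_of_neg one_lt_two (by linarith)

theorem sewingConst_pos (hζ : 1 < ζ) : 0 < sewingConst ζ :=
  div_pos two_pos (sub_pos.2 (two_rpow_one_sub_lt_one hζ))

theorem two_mul_half_rpow {x : ℝ} (hx : 0 ≤ x) : 2 * (x / 2) ^ ζ = 2 ^ (1 - ζ) * x ^ ζ := by
  rw [Real.div_rpow hx (by norm_num), Real.rpow_sub two_pos, Real.rpow_one]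
  ring

/-- With c the midpoint of the interval, this finds the cell at which the maximal inequality splits
a partition. -/
theorem exists_crossing_index {p : ℕ → ℝ} {c : ℝ} {i j : ℕ} (hij : i < j) (h1 : p i ≤ c)
    (h2 : c ≤ p j) : ∃ l, i ≤ l ∧ l < j ∧ p l ≤ c ∧ c ≤ p (l + 1) := by
  induction j, hij using Nat.le_induction with
  | base => exact ⟨i, le_rfl, i.lt_succ_self, h1, h2⟩
  | succ j hj ih =>
    rcases le_total c (p j) with h | h
    · obtain ⟨l, hl⟩ := ih h
      exact ⟨l, hl.1, hl.2.1.trans j.lt_succ_self, hl.2.2⟩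
    · exact ⟨j, by omega, j.lt_succ_self, h, h2⟩

/-- The maximal inequality of Young's theory: the sum of an almost additive germ over a partition
differs from its value on the whole interval by a multiple of `|t - s| ^ ζ`. -/
theorem IsAlmostAdditive.norm_sum_sub_le (h : IsAlmostAdditive Ξ K ζ a b) (hζ : 1 < ζ)
    (hK : 0 ≤ K) {p : ℕ → ℝ} (hp : Monotone p) {i j : ℕ} (hij : i ≤ j) (hi : a ≤ p i)
    (hj : p j ≤ b) :
    ‖∑ k ∈ Finset.Ico i j, Ξ (p k) (p (k + 1)) - Ξ (p i) (p j)‖ ≤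
      sewingConst ζ * K * (p j - p i) ^ ζ := by
  have hC := sewingConst_pos hζ
  induction hn : j - i using Nat.strong_induction_on generalizing i j with
  | _ n ih =>
  subst hn
  rcases hij.eq_or_lt with rfl | hij'
  · simp only [Finset.Ico_self, Finset.sum_empty, h.diag, sub_self, norm_zero]
    rw [Real.zero_rpow (by linarith), mul_zero]
  have hL : 0 ≤ p j - p i := sub_nonneg.2 (hp hij)
  obtain ⟨l, hil, hlj, hl1, hl2⟩ := exists_crossing_index (p := p) (c := (p i + p j) / 2) hij'
    (by linarith) (by linarith)
  -- Once the cell containing the midpoint is removed, each remaining part has at most half the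
  -- length, whatever the number of its points. Reinserting that cell costs two defects.
  have e1 := ih (l - i) (by omega) hil hi (by linarith) rfl
  have e2 := ih (j - (l + 1)) (by omega) hlj (by linarith) hj rfl
  have e3 := h.defect (p i) (p l) (p j) hi (hp hil) (hp hlj.le) hj
  have e4 := h.defect (p l) (p (l + 1)) (p j) (hi.trans (hp hil)) (hp l.le_succ) (hp hlj) hj
  have hsum : ∑ k ∈ Finset.Ico i j, Ξ (p k) (p (k + 1)) =
      ∑ k ∈ Finset.Ico i l, Ξ (p k) (p (k + 1)) + Ξ (p l) (p (l + 1)) +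
        ∑ k ∈ Finset.Ico (l + 1) j, Ξ (p k) (p (k + 1)) := by
    rw [← Finset.sum_Ico_consecutive _ hil hlj.le, add_assoc,
      Finset.sum_eq_sum_Ico_succ_bot hlj]
  have f1 : (p l - p i) ^ ζ ≤ ((p j - p i) / 2) ^ ζ :=
    Real.rpow_le_rpow (sub_nonneg.2 (hp hil)) (by linarith) (by linarith)
  have f2 : (p j - p (l + 1)) ^ ζ ≤ ((p j - p i) / 2) ^ ζ :=
    Real.rpow_le_rpow (sub_nonneg.2 (hp hlj)) (by linarith) (by linarith)
  have f3 : (p j - p l) ^ ζ ≤ (p j - p i) ^ ζ :=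
    Real.rpow_le_rpow (sub_nonneg.2 (hp hlj.le)) (by linarith [hp hil]) (by linarith)
  have hdec : ∑ k ∈ Finset.Ico i j, Ξ (p k) (p (k + 1)) - Ξ (p i) (p j) =
      (∑ k ∈ Finset.Ico i l, Ξ (p k) (p (k + 1)) - Ξ (p i) (p l)) +
      (∑ k ∈ Finset.Ico (l + 1) j, Ξ (p k) (p (k + 1)) - Ξ (p (l + 1)) (p j)) -
      (Ξ (p i) (p j) - Ξ (p i) (p l) - Ξ (p l) (p j)) -
      (Ξ (p l) (p j) - Ξ (p l) (p (l + 1)) - Ξ (p (l + 1)) (p j)) := by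
    rw [hsum]; abel
  -- The sewing constant is the fixed point of this recursion: two halves contribute the factor
  -- 2^{1-ζ}, the two defects add 2.
  have hconst : sewingConst ζ * 2 ^ (1 - ζ) + 2 = sewingConst ζ := by
    have := (sub_pos.2 (two_rpow_one_sub_lt_one hζ)).ne'
    rw [sewingConst]
    field_simp
    ring
  calc _ ≤ sewingConst ζ * K * (p l - p i) ^ ζ + sewingConst ζ * K * (p j - p (l + 1)) ^ ζ +
        K * (p j - p i) ^ ζ + K * (p j - p l) ^ ζ := by
        rw [hdec]
        refine (norm_sub_le _ _).trans (add_le_add ((norm_sub_le _ _).trans (add_le_add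
          ((norm_add_le _ _).trans (add_le_add e1 e2)) e3)) e4)
    _ ≤ sewingConst ζ * K * ((p j - p i) / 2) ^ ζ + sewingConst ζ * K * ((p j - p i) / 2) ^ ζ +
        K * (p j - p i) ^ ζ + K * (p j - p i) ^ ζ := by gcongr
    _ = sewingConst ζ * K * (2 * ((p j - p i) / 2) ^ ζ) + 2 * K * (p j - p i) ^ ζ := by ring
    _ = (sewingConst ζ * 2 ^ (1 - ζ) + 2) * K * (p j - p i) ^ ζ := by
        rw [two_mul_half_rpow hL]; ring
    _ = _ := by rw [hconst]

/-- The dyadic grid of an interval. -/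
def dyadicGrid (a b : ℝ) (n k : ℕ) : ℝ := a + (b - a) * (k / 2 ^ n)

theorem dyadicGrid_mono (hab : a ≤ b) (n : ℕ) : Monotone (dyadicGrid a b n) := fun i j hij => by
  have : (0 : ℝ) ≤ b - a := sub_nonneg.2 hab
  unfold dyadicGrid
  gcongr

theorem dyadicGrid_zero (n : ℕ) : dyadicGrid a b n 0 = a := by simp [dyadicGrid]

theorem dyadicGrid_last (n : ℕ) : dyadicGrid a b n (2 ^ n) = b := by simp [dyadicGrid]

theorem dyadicGrid_succ_sub (n k : ℕ) :
    dyadicGrid a b n (k + 1) - dyadicGrid a b n k = (b - a) / 2 ^ n := by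
  simp only [dyadicGrid]; push_cast; ring

theorem dyadicGrid_two_mul (n k : ℕ) : dyadicGrid a b (n + 1) (2 * k) = dyadicGrid a b n k := by
  simp only [dyadicGrid]; push_cast; rw [pow_succ]; field_simp

/-- The sum of the germ over the dyadic partition of `[a, t]`. -/
def dyadicSum (Ξ : ℝ → ℝ → E) (a b : ℝ) (n : ℕ) (t : ℝ) : E :=
  ∑ k ∈ Finset.range (2 ^ n), Ξ (min (dyadicGrid a b n k) t) (min (dyadicGrid a b n (k + 1)) t)

theorem sum_range_two_mul (f : ℕ → E) (n : ℕ) :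
    ∑ k ∈ Finset.range (2 * n), f k = ∑ k ∈ Finset.range n, (f (2 * k) + f (2 * k + 1)) := by
  induction n with
  | zero => simp
  | succ n ih =>
    rw [Finset.sum_range_succ, ← ih, mul_add, mul_one, Finset.sum_range_succ,
      Finset.sum_range_succ, add_assoc]

theorem two_pow_mul_div_rpow (hab : a ≤ b) (n : ℕ) :
    (2 : ℝ) ^ n * (K * ((b - a) / 2 ^ n) ^ ζ) = K * (b - a) ^ ζ * (2 ^ (1 - ζ)) ^ n := by
  have h2 : (0 : ℝ) < 2 ^ n := by positivity
  rw [Real.div_rpow (sub_nonneg.2 hab) h2.le, ← Real.rpow_natCast (2 ^ (1 - ζ)),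
    ← Real.rpow_natCast, ← Real.rpow_mul two_pos.le, ← Real.rpow_mul two_pos.le,
    show (1 - ζ) * (n : ℝ) = n - n * ζ by ring, Real.rpow_sub two_pos]
  ring

/-- Halving all 2^n cells costs one defect per cell, in total a geometric term of ratio 2^{1-ζ} < 1.
-/
theorem IsAlmostAdditive.norm_dyadicSum_succ_sub (h : IsAlmostAdditive Ξ K ζ a b) (hζ : 1 < ζ)
    (hK : 0 ≤ K) {t : ℝ} (hat : a ≤ t) (htb : t ≤ b) (n : ℕ) :
    ‖dyadicSum Ξ a b n t - dyadicSum Ξ a b (n + 1) t‖ ≤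
      K * (b - a) ^ ζ * (2 ^ (1 - ζ)) ^ n := by
  have hab := hat.trans htb
  rw [dyadicSum, dyadicSum, pow_succ', sum_range_two_mul, ← Finset.sum_sub_distrib]
  refine (norm_sum_le_of_le (n := fun _ => K * ((b - a) / 2 ^ n) ^ ζ) _ fun k _ => ?_).trans_eq ?_
  · set x := dyadicGrid a b n k with hx
    set y := dyadicGrid a b (n + 1) (2 * k + 1) with hy
    set z := dyadicGrid a b n (k + 1) with hz
    have e1 : dyadicGrid a b (n + 1) (2 * k) = x := dyadicGrid_two_mul n k
    have e2 : dyadicGrid a b (n + 1) (2 * k + 1 + 1) = z := dyadicGrid_two_mul n (k + 1)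
    have hxy : x ≤ y := by rw [← e1]; exact dyadicGrid_mono hab _ (Nat.le_succ _)
    have hyz : y ≤ z := by rw [← e2]; exact dyadicGrid_mono hab _ (Nat.le_succ _)
    have hax : a ≤ x := by
      rw [← dyadicGrid_zero (a := a) (b := b) n]; exact dyadicGrid_mono hab _ (Nat.zero_le _)
    have hzx : z - x = (b - a) / 2 ^ n := dyadicGrid_succ_sub n k
    rw [e1, e2, ← sub_sub]
    refine (h.defect _ _ _ (le_min hax hat) (min_le_min_right _ hxy) (min_le_min_right _ hyz)
      ((min_le_right _ _).trans htb)).trans ?_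
    rw [← hzx]
    refine mul_le_mul_of_nonneg_left (Real.rpow_le_rpow ?_ ?_ (by linarith)) hK
    · exact sub_nonneg.2 (min_le_min_right _ (hxy.trans hyz))
    · rcases le_total x t with hxt | hxt
      · rw [min_eq_left hxt]; linarith [min_le_left z t]
      · rw [min_eq_right hxt, min_eq_right (hxt.trans (hxy.trans hyz))]; linarith
  · rw [Finset.sum_const, Finset.card_range, nsmul_eq_mul, Nat.cast_pow, Nat.cast_ofNat,
      two_pow_mul_div_rpow hab]

/-- The difference of the two dyadic sums is nearly the sum over the grid clamped to [s,t], to which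
the maximal inequality applies. The first error term vanishes as n grows. -/
theorem IsAlmostAdditive.norm_dyadicSum_sub_sub_le (h : IsAlmostAdditive Ξ K ζ a b) (hζ : 1 < ζ)
    (hK : 0 ≤ K) {s t : ℝ} (has : a ≤ s) (hst : s ≤ t) (htb : t ≤ b) (n : ℕ) :
    ‖dyadicSum Ξ a b n t - dyadicSum Ξ a b n s - Ξ s t‖ ≤
      K * (b - a) ^ ζ * (2 ^ (1 - ζ)) ^ n + sewingConst ζ * K * (t - s) ^ ζ := by
  have hab := has.trans (hst.trans htb)
  set p : ℕ → ℝ := fun k => max s (min (dyadicGrid a b n k) t) with hp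
  have hpm : Monotone p := fun i j hij =>
    max_le_max_left _ (min_le_min_right _ (dyadicGrid_mono hab n hij))
  have hp0 : p 0 = s := by
    simp only [hp, dyadicGrid_zero, max_eq_left_iff]; exact (min_le_left _ _).trans has
  have hpn : p (2 ^ n) = t := by
    simp only [hp, dyadicGrid_last, min_eq_right htb, max_eq_right hst]
  have hmax := h.norm_sum_sub_le hζ hK hpm (Nat.zero_le (2 ^ n)) (by rw [hp0]; exact has)
    (by rw [hpn]; exact htb)
  rw [hp0, hpn, ← Finset.range_eq_Ico] at hmax
  have hdiff : ‖dyadicSum Ξ a b n t - dyadicSum Ξ a b n s -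
      ∑ k ∈ Finset.range (2 ^ n), Ξ (p k) (p (k + 1))‖ ≤
        K * (b - a) ^ ζ * (2 ^ (1 - ζ)) ^ n := by
    -- Cells on one side of s cancel exactly, and a cell straddling s leaves a single defect.
    -- Bounding every cell by one defect is wasteful but still summable.
    rw [dyadicSum, dyadicSum, ← Finset.sum_sub_distrib, ← Finset.sum_sub_distrib]
    refine (norm_sum_le_of_le (n := fun _ => K * ((b - a) / 2 ^ n) ^ ζ) _ fun k _ => ?_).trans_eq ?_
    · simp only [hp]
      set x := dyadicGrid a b n k
      set y := dyadicGrid a b n (k + 1)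
      have hxy : x ≤ y := dyadicGrid_mono hab _ (Nat.le_succ _)
      have hax : a ≤ x := by
        rw [← dyadicGrid_zero (a := a) (b := b) n]; exact dyadicGrid_mono hab _ (Nat.zero_le _)
      have hyx : y - x = (b - a) / 2 ^ n := dyadicGrid_succ_sub n k
      have hpos : 0 ≤ K * ((b - a) / 2 ^ n) ^ ζ := by
        have := sub_nonneg.2 hab
        positivity
      rcases le_total y s with hys | hsy
      · have hxs := hxy.trans hys
        rw [min_eq_left (hxs.trans hst), min_eq_left (hys.trans hst), min_eq_left hxs,
          min_eq_left hys, max_eq_left hxs, max_eq_left hys, h.diag]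
        simpa using hpos
      rcases le_total s x with hsx | hxs
      · rw [min_eq_right hsx, min_eq_right hsy, max_eq_right (le_min hsx hst),
          max_eq_right (le_min hsy hst), h.diag]
        simpa using hpos
      · rw [min_eq_left (hxs.trans hst), min_eq_left hxs, min_eq_right hsy, max_eq_left hxs,
          max_eq_right (le_min hsy hst)]
        refine (h.defect _ _ _ hax hxs (le_min hsy hst) ((min_le_right _ _).trans htb)).trans ?_
        rw [← hyx]
        gcongr
        · exact sub_nonneg.2 (hxs.trans (le_min hsy hst))
        · exact min_le_left _ _
    · rw [Finset.sum_const, Finset.card_range, nsmul_eq_mul, Nat.cast_pow, Nat.cast_ofNat,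
        two_pow_mul_div_rpow hab]
  calc _ = ‖(dyadicSum Ξ a b n t - dyadicSum Ξ a b n s -
      ∑ k ∈ Finset.range (2 ^ n), Ξ (p k) (p (k + 1))) +
        (∑ k ∈ Finset.range (2 ^ n), Ξ (p k) (p (k + 1)) - Ξ s t)‖ := by congr 1; abel
    _ ≤ _ := (norm_add_le _ _).trans (add_le_add hdiff hmax)

/-- `g` is a primitive on `[a, b]` of the germ `Ξ`, up to errors of order `ζ`. -/
def IsSewing (Ξ : ℝ → ℝ → E) (D ζ a b : ℝ) (g : ℝ → E) : Prop :=
  ∀ u v, a ≤ u → u ≤ v → v ≤ b → ‖g v - g u - Ξ u v‖ ≤ D * (v - u) ^ ζ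

/-- The sewing lemma. -/
theorem IsAlmostAdditive.exists_isSewing [CompleteSpace E] (h : IsAlmostAdditive Ξ K ζ a b)
    (hζ : 1 < ζ) (hK : 0 ≤ K) : ∃ g : ℝ → E, IsSewing Ξ (sewingConst ζ * K) ζ a b g := by
  have hr := two_rpow_one_sub_lt_one hζ
  have hlim : ∀ t, a ≤ t → t ≤ b → ∃ x, Tendsto (fun n => dyadicSum Ξ a b n t) atTop (𝓝 x) :=
    fun t hat htb => cauchySeq_tendsto_of_complete (cauchySeq_of_le_geometric _
      (K * (b - a) ^ ζ) hr fun n => by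
        rw [dist_eq_norm]; exact h.norm_dyadicSum_succ_sub hζ hK hat htb n)
  classical
  -- The primitive is the limit of the dyadic sums; its value off [a, b] is irrelevant.
  refine ⟨fun t => if ht : a ≤ t ∧ t ≤ b then (hlim t ht.1 ht.2).choose else 0,
    fun u v hau huv hvb => ?_⟩
  have hu : a ≤ u ∧ u ≤ b := ⟨hau, huv.trans hvb⟩
  have hv : a ≤ v ∧ v ≤ b := ⟨hau.trans huv, hvb⟩
  simp only [dif_pos hu, dif_pos hv]
  have h1 := (((hlim v hv.1 hv.2).choose_spec.sub (hlim u hu.1 hu.2).choose_spec).sub_const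
    (Ξ u v)).norm
  have h2 : Tendsto (fun n : ℕ => K * (b - a) ^ ζ * ((2 : ℝ) ^ (1 - ζ)) ^ n +
      sewingConst ζ * K * (v - u) ^ ζ) atTop
        (𝓝 (K * (b - a) ^ ζ * 0 + sewingConst ζ * K * (v - u) ^ ζ)) :=
    ((tendsto_pow_atTop_nhds_zero_of_lt_one (by positivity) hr).const_mul _).add_const _
  rw [mul_zero, zero_add] at h2
  exact le_of_tendsto_of_tendsto' h1 h2 fun n =>
    h.norm_dyadicSum_sub_sub_le hζ hK hau huv hvb n

/-- A cell of length ℓ ≤ ε has error D ℓ^ζ ≤ D ε^{ζ-1} ℓ, and the lengths add up. So Riemann sums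
converge to the increment of g along all partitions, not only dyadic ones. -/
theorem IsSewing.norm_sum_sub_le {D : ℝ} {g : ℝ → E} (h : IsSewing Ξ D ζ a b g) (hζ : 1 < ζ)
    (hD : 0 ≤ D) {p : ℕ → ℝ} (hp : Monotone p) {n : ℕ} (h0 : a ≤ p 0) (hn : p n ≤ b) {ε : ℝ}
    (hε : ∀ k < n, p (k + 1) - p k ≤ ε) :
    ‖∑ k ∈ Finset.range n, Ξ (p k) (p (k + 1)) - (g (p n) - g (p 0))‖ ≤
      D * ε ^ (ζ - 1) * (p n - p 0) := by
  rw [← Finset.sum_range_sub (fun k => g (p k)), ← Finset.sum_sub_distrib,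
    ← Finset.sum_range_sub (fun k => p k), Finset.mul_sum]
  refine norm_sum_le_of_le _ fun k hk => ?_
  have hk : k < n := Finset.mem_range.1 hk
  rw [norm_sub_rev]
  have hpos : 0 ≤ p (k + 1) - p k := sub_nonneg.2 (hp k.le_succ)
  refine (h _ _ (h0.trans (hp k.zero_le)) (hp k.le_succ) ((hp hk).trans hn)).trans ?_
  rw [mul_assoc]
  gcongr
  rcases hpos.eq_or_lt with h' | h'
  · rw [← h', mul_zero, Real.zero_rpow (by linarith)]
  · calc (p (k + 1) - p k) ^ ζ = (p (k + 1) - p k) ^ (ζ - 1) * (p (k + 1) - p k) := by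
          rw [Real.rpow_sub_one h'.ne']; field_simp
      _ ≤ _ := by
          gcongr
          exact hε k hk

/-- The points of the uniform partition of `[u, v]` into `n + 1` intervals. -/
def uniformGrid (u v : ℝ) (n k : ℕ) : ℝ := u + (v - u) * (k / (n + 1))

theorem uniformGrid_mono {u v : ℝ} (huv : u ≤ v) (n : ℕ) : Monotone (uniformGrid u v n) :=
  fun i j hij => by
    have : (0 : ℝ) ≤ v - u := sub_nonneg.2 huv
    unfold uniformGrid
    gcongr

theorem uniformGrid_zero (u v : ℝ) (n : ℕ) : uniformGrid u v n 0 = u := by simp [uniformGrid]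

theorem uniformGrid_last (u v : ℝ) (n : ℕ) : uniformGrid u v n (n + 1) = v := by
  have : (n : ℝ) + 1 ≠ 0 := by positivity
  simp [uniformGrid, this]

theorem uniformGrid_succ_sub (u v : ℝ) (n k : ℕ) :
    uniformGrid u v n (k + 1) - uniformGrid u v n k = (v - u) / (n + 1) := by
  simp only [uniformGrid]; push_cast; ring

theorem IsSewing.tendsto_uniform {D : ℝ} {g : ℝ → E} (h : IsSewing Ξ D ζ a b g) (hζ : 1 < ζ)
    (hD : 0 ≤ D) {u v : ℝ} (hau : a ≤ u) (huv : u ≤ v) (hvb : v ≤ b) :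
    Tendsto (fun n : ℕ => ∑ k ∈ Finset.range (n + 1),
      Ξ (uniformGrid u v n k) (uniformGrid u v n (k + 1))) atTop (𝓝 (g v - g u)) := by
  rw [tendsto_iff_norm_sub_tendsto_zero]
  have hmesh : Tendsto (fun n : ℕ => (v - u) / ((n : ℝ) + 1)) atTop (𝓝 0) := by
    have := (tendsto_one_div_add_atTop_nhds_zero_nat (𝕜 := ℝ)).const_mul (v - u)
    simpa only [mul_one_div, mul_zero] using this
  have hlim : Tendsto (fun n : ℕ => D * ((v - u) / ((n : ℝ) + 1)) ^ (ζ - 1) * (v - u)) atTop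
      (𝓝 0) := by
    have h1 := (hmesh.rpow_const (p := ζ - 1) (Or.inr (by linarith))).const_mul D
    have h2 := h1.mul_const (v - u)
    rwa [Real.zero_rpow (by linarith), mul_zero, zero_mul] at h2
  refine squeeze_zero (fun n => norm_nonneg _) (fun n => ?_) hlim
  have := h.norm_sum_sub_le hζ hD (uniformGrid_mono huv n) (n := n + 1)
    (by rw [uniformGrid_zero]; exact hau) (by rw [uniformGrid_last]; exact hvb)
    (fun k _ => (uniformGrid_succ_sub u v n k).le)
  rwa [uniformGrid_last, uniformGrid_zero] at this

theorem uniformGrid_mem {u v : ℝ} (huv : u ≤ v) {n k : ℕ} (hk : k ≤ n + 1) :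
    u ≤ uniformGrid u v n k ∧ uniformGrid u v n k ≤ v :=
  ⟨by simpa only [uniformGrid_zero] using uniformGrid_mono huv n k.zero_le,
    by simpa only [uniformGrid_last] using uniformGrid_mono huv n hk⟩

/-- Primitives of germs which are mapped onto each other are mapped onto each other. -/
theorem IsSewing.map_sub_eq {E' : Type*} [NormedAddCommGroup E'] {Ξ' : ℝ → ℝ → E'}
    {D D' a' b' : ℝ} {g : ℝ → E} {g' : ℝ → E'} (h : IsSewing Ξ D ζ a b g)
    (h' : IsSewing Ξ' D' ζ a' b' g') (hζ : 1 < ζ) (hD : 0 ≤ D) (hD' : 0 ≤ D') {u v : ℝ}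
    (hau : a ≤ u) (ha'u : a' ≤ u) (huv : u ≤ v) (hvb : v ≤ b) (hvb' : v ≤ b')
    {f : E →+ E'} (hf : Continuous f)
    (hΞ : ∀ x y, u ≤ x → x ≤ y → y ≤ v → f (Ξ x y) = Ξ' x y) :
    f (g v - g u) = g' v - g' u := by
  have h1 := (hf.tendsto _).comp (h.tendsto_uniform hζ hD hau huv hvb)
  refine tendsto_nhds_unique h1 ((h'.tendsto_uniform hζ hD' ha'u huv hvb').congr fun n => ?_)
  rw [Function.comp_apply, map_sum]
  refine Finset.sum_congr rfl fun k hk => (hΞ _ _ ?_ ?_ ?_).symm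
  · exact (uniformGrid_mem huv (Finset.mem_range.1 hk).le).1
  · exact uniformGrid_mono huv n k.le_succ
  · exact (uniformGrid_mem huv (Finset.mem_range.1 hk)).2

/-- Used to transfer adaptedness from the germ to its primitive, with A the random variables
measurable at a given time. -/
theorem IsSewing.sub_mem_of_isClosed {D : ℝ} {g : ℝ → E} (h : IsSewing Ξ D ζ a b g)
    (hζ : 1 < ζ) (hD : 0 ≤ D) {u v : ℝ} (hau : a ≤ u) (huv : u ≤ v) (hvb : v ≤ b)
    (A : AddSubgroup E) (hA : IsClosed (A : Set E))
    (hΞ : ∀ x y, u ≤ x → x ≤ y → y ≤ v → Ξ x y ∈ A) : g v - g u ∈ A := by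
  refine hA.mem_of_tendsto (h.tendsto_uniform hζ hD hau huv hvb) (Eventually.of_forall fun n => ?_)
  refine A.sum_mem fun k hk => hΞ _ _ ?_ ?_ ?_
  · exact (uniformGrid_mem huv (Finset.mem_range.1 hk).le).1
  · exact uniformGrid_mono huv n k.le_succ
  · exact (uniformGrid_mem huv (Finset.mem_range.1 hk)).2

end Sewing

/-! ### Operators on spaces of random variables and measurable modifications -/

section RandomVariables

variable {Ω : Type*} {mΩ : MeasurableSpace Ω} {μ : Measure Ω} {m : ℝ≥0∞} [Fact (1 ≤ m)]
  {V V' V'' : Type*} [NormedAddCommGroup V] [NormedSpace ℝ V]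
  [NormedAddCommGroup V'] [NormedSpace ℝ V'] [NormedAddCommGroup V''] [NormedSpace ℝ V'']

theorem compLpL_comp_apply (f : V' →L[ℝ] V'') (g : V →L[ℝ] V') (x : Lp V m μ) :
    (f ∘L g).compLpL m μ x = f.compLpL m μ (g.compLpL m μ x) := by
  refine Lp.ext ?_
  filter_upwards [(f ∘L g).coeFn_compLpL (p := m) (μ := μ) x,
    f.coeFn_compLpL (p := m) (μ := μ) (g.compLpL m μ x),
    g.coeFn_compLpL (p := m) (μ := μ) x] with ω h1 h2 h3
  rw [h1, h2, h3]
  rfl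

theorem compLpL_sub_apply (f g : V →L[ℝ] V') (x : Lp V m μ) :
    (f - g).compLpL m μ x = f.compLpL m μ x - g.compLpL m μ x := by
  have h := DFunLike.congr_fun (ContinuousLinearMap.add_compLpL (p := m) (μ := μ) (f - g) g) x
  rw [sub_add_cancel, add_apply] at h
  rw [h, add_sub_cancel_right]

theorem compLpL_zero_apply (x : Lp V m μ) : (0 : V →L[ℝ] V').compLpL m μ x = 0 := by
  have h := compLpL_sub_apply (0 : V →L[ℝ] V') 0 x
  rwa [sub_self, sub_self] at h

theorem norm_compLpL_apply_le (f : V →L[ℝ] V') (x : Lp V m μ) :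
    ‖f.compLpL m μ x‖ ≤ ‖f‖ * ‖x‖ :=
  ((f.compLpL m μ).le_opNorm x).trans (by gcongr; exact f.norm_compLpL_le)

/-- Applied to the inclusions of the scale, this lets identities between smooth random variables be
checked in a rougher space. -/
theorem compLpL_injective {f : V →L[ℝ] V'} (hf : Function.Injective f) :
    Function.Injective (f.compLpL m μ) := fun x y hxy => by
  refine Lp.ext ?_
  have h : f.compLpL m μ x =ᵐ[μ] f.compLpL m μ y := by rw [hxy]
  filter_upwards [f.coeFn_compLpL (p := m) (μ := μ) x, f.coeFn_compLpL (p := m) (μ := μ) y, h]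
    with ω h1 h2 h3
  apply hf
  rw [← h1, ← h2, h3]

theorem aestronglyMeasurable_compLpL {m₀ : MeasurableSpace Ω} (f : V →L[ℝ] V') {x : Lp V m μ}
    (hx : AEStronglyMeasurable[m₀] x μ) : AEStronglyMeasurable[m₀] (f.compLpL m μ x) μ :=
  (f.continuous.comp_aestronglyMeasurable hx).congr (f.coeFn_compLpL x).symm

variable {T : ℝ}

theorem IsMeasurableAdapted.aestronglyMeasurable {ℱ : Filtration ℝ≥0 mΩ}
    {Y : Icc (0 : ℝ) T → Lp V m μ} (hY : IsMeasurableAdapted ℱ Y) (t : Icc (0 : ℝ) T) :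
    AEStronglyMeasurable[ℱ ⟨(t : ℝ), t.2.1⟩] (Y t) μ := by
  obtain ⟨y, -, h2, h3⟩ := hY
  exact ⟨y t, h2 t, (h3 t).symm⟩

/-- The largest multiple of `1/(N+1)` below `t`. -/
def gridFloor (hT : 0 ≤ T) (N : ℕ) (t : Icc (0 : ℝ) T) : Icc (0 : ℝ) T :=
  projIcc 0 T hT (⌊(t : ℝ) * (N + 1)⌋₊ / (N + 1))

theorem coe_gridFloor (hT : 0 ≤ T) (N : ℕ) (t : Icc (0 : ℝ) T) :
    (gridFloor hT N t : ℝ) = ⌊(t : ℝ) * (N + 1)⌋₊ / (N + 1) := by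
  have h0 : (0 : ℝ) ≤ ⌊(t : ℝ) * (N + 1)⌋₊ / (N + 1) := by positivity
  have h1 : (⌊(t : ℝ) * (N + 1)⌋₊ / (N + 1) : ℝ) ≤ t := by
    rw [div_le_iff₀ (by positivity)]
    exact Nat.floor_le (mul_nonneg t.2.1 (by positivity))
  rw [gridFloor, projIcc_of_mem hT ⟨h0, h1.trans t.2.2⟩]

theorem gridFloor_le (hT : 0 ≤ T) (N : ℕ) (t : Icc (0 : ℝ) T) :
    (gridFloor hT N t : ℝ) ≤ t := by
  rw [coe_gridFloor, div_le_iff₀ (by positivity)]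
  exact Nat.floor_le (mul_nonneg t.2.1 (by positivity))

theorem dist_gridFloor_lt (hT : 0 ≤ T) (N : ℕ) (t : Icc (0 : ℝ) T) :
    dist (gridFloor hT N t) t < 1 / ((N : ℝ) + 1) := by
  have h1 := gridFloor_le hT N t
  have h2 := Nat.lt_floor_add_one ((t : ℝ) * (N + 1))
  rw [Subtype.dist_eq, Real.dist_eq, abs_sub_comm, abs_of_nonneg (by linarith), coe_gridFloor,
    sub_lt_iff_lt_add', ← add_div, lt_div_iff₀ (by positivity)]
  exact h2

theorem stronglyMeasurable_gridFloor (hT : 0 ≤ T) (N : ℕ) {z : Icc (0 : ℝ) T → Ω → V}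
    (hz : ∀ t, StronglyMeasurable (z t)) :
    StronglyMeasurable (fun p : Icc (0 : ℝ) T × Ω => z (gridFloor hT N p.1) p.2) := by
  have hk : Measurable (fun p : Icc (0 : ℝ) T × Ω => ⌊(p.1 : ℝ) * (N + 1)⌋₊) :=
    Nat.measurable_floor.comp ((measurable_subtype_coe.comp measurable_fst).mul_const _)
  set K := ⌊T * (N + 1)⌋₊
  have e : (fun p : Icc (0 : ℝ) T × Ω => z (gridFloor hT N p.1) p.2) =
      -- Only finitely many grid points are reached, so the process is a finite sum over time
      -- strips, on each of which it is constant in time.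
      fun p => ∑ k ∈ Finset.range (K + 1),
        {p : Icc (0 : ℝ) T × Ω | ⌊(p.1 : ℝ) * (N + 1)⌋₊ = k}.indicator
          (fun p => z (projIcc 0 T hT (k / (N + 1))) p.2) p := by
    funext p
    rw [Finset.sum_eq_single ⌊(p.1 : ℝ) * (N + 1)⌋₊]
    · rw [indicator_of_mem (by simp)]
      rfl
    · intro k _ hk
      exact indicator_of_notMem (fun h => hk h.symm) _
    · intro h
      refine absurd (Finset.mem_range.2 (Nat.lt_succ_of_le (Nat.floor_le_floor ?_))) h
      gcongr
      exact p.1.2.2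
  rw [e]
  refine Finset.stronglyMeasurable_fun_sum _ fun k _ => ?_
  exact ((hz _).comp_measurable measurable_snd).indicator (hk (measurableSet_singleton k))

/-- A continuous path in `L^m` whose values are adapted has a measurable adapted modification. -/
theorem isMeasurableAdapted_of_continuous [CompleteSpace V] {ℱ : Filtration ℝ≥0 mΩ}
    (hT : 0 ≤ T) {Z : Icc (0 : ℝ) T → Lp V m μ} (hZ : Continuous Z)
    (hm : ∀ t : Icc (0 : ℝ) T, AEStronglyMeasurable[ℱ ⟨(t : ℝ), t.2.1⟩] (Z t) μ) :
    IsMeasurableAdapted ℱ Z := by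
  have huc := CompactSpace.uniformContinuous_of_continuous hZ
  rw [Metric.uniformContinuous_iff] at huc
  -- Uniform continuity gives one grid for all times, as joint measurability needs. The geometric
  -- rate later gives almost sure convergence at each t.
  have hN : ∀ n : ℕ, ∃ N : ℕ, ∀ t, dist (Z (gridFloor hT N t)) (Z t) < (1 / 2 : ℝ) ^ n := by
    intro n
    obtain ⟨δ, hδ, h⟩ := huc ((1 / 2 : ℝ) ^ n) (by positivity)
    obtain ⟨N, hN⟩ := exists_nat_one_div_lt hδ
    exact ⟨N, fun t => h ((dist_gridFloor_lt hT N t).trans hN)⟩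
  choose N hN using hN
  choose z hz hzZ using hm
  refine ⟨fun t ω => limUnder atTop fun n => z (gridFloor hT (N n) t) ω, ?_, fun t => ?_,
    fun t => ?_⟩
  · exact StronglyMeasurable.limUnder fun n =>
      stronglyMeasurable_gridFloor hT (N n) fun t => (hz t).mono (ℱ.le _)
  · let : MeasurableSpace Ω := ℱ ⟨(t : ℝ), t.2.1⟩
    -- Grid points are rounded down, so each approximation at time t uses only the past of t.
    exact StronglyMeasurable.limUnder fun n => (hz _).mono (ℱ.mono (gridFloor_le hT (N n) t))
  · have hlim : Tendsto (fun n => Z (gridFloor hT (N n) t)) atTop (𝓝 (Z t)) := by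
      rw [tendsto_iff_dist_tendsto_zero]
      exact squeeze_zero (fun n => dist_nonneg) (fun n => (hN n t).le)
        (tendsto_pow_atTop_nhds_zero_of_lt_one (by norm_num) (by norm_num))
    -- The subsequence only identifies the limit; convergence of the full sequence comes from the
    -- summable rate.
    obtain ⟨ns, hns, hae⟩ := (tendstoInMeasure_of_tendsto_Lp hlim).exists_seq_tendsto_ae
    have hB : ∑' n : ℕ, ENNReal.ofReal (2 * (1 / 2 : ℝ) ^ n) ≠ ∞ :=
      ((summable_geometric_of_lt_one (by norm_num) (by norm_num)).mul_left 2).tsum_ofReal_ne_top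
    have hconv := Lp.ae_tendsto_of_cauchy_eLpNorm (μ := μ) (p := m)
      (f := fun n => ⇑(Z (gridFloor hT (N n) t))) (fun n => Lp.aestronglyMeasurable _)
      Fact.out hB fun K i j hi hj => by
        rw [← Lp.edist_def, edist_dist]
        refine (ENNReal.ofReal_lt_ofReal_iff (by positivity)).2 ?_
        have h1 : (1 / 2 : ℝ) ^ i ≤ (1 / 2) ^ K :=
          pow_le_pow_of_le_one (by norm_num) (by norm_num) hi
        have h2 : (1 / 2 : ℝ) ^ j ≤ (1 / 2) ^ K :=
          pow_le_pow_of_le_one (by norm_num) (by norm_num) hj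
        have h3 := dist_triangle_right (Z (gridFloor hT (N i) t)) (Z (gridFloor hT (N j) t)) (Z t)
        linarith [hN i t, hN j t]
    have hall : ∀ᵐ ω ∂μ, ∀ n, Z (gridFloor hT (N n) t) ω = z (gridFloor hT (N n) t) ω :=
      ae_all_iff.2 fun n => hzZ _
    filter_upwards [hae, hconv, hall] with ω h1 h2 h3
    obtain ⟨l, hl⟩ := h2
    have hlZ : l = Z t ω := tendsto_nhds_unique (hl.comp hns.tendsto_atTop) h1
    rw [hlZ] at hl
    exact (hl.congr h3).limUnder_eq

end RandomVariables

/-! ### Smoothing in the scale of spaces -/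

section ScaleSmoothing

variable {H : Type*} [NormedAddCommGroup H] [InnerProductSpace ℝ H] [CompleteSpace H]
  {S : ℝ → H →L[ℝ] H}

theorem exists_scale_smoothing (hS : IsAnalyticSemigroup S) (hν : IsExpStable S) {κ κ' : ℝ}
    (h : κ ≤ κ') (h2 : κ' - κ < 2) :
    ∃ C : ℝ, 0 ≤ C ∧ ∀ t : ℝ, 0 < t → ∃ R : HScale S κ →L[ℝ] HScale S κ',
      embed S κ κ' ∘L R = scaleSemigroup S κ t ∧ ‖R‖ ≤ C * t ^ (-(κ' - κ)) :=
  exists_smoothing hS hν (sub_nonneg.2 h) h2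

theorem exists_norm_scaleSemigroup_sub_embed_le (hS : IsAnalyticSemigroup S)
    (hν : IsExpStable S) {κ κ' : ℝ} (h : κ < κ') (h1 : κ' - κ < 1) :
    ∃ C : ℝ, 0 ≤ C ∧ ∀ t : ℝ, 0 ≤ t →
      ‖scaleSemigroup S κ t ∘L embed S κ κ' - embed S κ κ'‖ ≤ C * t ^ (κ' - κ) :=
  exists_norm_sub_negPow_le hS hν (sub_pos.2 h) h1

theorem exists_norm_scaleSemigroup_le (hν : IsExpStable S) :
    ∃ M : ℝ, 0 < M ∧ ∀ κ t : ℝ, 0 ≤ t → ‖scaleSemigroup S κ t‖ ≤ M := by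
  obtain ⟨M, hM0, hM⟩ := exists_norm_le_of_isExpStable hν
  exact ⟨M, hM0, fun _ => hM⟩

theorem scaleSemigroup_add (hS : IsAnalyticSemigroup S) (κ : ℝ) {s t : ℝ} (hs : 0 ≤ s)
    (ht : 0 ≤ t) :
    scaleSemigroup S κ (s + t) = scaleSemigroup S κ s ∘L scaleSemigroup S κ t :=
  hS.map_add s t hs ht

end ScaleSmoothing

/-! ### The germ of the convolution -/

section Germ

variable {H : Type*} [NormedAddCommGroup H] [InnerProductSpace ℝ H] {S : ℝ → H →L[ℝ] H}
  {Ω : Type*} {mΩ : MeasurableSpace Ω} {μ : Measure Ω} {m : ℝ≥0∞} [Fact (1 ≤ m)]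
  {ℱ : Filtration ℝ≥0 mΩ} {e : ℕ} {α β γ T A N : ℝ}
  {η : ℝ → EuclideanSpace ℝ (Fin e)} {Y : ℝ → Lp (HScaleE S e γ) m μ}

/-- `η` is `α`-Hölder with constant `A`, and `Y` is adapted, bounded by `N` in `H_γ^e` and
`β`-Hölder with constant `N` in `H_{γ-β}^e`, on `[0, T]`. -/
structure IsControlled (ℱ : Filtration ℝ≥0 mΩ) (α β T A N : ℝ)
    (η : ℝ → EuclideanSpace ℝ (Fin e)) (Y : ℝ → Lp (HScaleE S e γ) m μ) : Prop where
  A_nonneg : 0 ≤ A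
  N_nonneg : 0 ≤ N
  norm_eta : ∀ u v, 0 ≤ u → u ≤ v → v ≤ T → ‖η v - η u‖ ≤ A * (v - u) ^ α
  norm_le : ∀ u, 0 ≤ u → u ≤ T → ‖Y u‖ ≤ N
  norm_incr : ∀ u v, 0 ≤ u → u ≤ v → v ≤ T →
    ‖(embedE S e (γ - β) γ).compLpL m μ (Y v) - (embedE S e (γ - β) γ).compLpL m μ (Y u)‖ ≤
      N * (v - u) ^ β
  adapted : ∀ u, 0 ≤ u → u ≤ T →
    AEStronglyMeasurable[ℱ u.toNNReal] ((embedE S e (γ - β) γ).compLpL m μ (Y u)) μ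

/-- The germ `S_{τ-u} Y_u (η_v - η_u)` of the convolution, with values in `H_κ`. -/
def germ (κ : ℝ) (η : ℝ → EuclideanSpace ℝ (Fin e)) (Y : ℝ → Lp (HScaleE S e γ) m μ)
    (τ u v : ℝ) : Lp (HScale S κ) m μ :=
  (embed S κ γ).compLpL m μ ((semigroupApply S e γ (τ - u) (η v - η u)).compLpL m μ (Y u))

/-- Evaluation of a random element of `H_κ^e` at `x ∈ ℝ^e`. -/
def evalAt (κ : ℝ) (x : EuclideanSpace ℝ (Fin e)) :
    Lp (HScaleE S e κ) m μ →L[ℝ] Lp (HScale S κ) m μ :=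
  (ContinuousLinearMap.apply ℝ (HScale S κ) x).compLpL m μ

theorem norm_evalAt_le (κ : ℝ) (x : EuclideanSpace ℝ (Fin e)) (y : Lp (HScaleE S e κ) m μ) :
    ‖evalAt κ x y‖ ≤ ‖x‖ * ‖y‖ := by
  refine (norm_compLpL_apply_le _ _).trans ?_
  gcongr
  refine ContinuousLinearMap.opNorm_le_bound _ (norm_nonneg _) fun f => ?_
  rw [ContinuousLinearMap.apply_apply, mul_comm]
  exact f.le_opNorm x

theorem semigroupApply_compLpL (κ τ : ℝ) (x : EuclideanSpace ℝ (Fin e))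
    (y : Lp (HScaleE S e κ) m μ) :
    (semigroupApply S e κ τ x).compLpL m μ y =
      (scaleSemigroup S κ τ).compLpL m μ (evalAt κ x y) :=
  compLpL_comp_apply _ _ _

theorem embed_evalAt (κ κ' : ℝ) (x : EuclideanSpace ℝ (Fin e)) (y : Lp (HScaleE S e κ') m μ) :
    (embed S κ κ').compLpL m μ (evalAt κ' x y) =
      evalAt κ x ((embedE S e κ κ').compLpL m μ y) := by
  rw [evalAt, evalAt, ← compLpL_comp_apply, ← compLpL_comp_apply]
  rfl

variable [CompleteSpace H]

theorem embed_scaleSemigroup_apply (hS : IsAnalyticSemigroup S) (hν : IsExpStable S)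
    {κ κ' t : ℝ} (h : κ ≤ κ') (ht : 0 ≤ t) (y : Lp (HScale S κ') m μ) :
    (embed S κ κ').compLpL m μ ((scaleSemigroup S κ' t).compLpL m μ y) =
      (scaleSemigroup S κ t).compLpL m μ ((embed S κ κ').compLpL m μ y) := by
  rw [← compLpL_comp_apply, embed_scaleSemigroup hS hν h ht, compLpL_comp_apply]

theorem scaleSemigroup_add_apply (hS : IsAnalyticSemigroup S) (κ : ℝ) {s t : ℝ} (hs : 0 ≤ s)
    (ht : 0 ≤ t) (y : Lp (HScale S κ) m μ) :
    (scaleSemigroup S κ (s + t)).compLpL m μ y =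
      (scaleSemigroup S κ s).compLpL m μ ((scaleSemigroup S κ t).compLpL m μ y) := by
  rw [scaleSemigroup_add hS κ hs ht, compLpL_comp_apply]

theorem embed_comp_apply (hS : IsAnalyticSemigroup S) (hν : IsExpStable S) {κ₁ κ₂ κ₃ : ℝ}
    (h₁ : κ₁ ≤ κ₂) (h₂ : κ₂ ≤ κ₃) (y : Lp (HScale S κ₃) m μ) :
    (embed S κ₁ κ₂).compLpL m μ ((embed S κ₂ κ₃).compLpL m μ y) =
      (embed S κ₁ κ₃).compLpL m μ y := by
  rw [← compLpL_comp_apply, embed_comp hS hν h₁ h₂]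

theorem germ_eq (hS : IsAnalyticSemigroup S) (hν : IsExpStable S) {κ τ u v : ℝ} (hκ : κ ≤ γ)
    (hu : u ≤ τ) :
    germ κ η Y τ u v = (scaleSemigroup S κ (τ - u)).compLpL m μ
      (evalAt κ (η v - η u) ((embedE S e κ γ).compLpL m μ (Y u))) := by
  rw [germ, semigroupApply_compLpL, embed_scaleSemigroup_apply hS hν hκ (sub_nonneg.2 hu),
    embed_evalAt]

/-- The semigroup law moves the endpoint of the germ from τ to t, which relates the primitives for
different endpoints. -/
theorem scaleSemigroup_germ (hS : IsAnalyticSemigroup S) (hν : IsExpStable S)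
    {κ τ t u v : ℝ} (hκ : κ ≤ γ) (hu : u ≤ τ) (ht : τ ≤ t) :
    (scaleSemigroup S κ (t - τ)).compLpL m μ (germ κ η Y τ u v) = germ κ η Y t u v := by
  rw [germ_eq hS hν hκ hu, germ_eq hS hν hκ (hu.trans ht),
    ← scaleSemigroup_add_apply hS κ (sub_nonneg.2 ht) (sub_nonneg.2 hu), sub_add_sub_cancel]

theorem germ_sub_germ (κ τ u v w : ℝ) :
    germ κ η Y τ u w - germ κ η Y τ u v = (embed S κ γ).compLpL m μ
      ((scaleSemigroup S γ (τ - u)).compLpL m μ (evalAt γ (η w - η v) (Y u))) := by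
  rw [germ, germ, ← _root_.map_sub, semigroupApply_compLpL, semigroupApply_compLpL,
    ← _root_.map_sub]
  congr 2
  rw [evalAt, evalAt, evalAt, ← compLpL_sub_apply, ← _root_.map_sub, sub_sub_sub_cancel_right]

/-- After factoring out S_{τ-v}, the defect pairs η_w - η_v with (S_{v-u} - 1) Y_u - (Y_v - Y_u). In
H_{γ-β} both terms are O((v-u)^β). The constant depends on neither T nor the data. -/
theorem exists_germ_isAlmostAdditive (hS : IsAnalyticSemigroup S) (hν : IsExpStable S)
    (hα : 0 < α) (hβ : 0 < β) (hβ1 : β < 1) :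
    ∃ C : ℝ, 0 ≤ C ∧ ∀ (T A N : ℝ) (η : ℝ → EuclideanSpace ℝ (Fin e))
      (Y : ℝ → Lp (HScaleE S e γ) m μ), IsControlled ℱ α β T A N η Y → ∀ τ, τ ≤ T →
        IsAlmostAdditive (germ (γ - β) η Y τ) (C * (N * A)) (α + β) 0 τ := by
  obtain ⟨M, hM0, hM⟩ := exists_norm_scaleSemigroup_le hν
  obtain ⟨C, hC, hCb⟩ := exists_norm_scaleSemigroup_sub_embed_le hS hν (κ := γ - β) (κ' := γ)
    (by linarith) (by linarith)
  rw [sub_sub_cancel] at hCb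
  refine ⟨M * (C + 1), by positivity, fun T A N η Y h τ hτ => ⟨fun u => ?_, ?_⟩⟩
  · rw [germ, sub_self, semigroupApply_compLpL, evalAt, _root_.map_zero, compLpL_zero_apply,
      _root_.map_zero, _root_.map_zero]
  · intro u v w hu huv hvw hwτ
    have hκ : γ - β ≤ γ := by linarith
    have hA := h.A_nonneg
    have hN := h.N_nonneg
    set x := η w - η v with hx
    have hxn : ‖x‖ ≤ A * (w - v) ^ α := h.norm_eta v w (hu.trans huv) hvw (hwτ.trans hτ)
    have hYu := h.norm_le u hu ((huv.trans hvw).trans (hwτ.trans hτ))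
    have e1 : germ (γ - β) η Y τ u w - germ (γ - β) η Y τ u v - germ (γ - β) η Y τ v w =
        (scaleSemigroup S (γ - β) (τ - v)).compLpL m μ
          ((scaleSemigroup S (γ - β) (v - u) ∘L embed S (γ - β) γ -
              embed S (γ - β) γ).compLpL m μ (evalAt γ x (Y u)) -
            evalAt (γ - β) x ((embedE S e (γ - β) γ).compLpL m μ (Y v) -
              (embedE S e (γ - β) γ).compLpL m μ (Y u))) := by
      rw [germ_sub_germ, germ_eq hS hν hκ (hvw.trans hwτ),
        embed_scaleSemigroup_apply hS hν hκ (by linarith), ← hx,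
        show τ - u = (τ - v) + (v - u) by ring,
        scaleSemigroup_add_apply hS _ (by linarith) (by linarith), ← _root_.map_sub]
      congr 1
      rw [compLpL_sub_apply, compLpL_comp_apply, _root_.map_sub, embed_evalAt (γ - β) γ x]
      abel
    have hvu : 0 ≤ v - u := sub_nonneg.2 huv
    have hwv : 0 ≤ w - v := sub_nonneg.2 hvw
    have n1 : ‖(scaleSemigroup S (γ - β) (v - u) ∘L embed S (γ - β) γ -
        embed S (γ - β) γ).compLpL m μ (evalAt γ x (Y u))‖ ≤
          C * (v - u) ^ β * (A * (w - v) ^ α * N) := by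
      refine (norm_compLpL_apply_le _ _).trans ?_
      gcongr
      · exact hCb _ hvu
      · exact (norm_evalAt_le _ _ _).trans (by gcongr)
    have n2 : ‖evalAt (γ - β) x ((embedE S e (γ - β) γ).compLpL m μ (Y v) -
        (embedE S e (γ - β) γ).compLpL m μ (Y u))‖ ≤
          A * (w - v) ^ α * (N * (v - u) ^ β) := by
      refine (norm_evalAt_le _ _ _).trans ?_
      gcongr
      exact h.norm_incr u v hu huv (hvw.trans (hwτ.trans hτ))
    rw [e1]
    have f1 : (v - u) ^ β ≤ (w - u) ^ β := by gcongr
    have f2 : (w - v) ^ α ≤ (w - u) ^ α := by gcongr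
    have hwu : 0 ≤ w - u := by linarith
    calc _ ≤ M * (C * (v - u) ^ β * (A * (w - v) ^ α * N) +
          A * (w - v) ^ α * (N * (v - u) ^ β)) := by
          refine (norm_compLpL_apply_le _ _).trans ?_
          gcongr
          · exact hM _ _ (by linarith)
          · exact (norm_sub_le _ _).trans (add_le_add n1 n2)
      _ = M * (C + 1) * (N * A) * ((w - v) ^ α * (v - u) ^ β) := by ring
      _ ≤ M * (C + 1) * (N * A) * ((w - u) ^ α * (w - u) ^ β) := by gcongr
      _ = _ := by rw [← Real.rpow_add_of_nonneg hwu hα.le hβ.le]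

/-- The random variables of `L^m(Ω, V)` which are measurable at time `t`. -/
def measurableAt (V : Type*) [NormedAddCommGroup V] (ℱ : Filtration ℝ≥0 mΩ) (m : ℝ≥0∞)
    (μ : Measure Ω) (t : ℝ) : AddSubgroup (Lp V m μ) :=
  lpMeasSubgroup V (ℱ t.toNNReal) m μ

theorem measurableAt_mono {V : Type*} [NormedAddCommGroup V] {s t : ℝ} (h : s ≤ t) {x : Lp V m μ}
    (hx : x ∈ measurableAt V ℱ m μ s) : x ∈ measurableAt V ℱ m μ t :=
  AEStronglyMeasurable.mono (ℱ.mono (Real.toNNReal_mono h)) hx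

theorem isClosed_measurableAt {V : Type*} [NormedAddCommGroup V] [CompleteSpace V] (t : ℝ) :
    IsClosed (measurableAt V ℱ m μ t : Set (Lp V m μ)) :=
  isClosed_aestronglyMeasurable (ℱ.le _)

theorem compLpL_mem_measurableAt {V V' : Type*} [NormedAddCommGroup V] [NormedSpace ℝ V]
    [NormedAddCommGroup V'] [NormedSpace ℝ V'] (f : V →L[ℝ] V') {t : ℝ} {x : Lp V m μ}
    (hx : x ∈ measurableAt V ℱ m μ t) : f.compLpL m μ x ∈ measurableAt V' ℱ m μ t :=
  aestronglyMeasurable_compLpL f hx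

theorem germ_mem_measurableAt (hS : IsAnalyticSemigroup S) (hν : IsExpStable S)
    (h : IsControlled ℱ α β T A N η Y) (hβ : 0 ≤ β) {τ u v : ℝ} (hu : 0 ≤ u) (huτ : u ≤ τ)
    (hτ : τ ≤ T) : germ (γ - β) η Y τ u v ∈ measurableAt (HScale S (γ - β)) ℱ m μ u := by
  rw [germ_eq hS hν (by linarith) huτ]
  exact compLpL_mem_measurableAt _ (compLpL_mem_measurableAt _ (h.adapted u hu (huτ.trans hτ)))

/-- The germ itself is bounded in H_γ; only its defect has to be measured in the rougher space
H_{γ-β}. -/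
theorem IsControlled.norm_semigroupApply_le (h : IsControlled ℱ α β T A N η Y) {M : ℝ}
    (hM0 : 0 < M) (hM : ∀ κ t : ℝ, 0 ≤ t → ‖scaleSemigroup S κ t‖ ≤ M) {τ u v : ℝ} (hu : 0 ≤ u)
    (huv : u ≤ v) (hvτ : v ≤ τ) (hτ : τ ≤ T) :
    ‖(semigroupApply S e γ (τ - u) (η v - η u)).compLpL m μ (Y u)‖ ≤
      M * (N * A) * (v - u) ^ α := by
  have hA := h.A_nonneg
  have hN := h.N_nonneg
  have hvu := sub_nonneg.2 huv
  rw [semigroupApply_compLpL]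
  calc _ ≤ M * ((A * (v - u) ^ α) * N) := by
        refine (norm_compLpL_apply_le _ _).trans ?_
        gcongr
        · exact hM _ _ (by linarith)
        · refine (norm_evalAt_le _ _ _).trans ?_
          gcongr
          · exact h.norm_eta u v hu huv (hvτ.trans hτ)
          · exact h.norm_le u hu (by linarith)
    _ = _ := by ring

/-- A family of primitives of the germs with endpoint `τ ∈ [0, T]`. -/
def IsConvolutionFamily (D ζ κ T : ℝ) (η : ℝ → EuclideanSpace ℝ (Fin e))
    (Y : ℝ → Lp (HScaleE S e γ) m μ) (g : ℝ → ℝ → Lp (HScale S κ) m μ) : Prop :=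
  ∀ τ, τ ≤ T → IsSewing (germ κ η Y τ) D ζ 0 τ (g τ)

variable {D : ℝ} {g : ℝ → ℝ → Lp (HScale S (γ - β)) m μ}

theorem IsConvolutionFamily.scaleSemigroup_sub
    (hg : IsConvolutionFamily D (α + β) (γ - β) T η Y g) (hS : IsAnalyticSemigroup S)
    (hν : IsExpStable S) (hβ : 0 ≤ β) (hαβ : 1 < α + β) (hD : 0 ≤ D) {u v τ t : ℝ} (hu : 0 ≤ u)
    (huv : u ≤ v) (hvτ : v ≤ τ) (hτt : τ ≤ t) (ht : t ≤ T) :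
    (scaleSemigroup S (γ - β) (t - τ)).compLpL m μ (g τ v - g τ u) = g t v - g t u :=
  (hg τ (hτt.trans ht)).map_sub_eq (hg t ht) hαβ hD hD hu hu huv hvτ (hvτ.trans hτt)
    (f := AddMonoidHomClass.toAddMonoidHom ((scaleSemigroup S (γ - β) (t - τ)).compLpL m μ))
    ((scaleSemigroup S (γ - β) (t - τ)).compLpL m μ).continuous
    fun _ _ _ hxy hyv => scaleSemigroup_germ hS hν (by linarith)
      (hxy.trans (hyv.trans hvτ)) hτt

theorem IsConvolutionFamily.sub_mem_measurableAt
    (hg : IsConvolutionFamily D (α + β) (γ - β) T η Y g) (hS : IsAnalyticSemigroup S)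
    (hν : IsExpStable S) (h : IsControlled ℱ α β T A N η Y)
    (hβ : 0 ≤ β) (hαβ : 1 < α + β) (hD : 0 ≤ D) {u v τ : ℝ} (hu : 0 ≤ u)
    (huv : u ≤ v) (hvτ : v ≤ τ) (hτ : τ ≤ T) :
    g τ v - g τ u ∈ measurableAt (HScale S (γ - β)) ℱ m μ v :=
  (hg τ hτ).sub_mem_of_isClosed hαβ hD hu huv hvτ _ (isClosed_measurableAt v)
    fun _ _ hux hxy hyv => measurableAt_mono (hxy.trans hyv)
      (germ_mem_measurableAt hS hν h hβ (hu.trans hux) (hxy.trans (hyv.trans hvτ)) hτ)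

end Germ

/-! ### Lifting the convolution to smoother spaces -/

section Lift

variable {H : Type*} [NormedAddCommGroup H] [InnerProductSpace ℝ H] [CompleteSpace H]
  {S : ℝ → H →L[ℝ] H}
  {Ω : Type*} {mΩ : MeasurableSpace Ω} {μ : Measure Ω} {m : ℝ≥0∞} [Fact (1 ≤ m)]
  {ℱ : Filtration ℝ≥0 mΩ} {e : ℕ} {α β γ θ : ℝ}

/-- The integral over an interval whose distance to the endpoint equals its length belongs to the
smoother space `H_{γ+θ}`. -/
theorem exists_lift_of_separated (hS : IsAnalyticSemigroup S) (hν : IsExpStable S)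
    (hβ : 0 < β) (hαβ : 1 < α + β) (hα1 : α < 1) (hβ1 : β < 1) (hθ : 0 ≤ θ) (hθα : θ < α)
    {D₀ : ℝ} (hD₀ : 0 ≤ D₀) :
    ∃ C : ℝ, 0 ≤ C ∧ ∀ (T A N : ℝ) (η : ℝ → EuclideanSpace ℝ (Fin e))
      (Y : ℝ → Lp (HScaleE S e γ) m μ), IsControlled ℱ α β T A N η Y →
      ∀ g : ℝ → ℝ → Lp (HScale S (γ - β)) m μ,
        IsConvolutionFamily (D₀ * (N * A)) (α + β) (γ - β) T η Y g →
      ∀ u h : ℝ, 0 ≤ u → 0 < h → u + h + h ≤ T → ∃ W : Lp (HScale S (γ + θ)) m μ,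
        (embed S (γ - β) (γ + θ)).compLpL m μ W = g (u + h + h) (u + h) - g (u + h + h) u ∧
        ‖W‖ ≤ C * (N * A) * h ^ (α - θ) ∧
        W ∈ measurableAt (HScale S (γ + θ)) ℱ m μ (u + h + h) := by
  obtain ⟨M, hM0, hM⟩ := exists_norm_scaleSemigroup_le hν
  obtain ⟨C₁, hC₁, hR₁⟩ := exists_scale_smoothing hS hν (κ := γ - β) (κ' := γ + θ)
    (by linarith) (by linarith)
  obtain ⟨C₂, hC₂, hR₂⟩ := exists_scale_smoothing hS hν (κ := γ) (κ' := γ + θ)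
    (by linarith) (by linarith)
  refine ⟨C₂ * M + C₁ * D₀, by positivity, fun T A N η Y hY g hg u h hu hh hT => ?_⟩
  obtain ⟨R₁, hR₁e, hR₁n⟩ := hR₁ h hh
  obtain ⟨R₂, hR₂e, hR₂n⟩ := hR₂ h hh
  have hNA : 0 ≤ N * A := mul_nonneg hY.N_nonneg hY.A_nonneg
  have hD : 0 ≤ D₀ * (N * A) := by positivity
  -- On H_γ the operator R₁ coincides with R₂, whose norm costs only h^{-θ}. This cheaper bound is
  -- used for the germ value, the full h^{-(θ+β)} only for the sewing remainder.
  have hR : R₁ ∘L embed S (γ - β) γ = R₂ := by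
    ext x
    apply embed_injective hS hν (γ₁ := γ - β) (γ₂ := γ + θ) (by linarith)
    have e1 := DFunLike.congr_fun hR₁e (embed S (γ - β) γ x)
    have e2 := DFunLike.congr_fun hR₂e x
    have e3 := DFunLike.congr_fun (embed_comp hS hν (γ₁ := γ - β) (γ₂ := γ) (γ₃ := γ + θ)
      (by linarith) (by linarith)) (R₂ x)
    have e4 := DFunLike.congr_fun (embed_scaleSemigroup hS hν (γ₁ := γ - β) (γ₂ := γ)
      (by linarith) hh.le) x
    simp only [ContinuousLinearMap.comp_apply] at *
    rw [e1, ← e3, e2, e4]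
  set J := g (u + h) (u + h) - g (u + h) u with hJ
  refine ⟨R₁.compLpL m μ J, ?_, ?_, ?_⟩
  · rw [← compLpL_comp_apply, hR₁e]
    have := hg.scaleSemigroup_sub hS hν hβ.le hαβ hD hu (by linarith : u ≤ u + h) le_rfl
      (by linarith : u + h ≤ u + h + h) hT
    rwa [add_sub_cancel_left] at this
  · set ξ := (semigroupApply S e γ (u + h - u) (η (u + h) - η u)).compLpL m μ (Y u) with hξ
    have hξn : ‖ξ‖ ≤ M * (N * A) * h ^ α := by
      have := hY.norm_semigroupApply_le hM0 hM hu (by linarith : u ≤ u + h) le_rfl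
        (by linarith : u + h ≤ T)
      rwa [← hξ, add_sub_cancel_left] at this
    have hrem : ‖J - (embed S (γ - β) γ).compLpL m μ ξ‖ ≤ D₀ * (N * A) * h ^ (α + β) := by
      have := hg (u + h) (by linarith) u (u + h) hu (by linarith) le_rfl
      rwa [add_sub_cancel_left] at this
    have hsplit : R₁.compLpL m μ J = R₂.compLpL m μ ξ +
        R₁.compLpL m μ (J - (embed S (γ - β) γ).compLpL m μ ξ) := by
      rw [← hR, compLpL_comp_apply, ← _root_.map_add, add_sub_cancel]
    rw [show -(γ + θ - γ) = -θ by ring] at hR₂n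
    rw [show -(γ + θ - (γ - β)) = -(θ + β) by ring] at hR₁n
    have p1 : h ^ (-θ) * h ^ α = h ^ (α - θ) := by
      rw [← Real.rpow_add hh]; congr 1; ring
    have p2 : h ^ (-(θ + β)) * h ^ (α + β) = h ^ (α - θ) := by
      rw [← Real.rpow_add hh]; congr 1; ring
    calc ‖R₁.compLpL m μ J‖ ≤ ‖R₂‖ * ‖ξ‖ +
          ‖R₁‖ * ‖J - (embed S (γ - β) γ).compLpL m μ ξ‖ := by
          rw [hsplit]
          exact (norm_add_le _ _).trans
            (add_le_add (norm_compLpL_apply_le _ _) (norm_compLpL_apply_le _ _))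
      _ ≤ C₂ * h ^ (-θ) * (M * (N * A) * h ^ α) +
          C₁ * h ^ (-(θ + β)) * (D₀ * (N * A) * h ^ (α + β)) := by gcongr
      _ = C₂ * M * (N * A) * (h ^ (-θ) * h ^ α) +
          C₁ * D₀ * (N * A) * (h ^ (-(θ + β)) * h ^ (α + β)) := by ring
      _ = _ := by rw [p1, p2]; ring
  · refine measurableAt_mono (by linarith : u + h ≤ u + h + h) (compLpL_mem_measurableAt _ ?_)
    exact hg.sub_mem_measurableAt hS hν hY hβ.le hαβ hD hu (by linarith) le_rfl (by linarith)

/-- The increment from u_n to t is a germ of size (t-u_n)^α plus a sewing error. This closes the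
telescoping sum over intervals that accumulate at t without reaching it. -/
theorem IsConvolutionFamily.tendsto_endpoint {T A N D : ℝ}
    {η : ℝ → EuclideanSpace ℝ (Fin e)} {Y : ℝ → Lp (HScaleE S e γ) m μ}
    {g : ℝ → ℝ → Lp (HScale S (γ - β)) m μ}
    (hg : IsConvolutionFamily D (α + β) (γ - β) T η Y g) (hν : IsExpStable S)
    (hY : IsControlled ℱ α β T A N η Y) (hα : 0 < α) (hβ : 0 < β) {t : ℝ} (ht : t ≤ T)
    {u : ℕ → ℝ} (hu : Tendsto u atTop (𝓝 t)) (hu0 : ∀ n, 0 ≤ u n) (hut : ∀ n, u n ≤ t) :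
    Tendsto (fun n => g t (u n)) atTop (𝓝 (g t t)) := by
  obtain ⟨M, hM0, hM⟩ := exists_norm_scaleSemigroup_le hν
  have hsub : Tendsto (fun n => t - u n) atTop (𝓝 0) := by
    simpa using (tendsto_const_nhds (x := t)).sub hu
  have hlim : Tendsto (fun n => ‖embed S (γ - β) γ‖ * (M * (N * A) * (t - u n) ^ α) +
      D * (t - u n) ^ (α + β)) atTop (𝓝 0) := by
    have h1 := ((hsub.rpow_const (p := α) (Or.inr hα.le)).const_mul (M * (N * A))).const_mul
      ‖embed S (γ - β) γ‖
    have h2 := (hsub.rpow_const (p := α + β) (Or.inr (by positivity))).const_mul D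
    have h3 := h1.add h2
    rwa [Real.zero_rpow hα.ne', Real.zero_rpow (by positivity), mul_zero, mul_zero, mul_zero,
      add_zero] at h3
  rw [tendsto_iff_norm_sub_tendsto_zero]
  refine squeeze_zero (fun n => norm_nonneg _) (fun n => ?_) hlim
  have h1 := hg t ht (u n) t (hu0 n) (hut n) le_rfl
  have h2 : ‖germ (γ - β) η Y t (u n) t‖ ≤
      ‖embed S (γ - β) γ‖ * (M * (N * A) * (t - u n) ^ α) := by
    refine (norm_compLpL_apply_le _ _).trans ?_
    gcongr
    exact hY.norm_semigroupApply_le hM0 hM (hu0 n) (hut n) le_rfl ht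
  calc ‖g t (u n) - g t t‖ = ‖germ (γ - β) η Y t (u n) t +
        (g t t - g t (u n) - germ (γ - β) η Y t (u n) t)‖ := by
        rw [norm_sub_rev]; congr 1; abel
    _ ≤ _ := (norm_add_le _ _).trans (add_le_add h2 h1)

/-- The mild increments of the convolution belong to the smoother space `H_{γ+θ}`. -/
theorem exists_lift (hS : IsAnalyticSemigroup S) (hν : IsExpStable S)
    (hβ : 0 < β) (hαβ : 1 < α + β) (hα1 : α < 1) (hβ1 : β < 1) (hθ : 0 ≤ θ) (hθα : θ < α)
    {D₀ : ℝ} (hD₀ : 0 ≤ D₀) :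
    ∃ C : ℝ, 0 ≤ C ∧ ∀ (T A N : ℝ) (η : ℝ → EuclideanSpace ℝ (Fin e))
      (Y : ℝ → Lp (HScaleE S e γ) m μ), IsControlled ℱ α β T A N η Y →
      ∀ g : ℝ → ℝ → Lp (HScale S (γ - β)) m μ,
        IsConvolutionFamily (D₀ * (N * A)) (α + β) (γ - β) T η Y g →
      ∀ s t : ℝ, 0 ≤ s → s ≤ t → t ≤ T → ∃ W : Lp (HScale S (γ + θ)) m μ,
        (embed S (γ - β) (γ + θ)).compLpL m μ W = g t t - g t s ∧
        ‖W‖ ≤ C * (N * A) * (t - s) ^ (α - θ) ∧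
        W ∈ measurableAt (HScale S (γ + θ)) ℱ m μ t := by
  obtain ⟨C, hC, hpiece⟩ := exists_lift_of_separated (ℱ := ℱ) (μ := μ) (m := m) (e := e) (γ := γ)
    hS hν hβ hαβ hα1 hβ1 hθ hθα hD₀
  have hq : 0 < α - θ := sub_pos.2 hθα
  set r : ℝ := (1 / 2 : ℝ) ^ (α - θ) with hr
  have hr0 : 0 ≤ r := by positivity
  have hr1 : r < 1 := Real.rpow_lt_one (by norm_num) (by norm_num) hq
  refine ⟨C * (1 - r)⁻¹, mul_nonneg hC (inv_nonneg.2 (sub_nonneg.2 hr1.le)),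
    fun T A N η Y hY g hg s t hs hst ht => ?_⟩
  rcases hst.eq_or_lt with rfl | hst
  · refine ⟨0, by rw [_root_.map_zero, sub_self], ?_, AddSubgroup.zero_mem _⟩
    rw [norm_zero, sub_self, Real.zero_rpow hq.ne', mul_zero]
  have hNA : 0 ≤ N * A := mul_nonneg hY.N_nonneg hY.A_nonneg
  -- The remaining distance to t is halved at each step, so the k-th piece has length h k equal to
  -- its distance from t.
  set u : ℕ → ℝ := fun k => t - (t - s) * (1 / 2 : ℝ) ^ k with hu
  set h : ℕ → ℝ := fun k => (t - s) / 2 * (1 / 2 : ℝ) ^ k with hh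
  have hpos : ∀ k, 0 < h k := fun k => mul_pos (by linarith) (by positivity)
  have huh : ∀ k, u k + h k = u (k + 1) := fun k => by simp only [hu, hh, pow_succ]; ring
  have huhh : ∀ k, u k + h k + h k = t := fun k => by simp only [hu, hh]; ring
  have hus : ∀ k, s ≤ u k := fun k => by
    have : (1 / 2 : ℝ) ^ k ≤ 1 := pow_le_one₀ (by norm_num) (by norm_num)
    simp only [hu]
    nlinarith
  have hu0 : ∀ k, 0 ≤ u k := fun k => hs.trans (hus k)
  have hut : ∀ k, u k ≤ t := fun k => by linarith [huhh k, hpos k]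
  have hulim : Tendsto u atTop (𝓝 t) := by
    have := (tendsto_pow_atTop_nhds_zero_of_lt_one (r := (1 / 2 : ℝ)) (by norm_num)
      (by norm_num)).const_mul (t - s)
    simpa [hu] using tendsto_const_nhds.sub this
  have hex : ∀ k, ∃ W : Lp (HScale S (γ + θ)) m μ,
      (embed S (γ - β) (γ + θ)).compLpL m μ W = g t (u (k + 1)) - g t (u k) ∧
      ‖W‖ ≤ C * (N * A) * ((t - s) / 2) ^ (α - θ) * r ^ k ∧
      W ∈ measurableAt (HScale S (γ + θ)) ℱ m μ t := fun k => by
    obtain ⟨W, h1, h2, h3⟩ := hpiece T A N η Y hY g hg (u k) (h k) (hu0 k) (hpos k)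
      (by rw [huhh]; exact ht)
    rw [huhh, huh] at h1
    rw [huhh] at h3
    refine ⟨W, h1, h2.trans_eq ?_, h3⟩
    rw [hh, Real.mul_rpow (by linarith) (by positivity), hr, Real.rpow_pow_comm (by norm_num)]
    ring
  choose W hW1 hW2 hW3 using hex
  -- Piece k has norm of order h_k^{α-θ}, hence the ratio r = 2^{-(α-θ)}, below 1 because θ < α.
  have hsum := (hasSum_geometric_of_lt_one hr0 hr1).mul_left
    (C * (N * A) * ((t - s) / 2) ^ (α - θ))
  have hWs : Summable W := Summable.of_norm_bounded hsum.summable hW2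
  have hWlim := hWs.hasSum.tendsto_sum_nat
  refine ⟨∑' k, W k, ?_, ?_, ?_⟩
  · refine tendsto_nhds_unique
      ((((embed S (γ - β) (γ + θ)).compLpL m μ).continuous.tendsto _).comp hWlim) ?_
    have h1 := (hg.tendsto_endpoint hν hY (by linarith) hβ ht hulim hu0 hut).sub_const (g t s)
    refine h1.congr fun n => ?_
    rw [Function.comp_apply, map_sum, Finset.sum_congr rfl fun k _ => hW1 k,
      Finset.sum_range_sub (fun k => g t (u k))]
    simp [hu]
  · refine (tsum_of_norm_bounded hsum hW2).trans ?_
    have : ((t - s) / 2) ^ (α - θ) ≤ (t - s) ^ (α - θ) := by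
      refine Real.rpow_le_rpow (by linarith) (by linarith) hq.le
    have h1 : 0 ≤ (1 - r)⁻¹ := inv_nonneg.2 (sub_nonneg.2 hr1.le)
    calc _ ≤ C * (N * A) * (t - s) ^ (α - θ) * (1 - r)⁻¹ := by gcongr
      _ = _ := by ring
  · exact (isClosed_measurableAt t).mem_of_tendsto hWlim
      (Eventually.of_forall fun n => AddSubgroup.sum_mem _ fun k _ => hW3 k)

end Lift

/-! ### Partitions and Riemann sums -/

section Partitions

variable {T : ℝ} {s t : Icc (0 : ℝ) T}

/-- The points of a partition, continued by the last one. -/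
def IntervalPartition.seq (π : IntervalPartition s t) (k : ℕ) : ℝ :=
  π.pts ⟨min k π.n, Nat.lt_succ_of_le (min_le_right _ _)⟩

theorem IntervalPartition.seq_mono (π : IntervalPartition s t) : Monotone π.seq := fun _ _ hij =>
  π.strictMono.monotone (Fin.mk_le_mk.2 (min_le_min_right _ hij))

theorem IntervalPartition.seq_castSucc (π : IntervalPartition s t) (i : Fin π.n) :
    π.seq i = π.pts i.castSucc := by
  rw [IntervalPartition.seq]
  congr 2
  exact Fin.ext (min_eq_left i.2.le)

theorem IntervalPartition.seq_succ (π : IntervalPartition s t) (i : Fin π.n) :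
    π.seq (i + 1) = π.pts i.succ := by
  rw [IntervalPartition.seq]
  congr 2
  exact Fin.ext (min_eq_left i.2)

theorem IntervalPartition.seq_zero (π : IntervalPartition s t) : π.seq 0 = s := by
  refine Eq.trans ?_ (congrArg Subtype.val π.first)
  rw [IntervalPartition.seq]
  congr 2

theorem IntervalPartition.seq_last (π : IntervalPartition s t) : π.seq π.n = t := by
  refine Eq.trans ?_ (congrArg Subtype.val π.last)
  rw [IntervalPartition.seq]
  congr 2
  exact Fin.ext (min_self _)

theorem IntervalPartition.seq_sub_le_mesh (π : IntervalPartition s t) {k : ℕ} (hk : k < π.n) :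
    π.seq (k + 1) - π.seq k ≤ π.mesh := by
  have h1 := π.seq_castSucc ⟨k, hk⟩
  have h2 := π.seq_succ ⟨k, hk⟩
  simp only at h1 h2
  rw [h1, h2]
  exact le_ciSup (f := fun i : Fin π.n => ((π.pts i.succ : ℝ) - π.pts i.castSucc))
    (finite_range _).bddAbove ⟨k, hk⟩

/-- The uniform partition of `[s, t]` into `n + 1` intervals. -/
def uniformPartition (hst : s < t) (n : ℕ) : IntervalPartition s t where
  n := n + 1
  pts i := ⟨uniformGrid s t n i,
    s.2.1.trans (uniformGrid_mem (le_of_lt hst) (Nat.lt_succ_iff.1 i.2)).1,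
    (uniformGrid_mem (le_of_lt hst) (Nat.lt_succ_iff.1 i.2)).2.trans t.2.2⟩
  strictMono i j hij := by
    have h : (0 : ℝ) < t - s := sub_pos.2 hst
    have hij' : ((i : ℕ) : ℝ) < ((j : ℕ) : ℝ) := by exact_mod_cast hij
    change uniformGrid s t n i < uniformGrid s t n j
    unfold uniformGrid
    gcongr
  first := Subtype.ext (uniformGrid_zero _ _ _)
  last := Subtype.ext (uniformGrid_last _ _ _)

theorem mesh_uniformPartition (hst : s < t) (n : ℕ) :
    (uniformPartition hst n).mesh = ((t : ℝ) - s) / (n + 1) := by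
  have h : ∀ i : Fin (n + 1), (((uniformPartition hst n).pts i.succ : ℝ) -
      (uniformPartition hst n).pts i.castSucc) = ((t : ℝ) - s) / (n + 1) := fun i =>
    uniformGrid_succ_sub _ _ _ _
  exact (congrArg iSup (funext h)).trans ciSup_const

/-- Partitions of arbitrarily small mesh exist, so limits along the mesh filter are unique. For s =
t the one-point partition serves, with mesh an empty supremum, equal to 0. -/
theorem neBot_comap_mesh (hst : s ≤ t) :
    (comap (IntervalPartition.mesh : IntervalPartition s t → ℝ) (𝓝 0)).NeBot := by
  rw [comap_neBot_iff]
  intro U hU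
  rcases hst.eq_or_lt with rfl | hst
  · have hmono : StrictMono (fun _ : Fin (0 + 1) => s) := fun i j hij => by omega
    refine ⟨⟨0, fun _ => s, hmono, rfl, rfl⟩, ?_⟩
    have : IntervalPartition.mesh (s := s) (t := s) ⟨0, fun _ => s, hmono, rfl, rfl⟩ = 0 :=
      Real.iSup_of_isEmpty _
    rw [this]
    exact mem_of_mem_nhds hU
  · have hlim : Tendsto (fun n : ℕ => ((t : ℝ) - s) / ((n : ℝ) + 1)) atTop (𝓝 0) := by
      have := (tendsto_one_div_add_atTop_nhds_zero_nat (𝕜 := ℝ)).const_mul ((t : ℝ) - s)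
      simpa only [mul_one_div, mul_zero] using this
    obtain ⟨n, hn⟩ := (hlim.eventually hU).exists
    exact ⟨uniformPartition hst n, by rwa [mesh_uniformPartition]⟩

end Partitions

section RiemannSums

variable {Ω : Type*} {mΩ : MeasurableSpace Ω} {μ : Measure Ω} {m : ℝ≥0∞} [Fact (1 ≤ m)] {T : ℝ}
  {H : Type*} [NormedAddCommGroup H] [InnerProductSpace ℝ H] {S : ℝ → H →L[ℝ] H} {e : ℕ}
  {κ γ ζ D : ℝ} {s t : Icc (0 : ℝ) T}

theorem embed_riemannSum (hT : 0 ≤ T) (η : Icc (0 : ℝ) T → EuclideanSpace ℝ (Fin e))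
    (Y : Icc (0 : ℝ) T → Lp (HScaleE S e γ) m μ) (π : IntervalPartition s t) :
    (embed S κ γ).compLpL m μ (riemannSum S η Y π) = ∑ k ∈ Finset.range π.n,
      germ κ (IccExtend hT η) (IccExtend hT Y) t (π.seq k) (π.seq (k + 1)) := by
  rw [riemannSum, map_sum, Finset.sum_range]
  refine Finset.sum_congr rfl fun i _ => ?_
  rw [π.seq_castSucc, π.seq_succ, germ, IccExtend_val, IccExtend_val, IccExtend_val]
  rfl

theorem IsSewing.tendsto_riemannSum (hT : 0 ≤ T)
    {η : Icc (0 : ℝ) T → EuclideanSpace ℝ (Fin e)}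
    {Y : Icc (0 : ℝ) T → Lp (HScaleE S e γ) m μ} {g : ℝ → Lp (HScale S κ) m μ}
    (hg : IsSewing (germ κ (IccExtend hT η) (IccExtend hT Y) t) D ζ 0 t g) (hζ : 1 < ζ)
    (hD : 0 ≤ D) :
    Tendsto (fun π : IntervalPartition s t => (embed S κ γ).compLpL m μ (riemannSum S η Y π))
      (comap IntervalPartition.mesh (𝓝 0)) (𝓝 (g t - g s)) := by
  have hmesh : Tendsto (IntervalPartition.mesh : IntervalPartition s t → ℝ)
      (comap IntervalPartition.mesh (𝓝 0)) (𝓝 0) := tendsto_comap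
  have hlim : Tendsto (fun π : IntervalPartition s t =>
      D * π.mesh ^ (ζ - 1) * ((t : ℝ) - s)) (comap IntervalPartition.mesh (𝓝 0)) (𝓝 0) := by
    have h1 := (hmesh.rpow_const (p := ζ - 1) (Or.inr (by linarith))).const_mul D
    have h2 := h1.mul_const ((t : ℝ) - s)
    rwa [Real.zero_rpow (by linarith), mul_zero, zero_mul] at h2
  rw [tendsto_iff_norm_sub_tendsto_zero]
  refine squeeze_zero (fun π => norm_nonneg _) (fun π => ?_) hlim
  have h := hg.norm_sum_sub_le hζ hD π.seq_mono (n := π.n) (by rw [π.seq_zero]; exact s.2.1)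
    (by rw [π.seq_last]) fun k hk => π.seq_sub_le_mesh hk
  rwa [π.seq_zero, π.seq_last, ← embed_riemannSum] at h

/-! ### Bilinearity of Riemann sums and uniqueness of their limits -/

theorem evalAt_add (x y : EuclideanSpace ℝ (Fin e)) (z : Lp (HScaleE S e κ) m μ) :
    evalAt κ (x + y) z = evalAt κ x z + evalAt κ y z := by
  rw [evalAt, evalAt, evalAt, _root_.map_add, ContinuousLinearMap.add_compLpL, add_apply]

theorem evalAt_smul (c : ℝ) (x : EuclideanSpace ℝ (Fin e)) (z : Lp (HScaleE S e κ) m μ) :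
    evalAt κ (c • x) z = c • evalAt κ x z := by
  rw [evalAt, evalAt, _root_.map_smul, ContinuousLinearMap.smul_compLpL, smul_apply]

theorem riemannSum_add_left (η η' : Icc (0 : ℝ) T → EuclideanSpace ℝ (Fin e))
    (Y : Icc (0 : ℝ) T → Lp (HScaleE S e γ) m μ) (π : IntervalPartition s t) :
    riemannSum S (η + η') Y π = riemannSum S η Y π + riemannSum S η' Y π := by
  rw [riemannSum, riemannSum, riemannSum, ← Finset.sum_add_distrib]
  refine Finset.sum_congr rfl fun i _ => ?_
  rw [semigroupApply_compLpL, semigroupApply_compLpL, semigroupApply_compLpL,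
    ← _root_.map_add, ← evalAt_add]
  congr 3
  simp only [incr, Pi.add_apply]
  abel

theorem riemannSum_smul_left (c : ℝ) (η : Icc (0 : ℝ) T → EuclideanSpace ℝ (Fin e))
    (Y : Icc (0 : ℝ) T → Lp (HScaleE S e γ) m μ) (π : IntervalPartition s t) :
    riemannSum S (c • η) Y π = c • riemannSum S η Y π := by
  rw [riemannSum, riemannSum, Finset.smul_sum]
  refine Finset.sum_congr rfl fun i _ => ?_
  rw [semigroupApply_compLpL, semigroupApply_compLpL, ← _root_.map_smul, ← evalAt_smul]
  congr 3
  simp only [incr, Pi.smul_apply, smul_sub]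

theorem riemannSum_add_right (η : Icc (0 : ℝ) T → EuclideanSpace ℝ (Fin e))
    (Y Y' : Icc (0 : ℝ) T → Lp (HScaleE S e γ) m μ) (π : IntervalPartition s t) :
    riemannSum S η (Y + Y') π = riemannSum S η Y π + riemannSum S η Y' π := by
  rw [riemannSum, riemannSum, riemannSum, ← Finset.sum_add_distrib]
  exact Finset.sum_congr rfl fun i _ => _root_.map_add _ _ _

theorem riemannSum_smul_right (c : ℝ) (η : Icc (0 : ℝ) T → EuclideanSpace ℝ (Fin e))
    (Y : Icc (0 : ℝ) T → Lp (HScaleE S e γ) m μ) (π : IntervalPartition s t) :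
    riemannSum S η (c • Y) π = c • riemannSum S η Y π := by
  rw [riemannSum, riemannSum, Finset.smul_sum]
  refine Finset.sum_congr rfl fun i _ => ?_
  rw [Pi.smul_apply, _root_.map_smul]

/-- `Z_t` is the limit of the Riemann sums over the partitions of `[0, t]`. -/
def IsRiemannLimit (κ : ℝ) (η : Icc (0 : ℝ) T → EuclideanSpace ℝ (Fin e))
    (Y : Icc (0 : ℝ) T → Lp (HScaleE S e γ) m μ) (Z : Icc (0 : ℝ) T → Lp (HScale S κ) m μ) :
    Prop :=
  ∀ s t : Icc (0 : ℝ) T, (s : ℝ) = 0 →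
    Tendsto (fun π : IntervalPartition s t => (embed S κ γ).compLpL m μ (riemannSum S η Y π))
      (comap IntervalPartition.mesh (𝓝 0)) (𝓝 (Z t))

variable {η η' : Icc (0 : ℝ) T → EuclideanSpace ℝ (Fin e)}
  {Y Y' : Icc (0 : ℝ) T → Lp (HScaleE S e γ) m μ} {Z Z' : Icc (0 : ℝ) T → Lp (HScale S κ) m μ}

theorem IsRiemannLimit.unique (h : IsRiemannLimit κ η Y Z) (h' : IsRiemannLimit κ η Y Z') :
    Z = Z' := funext fun t => by
  let s : Icc (0 : ℝ) T := ⟨0, le_rfl, t.2.1.trans t.2.2⟩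
  have hs : s ≤ t := t.2.1
  have := neBot_comap_mesh hs
  exact tendsto_nhds_unique (h s t rfl) (h' s t rfl)

theorem IsRiemannLimit.congr (h : IsRiemannLimit κ η Y Z) (hZ : Z = Z') :
    IsRiemannLimit κ η Y Z' := hZ ▸ h

theorem IsRiemannLimit.add_left (h : IsRiemannLimit κ η Y Z) (h' : IsRiemannLimit κ η' Y Z') :
    IsRiemannLimit κ (η + η') Y (Z + Z') := fun s t hs =>
  ((h s t hs).add (h' s t hs)).congr fun π => by
    rw [riemannSum_add_left, _root_.map_add]

theorem IsRiemannLimit.add_right (h : IsRiemannLimit κ η Y Z) (h' : IsRiemannLimit κ η Y' Z') :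
    IsRiemannLimit κ η (Y + Y') (Z + Z') := fun s t hs =>
  ((h s t hs).add (h' s t hs)).congr fun π => by
    rw [riemannSum_add_right, _root_.map_add]

theorem IsRiemannLimit.smul_left (h : IsRiemannLimit κ η Y Z) (c : ℝ) :
    IsRiemannLimit κ (c • η) Y (c • Z) := fun s t hs =>
  ((h s t hs).const_smul c).congr fun π => by
    rw [riemannSum_smul_left, _root_.map_smul]

theorem IsRiemannLimit.smul_right (h : IsRiemannLimit κ η Y Z) (c : ℝ) :
    IsRiemannLimit κ η (c • Y) (c • Z) := fun s t hs =>
  ((h s t hs).const_smul c).congr fun π => by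
    rw [riemannSum_smul_right, _root_.map_smul]

/-- Since Z_0 = 0, the mild increment from 0 to t is Z_t itself, so the Riemann sums alone determine
Z. -/
theorem IsYoungConvolution.isRiemannLimit {ℱ : Filtration ℝ≥0 mΩ} {α : ℝ}
    (h : IsYoungConvolution S ℱ α η Y Z) : IsRiemannLimit κ η Y Z := fun s t hs => by
  have h1 := h.tendsto s t (by rw [← Subtype.coe_le_coe, hs]; exact t.2.1)
  rwa [hatIncr, mildIncr, h.zero s hs, _root_.map_zero, sub_zero] at h1

end RiemannSums

/-! ### Hölder norms -/

section HolderNorms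

variable {T : ℝ} {V : Type*} [NormedAddCommGroup V] [NormedSpace ℝ V]

theorem holderNorm_le_ofReal {β c : ℝ} {A : Icc (0 : ℝ) T → Icc (0 : ℝ) T → V} (hc : 0 ≤ c)
    (h : ∀ s t, s < t → ‖A s t‖ ≤ c * ((t : ℝ) - s) ^ β) :
    holderNorm β A ≤ ENNReal.ofReal c := by
  refine iSup_le fun s => iSup_le fun t => iSup_le fun hst => ?_
  refine ENNReal.div_le_of_le_mul ?_
  rw [← ENNReal.ofReal_mul hc, ← ofReal_norm]
  exact ENNReal.ofReal_le_ofReal (h s t hst)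

theorem norm_le_holderNorm_toReal {β : ℝ} {A : Icc (0 : ℝ) T → Icc (0 : ℝ) T → V}
    (hA : holderNorm β A ≠ ⊤) {s t : Icc (0 : ℝ) T} (hst : s < t) :
    ‖A s t‖ ≤ (holderNorm β A).toReal * ((t : ℝ) - s) ^ β := by
  have hpos : 0 < ((t : ℝ) - s) ^ β := Real.rpow_pos_of_pos (sub_pos.2 hst) _
  have h : ‖A s t‖ₑ / ENNReal.ofReal (((t : ℝ) - s) ^ β) ≤ holderNorm β A :=
    le_iSup₂_of_le s t (le_iSup_of_le hst le_rfl)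
  rw [ENNReal.div_le_iff (by simpa using hpos) ENNReal.ofReal_ne_top] at h
  have h' := ENNReal.toReal_mono (ENNReal.mul_ne_top hA ENNReal.ofReal_ne_top) h
  rwa [ENNReal.toReal_mul, ENNReal.toReal_ofReal hpos.le, toReal_enorm] at h'

theorem supNorm_le_ofReal {Y : Icc (0 : ℝ) T → V} {c : ℝ} (h : ∀ t, ‖Y t‖ ≤ c) :
    supNorm Y ≤ ENNReal.ofReal c := iSup_le fun t => by
  rw [← ofReal_norm]
  exact ENNReal.ofReal_le_ofReal (h t)

theorem supNorm_ne_top {Y : Icc (0 : ℝ) T → V} (hY : Continuous Y) : supNorm Y ≠ ⊤ := by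
  obtain ⟨c, hc⟩ := (isCompact_range hY).isBounded.exists_norm_le
  exact ((supNorm_le_ofReal fun t => hc _ ⟨t, rfl⟩).trans_lt ENNReal.ofReal_lt_top).ne

theorem norm_le_supNorm_toReal {Y : Icc (0 : ℝ) T → V} (hY : supNorm Y ≠ ⊤) (t : Icc (0 : ℝ) T) :
    ‖Y t‖ ≤ (supNorm Y).toReal := by
  rw [← toReal_enorm]
  exact ENNReal.toReal_mono hY (le_iSup (fun t => ‖Y t‖ₑ) t)

theorem continuous_of_norm_sub_le {Z : Icc (0 : ℝ) T → V} {K₁ K₂ p q : ℝ} (hp : 0 < p)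
    (hq : 0 < q) (h : ∀ s t, s ≤ t →
      ‖Z t - Z s‖ ≤ K₁ * ((t : ℝ) - s) ^ p + K₂ * ((t : ℝ) - s) ^ q) : Continuous Z := by
  refine continuous_iff_continuousAt.2 fun s => ?_
  rw [ContinuousAt, tendsto_iff_norm_sub_tendsto_zero]
  have hd : Tendsto (fun t : Icc (0 : ℝ) T => |(t : ℝ) - s|) (𝓝 s) (𝓝 0) := by
    have : Continuous fun t : Icc (0 : ℝ) T => |(t : ℝ) - s| := by fun_prop
    simpa using this.tendsto s
  have hlim : Tendsto (fun t : Icc (0 : ℝ) T => K₁ * |(t : ℝ) - s| ^ p + K₂ * |(t : ℝ) - s| ^ q)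
      (𝓝 s) (𝓝 0) := by
    have h1 := ((hd.rpow_const (p := p) (Or.inr hp.le)).const_mul K₁).add
      ((hd.rpow_const (p := q) (Or.inr hq.le)).const_mul K₂)
    rwa [Real.zero_rpow hp.ne', Real.zero_rpow hq.ne', mul_zero, mul_zero, add_zero] at h1
  refine squeeze_zero (fun t => norm_nonneg _) (fun t => ?_) hlim
  rcases le_total s t with hst | hts
  · rw [abs_of_nonneg (sub_nonneg.2 (Subtype.coe_le_coe.2 hst))]
    exact h s t hst
  · rw [abs_sub_comm, abs_of_nonneg (sub_nonneg.2 (Subtype.coe_le_coe.2 hts)), norm_sub_rev]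
    exact h t s hts

end HolderNorms

/-! ### The convolution as a process -/

section ConvolutionLifts

variable {Ω : Type*} {mΩ : MeasurableSpace Ω} {μ : Measure Ω} {m : ℝ≥0∞} [Fact (1 ≤ m)]
  {H : Type*} [NormedAddCommGroup H] [InnerProductSpace ℝ H] [CompleteSpace H]
  {S : ℝ → H →L[ℝ] H} {ℱ : Filtration ℝ≥0 mΩ} {e : ℕ} {α β γ θ T : ℝ}

theorem holderNorm_incr_ne_top {η : Icc (0 : ℝ) T → EuclideanSpace ℝ (Fin e)}
    (hη : η ∈ HolderPath T α e) : holderNorm α (incr η) ≠ ⊤ := hη.2.ne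

theorem eSpaceNorm_ne_top {V V' : Type*} [NormedAddCommGroup V] [NormedSpace ℝ V]
    [NormedAddCommGroup V'] [NormedSpace ℝ V'] {ι : V →L[ℝ] V'} {Y : Icc (0 : ℝ) T → Lp V m μ}
    (hY : Y ∈ ESpace μ m T ℱ β ι) : eSpaceNorm β ι Y ≠ ⊤ :=
  ENNReal.add_ne_top.2 ⟨hY.1.2.2.ne, supNorm_ne_top hY.2⟩

/-- Paths on [0,T] are extended to all real times by their end values, and the E-norm of Y dominates
both its supremum and its Hölder seminorm. -/
theorem isControlled_IccExtend (hT : 0 ≤ T) (hα : 0 < α) (hβ : 0 < β)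
    {η : Icc (0 : ℝ) T → EuclideanSpace ℝ (Fin e)} (hη : η ∈ HolderPath T α e)
    {Y : Icc (0 : ℝ) T → Lp (HScaleE S e γ) m μ}
    (hY : Y ∈ ESpace μ m T ℱ β (embedE S e (γ - β) γ)) :
    IsControlled ℱ α β T (holderNorm α (incr η)).toReal
      (eSpaceNorm β (embedE S e (γ - β) γ) Y).toReal (IccExtend hT η) (IccExtend hT Y) where
  A_nonneg := ENNReal.toReal_nonneg
  N_nonneg := ENNReal.toReal_nonneg
  norm_eta u v hu huv hv := by
    rcases huv.eq_or_lt with rfl | huv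
    · rw [sub_self, sub_self, norm_zero, Real.zero_rpow hα.ne', mul_zero]
    · rw [IccExtend_of_mem hT η ⟨hu.trans huv.le, hv⟩, IccExtend_of_mem hT η ⟨hu, huv.le.trans hv⟩]
      exact norm_le_holderNorm_toReal (holderNorm_incr_ne_top hη)
        (s := ⟨u, hu, huv.le.trans hv⟩) (t := ⟨v, hu.trans huv.le, hv⟩) huv
  norm_le u hu huT := by
    rw [IccExtend_of_mem hT Y ⟨hu, huT⟩]
    refine (norm_le_supNorm_toReal (supNorm_ne_top hY.2) _).trans ?_
    exact ENNReal.toReal_mono (eSpaceNorm_ne_top hY) le_add_self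
  norm_incr u v hu huv hv := by
    rcases huv.eq_or_lt with rfl | huv
    · rw [sub_self, sub_self, norm_zero, Real.zero_rpow hβ.ne', mul_zero]
    · rw [IccExtend_of_mem hT Y ⟨hu.trans huv.le, hv⟩, IccExtend_of_mem hT Y ⟨hu, huv.le.trans hv⟩]
      refine (norm_le_holderNorm_toReal hY.1.2.2.ne
        (s := ⟨u, hu, huv.le.trans hv⟩) (t := ⟨v, hu.trans huv.le, hv⟩) huv).trans ?_
      have h1 : (0 : ℝ) ≤ (v - u) ^ β := Real.rpow_nonneg (sub_nonneg.2 huv.le) _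
      exact mul_le_mul_of_nonneg_right
        (ENNReal.toReal_mono (eSpaceNorm_ne_top hY) le_self_add) h1
  adapted u hu huT := by
    rw [IccExtend_of_mem hT Y ⟨hu, huT⟩, Real.toNNReal_of_nonneg hu]
    exact hY.1.2.1.aestronglyMeasurable ⟨u, hu, huT⟩

theorem hatIncr_mapPath_embed (hS : IsAnalyticSemigroup S) (hν : IsExpStable S) {κ ρ : ℝ}
    (h : κ ≤ ρ) (Z : Icc (0 : ℝ) T → Lp (HScale S ρ) m μ) {s t : Icc (0 : ℝ) T} (hst : s ≤ t) :
    hatIncr S (mapPath (embed S κ ρ) Z) s t =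
      (embed S κ ρ).compLpL m μ (hatIncr S Z s t) := by
  simp only [hatIncr, mildIncr, mapPath]
  rw [_root_.map_sub, embed_scaleSemigroup_apply hS hν h
    (sub_nonneg.2 (Subtype.coe_le_coe.2 hst))]

/-- `Z` is an adapted process with values in `H_ρ`, its mild increments are bounded by
`K |t - s| ^ q`, and are the limits of the Riemann sums in `H_κ`. -/
structure IsConvolutionLift (ℱ : Filtration ℝ≥0 mΩ) (κ q K : ℝ) {ρ : ℝ}
    (η : Icc (0 : ℝ) T → EuclideanSpace ℝ (Fin e)) (Y : Icc (0 : ℝ) T → Lp (HScaleE S e γ) m μ)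
    (Z : Icc (0 : ℝ) T → Lp (HScale S ρ) m μ) : Prop where
  zero : ∀ t : Icc (0 : ℝ) T, (t : ℝ) = 0 → Z t = 0
  adapted : ∀ t : Icc (0 : ℝ) T, AEStronglyMeasurable[ℱ ⟨(t : ℝ), t.2.1⟩] (Z t) μ
  norm_hatIncr_le : ∀ s t : Icc (0 : ℝ) T, s ≤ t → ‖hatIncr S Z s t‖ ≤ K * ((t : ℝ) - s) ^ q
  tendsto : ∀ s t : Icc (0 : ℝ) T, s ≤ t →
    Tendsto (fun π : IntervalPartition s t => (embed S κ γ).compLpL m μ (riemannSum S η Y π))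
      (comap IntervalPartition.mesh (𝓝 0)) (𝓝 (hatIncr S (mapPath (embed S κ ρ) Z) s t))

theorem exists_isConvolutionLift (hS : IsAnalyticSemigroup S) (hν : IsExpStable S)
    (hα : 0 < α) (hβ : 0 < β) (hαβ : 1 < α + β) (hα1 : α < 1) (hβ1 : β < 1) (hθ : 0 ≤ θ)
    (hθα : θ < α) :
    ∃ C : ℝ, 0 ≤ C ∧ ∀ T : ℝ, 0 < T → ∀ η ∈ HolderPath T α e,
      ∀ Y ∈ ESpace μ m T ℱ β (embedE S e (γ - β) γ),
        ∃ Z : Icc (0 : ℝ) T → Lp (HScale S (γ + θ)) m μ,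
          IsConvolutionLift ℱ (γ - β) (α - θ)
            (C * ((eSpaceNorm β (embedE S e (γ - β) γ) Y).toReal *
              (holderNorm α (incr η)).toReal)) η Y Z := by
  obtain ⟨C₀, hC₀, hadd⟩ := exists_germ_isAlmostAdditive (ℱ := ℱ) (μ := μ) (m := m) (e := e)
    (γ := γ) hS hν hα hβ hβ1
  have hc := (sewingConst_pos hαβ).le
  have hD₀ : 0 ≤ sewingConst (α + β) * C₀ := by positivity
  obtain ⟨C, hC, hlift⟩ := exists_lift (ℱ := ℱ) (μ := μ) (m := m) (e := e)
    (γ := γ) hS hν hβ hαβ hα1 hβ1 hθ hθα hD₀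
  refine ⟨C, hC, fun T hT η hη Y hY => ?_⟩
  have hcon := isControlled_IccExtend hT.le hα hβ hη hY
  set N := (eSpaceNorm β (embedE S e (γ - β) γ) Y).toReal
  set A := (holderNorm α (incr η)).toReal
  have hNA : 0 ≤ N * A := mul_nonneg hcon.N_nonneg hcon.A_nonneg
  have hD : 0 ≤ sewingConst (α + β) * C₀ * (N * A) := by positivity
  have hex : ∀ τ, ∃ g : ℝ → Lp (HScale S (γ - β)) m μ, τ ≤ T →
      IsSewing (germ (γ - β) (IccExtend hT.le η) (IccExtend hT.le Y) τ)
        (sewingConst (α + β) * C₀ * (N * A)) (α + β) 0 τ g := fun τ => by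
    by_cases hτ : τ ≤ T
    · obtain ⟨g, hg⟩ := (hadd T A N _ _ hcon τ hτ).exists_isSewing hαβ (by positivity)
      rw [← mul_assoc] at hg
      exact ⟨g, fun _ => hg⟩
    · exact ⟨0, fun h => absurd h hτ⟩
  choose g hg using hex
  have hfam : IsConvolutionFamily (sewingConst (α + β) * C₀ * (N * A)) (α + β) (γ - β) T
    (IccExtend hT.le η) (IccExtend hT.le Y) g := hg
  have hl := hlift T A N _ _ hcon g hfam
  -- The value Z_t is the lift to H_{γ+θ} of g^t(t) - g^t(0).
  choose Z hZ1 hZ2 hZ3 using fun t : Icc (0 : ℝ) T => hl 0 t le_rfl t.2.1 t.2.2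
  have hembed : ∀ s t : Icc (0 : ℝ) T, s ≤ t →
      hatIncr S (mapPath (embed S (γ - β) (γ + θ)) Z) s t = g t t - g t s := fun s t hst => by
    -- The operator S_{t-s} maps g^s(s) - g^s(0) to g^t(s) - g^t(0), so the mild increment
    -- telescopes.
    have h1 := hfam.scaleSemigroup_sub hS hν hβ.le hαβ hD le_rfl s.2.1 le_rfl
      (Subtype.coe_le_coe.2 hst) t.2.2
    simp only [hatIncr, mildIncr, mapPath]
    rw [hZ1, hZ1, h1]
    abel
  refine ⟨Z, ⟨fun t ht => ?_, fun t => ?_, fun s t hst => ?_, fun s t hst => ?_⟩⟩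
  · have h1 := hZ2 t
    rw [ht, sub_zero, Real.zero_rpow (by linarith), mul_zero] at h1
    exact norm_le_zero_iff.1 h1
  · have h1 : AEStronglyMeasurable[ℱ (Real.toNNReal t)] (Z t) μ := hZ3 t
    rwa [Real.toNNReal_of_nonneg t.2.1] at h1
  · obtain ⟨W, hW1, hW2, -⟩ := hl s t s.2.1 hst t.2.2
    have : hatIncr S Z s t = W := by
      apply compLpL_injective (embed_injective hS hν (γ₁ := γ - β) (γ₂ := γ + θ) (by linarith))
      rw [hW1, ← hembed s t hst, hatIncr_mapPath_embed hS hν (by linarith) Z hst]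
    rw [this]
    exact hW2
  · rw [hembed s t hst]
    exact (hg t t.2.2).tendsto_riemannSum hT.le hαβ hD

namespace IsConvolutionLift

variable {κ ρ ρ' q q' K K' : ℝ} {η : Icc (0 : ℝ) T → EuclideanSpace ℝ (Fin e)}
  {Y : Icc (0 : ℝ) T → Lp (HScaleE S e γ) m μ} {Z : Icc (0 : ℝ) T → Lp (HScale S ρ) m μ}
  {Z' : Icc (0 : ℝ) T → Lp (HScale S ρ') m μ}

theorem isRiemannLimit (h : IsConvolutionLift ℱ κ q K η Y Z) :
    IsRiemannLimit κ η Y (mapPath (embed S κ ρ) Z) := fun s t hs => by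
  have h1 := h.tendsto s t (by rw [← Subtype.coe_le_coe, hs]; exact t.2.1)
  have h2 : mapPath (embed S κ ρ) Z s = 0 := by
    rw [mapPath, h.zero s hs, _root_.map_zero]
  rwa [hatIncr, mildIncr, h2, _root_.map_zero, sub_zero] at h1

/-- Lifts to different spaces share their Riemann limits in H_κ, and the inclusion into H_κ is
injective. Bounds obtained for different θ may therefore be combined. -/
theorem mapPath_eq (hS : IsAnalyticSemigroup S) (hν : IsExpStable S)
    (h : IsConvolutionLift ℱ κ q K η Y Z) (h' : IsConvolutionLift ℱ κ q' K' η Y Z')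
    (hκ : κ ≤ ρ) (hρ : ρ ≤ ρ') : mapPath (embed S ρ ρ') Z' = Z := funext fun t => by
  apply compLpL_injective (embed_injective hS hν hκ)
  rw [mapPath, embed_comp_apply hS hν hκ hρ]
  exact congrFun (h'.isRiemannLimit.unique h.isRiemannLimit) t

theorem norm_le (h : IsConvolutionLift ℱ κ q K η Y Z) (hK : 0 ≤ K) (hq : 0 ≤ q)
    (t : Icc (0 : ℝ) T) : ‖Z t‖ ≤ K * T ^ q := by
  let z : Icc (0 : ℝ) T := ⟨0, le_rfl, t.2.1.trans t.2.2⟩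
  have h1 := h.norm_hatIncr_le z t t.2.1
  rw [hatIncr, mildIncr, h.zero z rfl, _root_.map_zero, sub_zero] at h1
  refine h1.trans ?_
  have h2 : (t : ℝ) - (z : ℝ) = t := sub_zero _
  rw [h2]
  have h3 := t.2.1
  gcongr
  exact t.2.2

/-- In δZ = (mild increment) + (S_{t-s} - 1) Z_s, the last term is small in H_ρ because Z is bounded
in the smoother space H_{ρ'}. -/
theorem continuous (hS : IsAnalyticSemigroup S) (hν : IsExpStable S)
    (h : IsConvolutionLift ℱ κ q K η Y Z) (h' : IsConvolutionLift ℱ κ q' K' η Y Z')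
    (hκ : κ ≤ ρ) (hρ : ρ < ρ') (hρ1 : ρ' - ρ < 1) (hq : 0 < q) (hq' : 0 ≤ q') (hK' : 0 ≤ K') :
    Continuous Z := by
  obtain ⟨C, hC, hCb⟩ := exists_norm_scaleSemigroup_sub_embed_le hS hν hρ hρ1
  refine continuous_of_norm_sub_le (K₁ := K) (K₂ := C * (K' * T ^ q')) hq (sub_pos.2 hρ)
    fun s t hst => ?_
  have hst' : (0 : ℝ) ≤ t - s := sub_nonneg.2 hst
  have e1 : Z t - Z s = hatIncr S Z s t +
      (scaleSemigroup S ρ ((t : ℝ) - s) ∘L embed S ρ ρ' - embed S ρ ρ').compLpL m μ (Z' s) := by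
    have e2 : (embed S ρ ρ').compLpL m μ (Z' s) = Z s :=
      congrFun (h.mapPath_eq hS hν h' hκ hρ.le) s
    rw [compLpL_sub_apply, compLpL_comp_apply, e2, hatIncr, mildIncr]
    abel
  rw [e1]
  refine (norm_add_le _ _).trans (add_le_add (h.norm_hatIncr_le s t hst) ?_)
  calc _ ≤ C * ((t : ℝ) - s) ^ (ρ' - ρ) * (K' * T ^ q') := by
        refine (norm_compLpL_apply_le _ _).trans ?_
        gcongr
        · exact hCb _ hst'
        · exact h'.norm_le hK' hq' s
    _ = _ := by ring

theorem norm_embed_hatIncr_le (hS : IsAnalyticSemigroup S) (hν : IsExpStable S)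
    (h : IsConvolutionLift ℱ κ q K η Y Z) (h' : IsConvolutionLift ℱ κ q' K' η Y Z')
    (hκ : κ ≤ ρ) (hρ : ρ ≤ ρ') {κ' : ℝ} (hκ' : κ' ≤ ρ) {s t : Icc (0 : ℝ) T} (hst : s ≤ t) :
    ‖(embed S κ' ρ').compLpL m μ (hatIncr S Z' s t)‖ ≤
      ‖embed S κ' ρ‖ * K * ((t : ℝ) - s) ^ q := by
  rw [← embed_comp_apply hS hν hκ' hρ, ← hatIncr_mapPath_embed hS hν hρ Z' hst,
    h.mapPath_eq hS hν h' hκ hρ, mul_assoc]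
  refine (norm_compLpL_apply_le _ _).trans ?_
  gcongr
  exact h.norm_hatIncr_le s t hst

end IsConvolutionLift

theorem IsMeasurableAdapted.mapPath {V V' : Type*} [NormedAddCommGroup V] [NormedSpace ℝ V]
    [NormedAddCommGroup V'] [NormedSpace ℝ V'] {Y : Icc (0 : ℝ) T → Lp V m μ}
    (hY : IsMeasurableAdapted ℱ Y) (f : V →L[ℝ] V') : IsMeasurableAdapted ℱ (mapPath f Y) := by
  obtain ⟨y, h1, h2, h3⟩ := hY
  refine ⟨fun t ω => f (y t ω), f.continuous.comp_stronglyMeasurable h1,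
    fun t => f.continuous.comp_stronglyMeasurable (h2 t), fun t => ?_⟩
  filter_upwards [h3 t, f.coeFn_compLpL (p := m) (μ := μ) (Y t)] with ω e1 e2
  rw [YoungConv.mapPath, e2, e1]

theorem continuous_mapPath {V V' : Type*} [NormedAddCommGroup V] [NormedSpace ℝ V]
    [NormedAddCommGroup V'] [NormedSpace ℝ V'] {Y : Icc (0 : ℝ) T → Lp V m μ}
    (hY : Continuous Y) (f : V →L[ℝ] V') : Continuous (mapPath f Y) :=
  (f.compLpL m μ).continuous.comp hY

end ConvolutionLifts

/-! ### Existence and bounds -/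

section Existence

variable {Ω : Type*} {mΩ : MeasurableSpace Ω} {μ : Measure Ω} {m : ℝ≥0∞} [Fact (1 ≤ m)]
  {H : Type*} [NormedAddCommGroup H] [InnerProductSpace ℝ H] [CompleteSpace H]
  {S : ℝ → H →L[ℝ] H} {ℱ : Filtration ℝ≥0 mΩ} {e : ℕ} {α β γ θ T : ℝ}

theorem IsConvolutionLift.norm_incr_mapPath_le (hS : IsAnalyticSemigroup S)
    (hν : IsExpStable S) {κ κ' ρ ρ' q q' K K' C : ℝ}
    {η : Icc (0 : ℝ) T → EuclideanSpace ℝ (Fin e)} {Y : Icc (0 : ℝ) T → Lp (HScaleE S e γ) m μ}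
    {Z : Icc (0 : ℝ) T → Lp (HScale S ρ) m μ} {Z' : Icc (0 : ℝ) T → Lp (HScale S ρ') m μ}
    (h : IsConvolutionLift ℱ κ q K η Y Z) (h' : IsConvolutionLift ℱ κ q' K' η Y Z')
    (hκ : κ ≤ ρ) (hρ : ρ ≤ ρ') (hκ' : κ' ≤ ρ) (hK' : 0 ≤ K') (hq' : 0 ≤ q') (hC : 0 ≤ C)
    (hCb : ∀ t : ℝ, 0 ≤ t →
      ‖scaleSemigroup S κ' t ∘L embed S κ' ρ' - embed S κ' ρ'‖ ≤ C * t ^ (ρ' - κ'))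
    {s t : Icc (0 : ℝ) T} (hst : s ≤ t) :
    ‖incr (mapPath (embed S κ' ρ') Z') s t‖ ≤ ‖embed S κ' ρ‖ * K * ((t : ℝ) - s) ^ q +
      C * (K' * T ^ q') * ((t : ℝ) - s) ^ (ρ' - κ') := by
  have hst' : (0 : ℝ) ≤ t - s := sub_nonneg.2 hst
  have e1 : incr (mapPath (embed S κ' ρ') Z') s t =
      (embed S κ' ρ').compLpL m μ (hatIncr S Z' s t) +
        (scaleSemigroup S κ' ((t : ℝ) - s) ∘L embed S κ' ρ' -
          embed S κ' ρ').compLpL m μ (Z' s) := by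
    rw [← hatIncr_mapPath_embed hS hν (hκ'.trans hρ) Z' hst, compLpL_sub_apply,
      compLpL_comp_apply]
    simp only [hatIncr, mildIncr, incr, mapPath]
    abel
  rw [e1]
  refine (norm_add_le _ _).trans
    (add_le_add (h.norm_embed_hatIncr_le hS hν h' hκ hρ hκ' hst) ?_)
  calc _ ≤ C * ((t : ℝ) - s) ^ (ρ' - κ') * (K' * T ^ q') := by
        refine (norm_compLpL_apply_le _ _).trans ?_
        gcongr
        · exact hCb _ hst'
        · exact h'.norm_le hK' hq' s
    _ = _ := by ring

theorem exists_convolution (hS : IsAnalyticSemigroup S) (hν : IsExpStable S)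
    (hα : 0 < α) (hβ : 0 < β) (hαβ : 1 < α + β) (hα1 : α < 1) (hβα : β < α) (hθ : 0 ≤ θ)
    (hθα : θ < α) {T₀ : ℝ} (hT₀ : 0 < T₀) :
    ∃ C : ℝ, 0 < C ∧ ∀ T : ℝ, 0 < T → T ≤ T₀ → ∀ η ∈ HolderPath T α e,
      ∀ Y ∈ ESpace μ m T ℱ β (embedE S e (γ - β) γ),
        ∃ Z ∈ ESpace μ m T ℱ β (embed S (γ + θ - β) (γ + θ)),
          IsYoungConvolution S ℱ α η Y (mapPath (embed S (γ - β) (γ + θ)) Z) ∧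
          MemHatC S ℱ (α - θ) Z ∧
          holderNorm (α - θ) (hatIncr S Z) ≤
            ENNReal.ofReal C * eSpaceNorm β (embedE S e (γ - β) γ) Y * holderNorm α (incr η) ∧
          eSpaceNorm β (embed S (γ + θ - β) (γ + θ)) Z ≤
            ENNReal.ofReal (C * T ^ (α - max β θ)) *
              eSpaceNorm β (embedE S e (γ - β) γ) Y * holderNorm α (incr η) := by
  have hβ1 : β < 1 := hβα.trans hα1
  -- The mild increment is needed in H_{γ+θ-β}, but lifts exist only for nonnegative exponents;
  -- hence θ - β is replaced by its positive part, which produces β ∨ θ in the final power of T.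
  have hmβ : 0 ≤ max (θ - β) 0 := le_max_right _ _
  have hmα : max (θ - β) 0 < α := max_lt (by linarith) hα
  have hmθ : max (θ - β) 0 ≤ θ := max_le (by linarith) hθ
  obtain ⟨C₀, hC₀, hlift₀⟩ := exists_isConvolutionLift (ℱ := ℱ) (μ := μ) (m := m) (e := e)
    (γ := γ) hS hν hα hβ hαβ hα1 hβ1 le_rfl hα
  obtain ⟨C₁, hC₁, hlift₁⟩ := exists_isConvolutionLift (ℱ := ℱ) (μ := μ) (m := m) (e := e)
    (γ := γ) hS hν hα hβ hαβ hα1 hβ1 hmβ hmα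
  obtain ⟨C₂, hC₂, hlift₂⟩ := exists_isConvolutionLift (ℱ := ℱ) (μ := μ) (m := m) (e := e)
    (γ := γ) hS hν hα hβ hαβ hα1 hβ1 hθ hθα
  -- An exponent strictly between θ and α, needed only for continuity in H_{γ+θ}.
  obtain ⟨C₃, hC₃, hlift₃⟩ := exists_isConvolutionLift (ℱ := ℱ) (μ := μ) (m := m) (e := e)
    (γ := γ) (θ := (θ + α) / 2) hS hν hα hβ hαβ hα1 hβ1 (by linarith) (by linarith)
  obtain ⟨Cβ, hCβ, hCβb⟩ := exists_norm_scaleSemigroup_sub_embed_le hS hν (κ := γ + θ - β)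
    (κ' := γ + θ) (by linarith) (by linarith)
  set c := ‖embed S (γ + θ - β) (γ + max (θ - β) 0)‖ with hc
  have hc0 : 0 ≤ c := norm_nonneg _
  set P := T₀ ^ (max β θ - θ) with hP
  have hP0 : 0 ≤ P := by positivity
  -- The terms come from the mild seminorm, the Hölder seminorm and the supremum. The factor P
  -- converts T^{α-θ} into T^{α-(β∨θ)} for T ≤ T₀; adding 1 ensures positivity.
  refine ⟨C₂ + (c * C₁ + Cβ * C₂ * P + C₂ * P) + 1, by positivity,
    fun T hT hTT₀ η hη Y hY => ?_⟩
  obtain ⟨Z₀, hZ₀⟩ := hlift₀ T hT η hη Y hY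
  obtain ⟨Z₁, hZ₁⟩ := hlift₁ T hT η hη Y hY
  obtain ⟨Z, hZ⟩ := hlift₂ T hT η hη Y hY
  obtain ⟨Z₃, hZ₃⟩ := hlift₃ T hT η hη Y hY
  set N := (eSpaceNorm β (embedE S e (γ - β) γ) Y).toReal
  set A := (holderNorm α (incr η)).toReal
  have hNA : 0 ≤ N * A := mul_nonneg ENNReal.toReal_nonneg ENNReal.toReal_nonneg
  have hprod : ∀ x : ℝ, 0 ≤ x → ENNReal.ofReal x * eSpaceNorm β (embedE S e (γ - β) γ) Y *
      holderNorm α (incr η) = ENNReal.ofReal (x * (N * A)) := fun x hx => by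
    rw [ENNReal.ofReal_mul hx, ENNReal.ofReal_mul ENNReal.toReal_nonneg,
      ENNReal.ofReal_toReal (eSpaceNorm_ne_top hY),
      ENNReal.ofReal_toReal (holderNorm_incr_ne_top hη), mul_assoc]
  have hcont : Continuous Z := hZ.continuous hS hν hZ₃ (by linarith) (by linarith) (by linarith)
    (by linarith) (by linarith) (by positivity)
  have hmeas : IsMeasurableAdapted ℱ Z :=
    isMeasurableAdapted_of_continuous hT.le hcont hZ.adapted
  have hhat : holderNorm (α - θ) (hatIncr S Z) ≤ ENNReal.ofReal (C₂ * (N * A)) :=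
    holderNorm_le_ofReal (by positivity) fun s t hst => hZ.norm_hatIncr_le s t hst.le
  have hTq : T ^ (α - θ) ≤ P * T ^ (α - max β θ) := by
    rw [show α - θ = (max β θ - θ) + (α - max β θ) by ring, Real.rpow_add hT]
    have : 0 ≤ max β θ - θ := sub_nonneg.2 (le_max_right _ _)
    rw [hP]
    gcongr
  set Q := T ^ (α - max β θ) with hQ
  have hQ0 : 0 ≤ Q := by positivity
  have hincr : ∀ s t : Icc (0 : ℝ) T, s < t →
      ‖incr (mapPath (embed S (γ + θ - β) (γ + θ)) Z) s t‖ ≤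
        (c * C₁ + Cβ * C₂ * P) * Q * (N * A) * ((t : ℝ) - s) ^ β := fun s t hst => by
    have hst' : (0 : ℝ) < t - s := sub_pos.2 hst
    have htT : (t : ℝ) - s ≤ T := by linarith [s.2.1, t.2.2]
    have h1 := hZ₁.norm_incr_mapPath_le hS hν hZ (κ' := γ + θ - β) (by linarith) (by linarith)
      (by linarith [le_max_left (θ - β) 0]) (by positivity) (by linarith) hCβ hCβb hst.le
    rw [sub_sub_cancel] at h1
    have h2 : ((t : ℝ) - s) ^ (α - max (θ - β) 0) ≤ Q * ((t : ℝ) - s) ^ β := by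
      have h3 : max (θ - β) 0 = max β θ - β := by
        rw [max_comm β θ, ← sub_self β, max_sub_sub_right]
      rw [h3, show α - (max β θ - β) = (α - max β θ) + β by ring, Real.rpow_add hst']
      have : 0 ≤ α - max β θ := sub_nonneg.2 (max_le hβα.le hθα.le)
      rw [hQ]
      gcongr
    refine h1.trans ?_
    calc _ ≤ c * (C₁ * (N * A)) * (Q * ((t : ℝ) - s) ^ β) +
          Cβ * (C₂ * (N * A) * (P * Q)) * ((t : ℝ) - s) ^ β := by gcongr
      _ = _ := by ring
  have hholder : holderNorm β (incr (mapPath (embed S (γ + θ - β) (γ + θ)) Z)) ≤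
      ENNReal.ofReal ((c * C₁ + Cβ * C₂ * P) * Q * (N * A)) :=
    holderNorm_le_ofReal (by positivity) hincr
  have hsup : supNorm Z ≤ ENNReal.ofReal (C₂ * P * Q * (N * A)) :=
    supNorm_le_ofReal fun t => by
      refine (hZ.norm_le (by positivity) (by linarith) t).trans ?_
      calc _ ≤ C₂ * (N * A) * (P * Q) := by gcongr
        _ = _ := by ring
  refine ⟨Z, ⟨⟨continuous_mapPath hcont _, hmeas.mapPath _,
    hholder.trans_lt ENNReal.ofReal_lt_top⟩, hcont⟩, ⟨⟨continuous_mapPath hcont _,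
    hmeas.mapPath _, ?_⟩, fun t ht => ?_, hZ.tendsto⟩,
    ⟨hcont, hmeas, hhat.trans_lt ENNReal.ofReal_lt_top⟩, hhat.trans ?_, ?_⟩
  -- The full exponent α in H_{γ-β} comes from the lift with θ = 0, which loses no time regularity.
  · refine (holderNorm_le_ofReal (c := ‖embed S (γ - β) (γ + 0)‖ * (C₀ * (N * A)))
      (by positivity) fun s t hst => ?_).trans_lt ENNReal.ofReal_lt_top
    have h1 := hZ₀.norm_embed_hatIncr_le hS hν hZ (κ' := γ - β) (by linarith) (by linarith)
      (by linarith) hst.le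
    rw [sub_zero] at h1
    rwa [hatIncr_mapPath_embed hS hν (by linarith) Z hst.le]
  · rw [mapPath, hZ.zero t ht, _root_.map_zero]
  · rw [hprod _ (by positivity)]
    refine ENNReal.ofReal_le_ofReal (mul_le_mul_of_nonneg_right ?_ hNA)
    have : 0 ≤ c * C₁ + Cβ * C₂ * P + C₂ * P := by positivity
    linarith
  · rw [hprod _ (by positivity), eSpaceNorm]
    refine (add_le_add hholder hsup).trans ?_
    rw [← ENNReal.ofReal_add (by positivity) (by positivity)]
    refine ENNReal.ofReal_le_ofReal ?_
    calc _ = (c * C₁ + Cβ * C₂ * P + C₂ * P) * Q * (N * A) := by ring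
      _ ≤ _ := by
        refine mul_le_mul_of_nonneg_right (mul_le_mul_of_nonneg_right ?_ hQ0) hNA
        linarith

theorem mapPath_embed_injective (hS : IsAnalyticSemigroup S) (hν : IsExpStable S) {κ ρ : ℝ}
    (h : κ ≤ ρ) : Function.Injective
      (mapPath (embed S κ ρ) : (Icc (0 : ℝ) T → Lp (HScale S ρ) m μ) → _) := fun _ _ hZ =>
  funext fun t => compLpL_injective (embed_injective hS hν h) (congrFun hZ t)

/-- The convolution as a bilinear map. -/
theorem exists_bilinear_convolution (hS : IsAnalyticSemigroup S) (hν : IsExpStable S) {κ ρ κ' : ℝ}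
    (h : κ ≤ ρ) (p : (Icc (0 : ℝ) T → EuclideanSpace ℝ (Fin e)) →
      (Icc (0 : ℝ) T → Lp (HScaleE S e γ) m μ) → (Icc (0 : ℝ) T → Lp (HScale S ρ) m μ) → Prop)
    (hex : ∀ η ∈ HolderPath T α e, ∀ Y ∈ ESpace μ m T ℱ β (embedE S e (γ - β) γ),
      ∃ Z ∈ ESpace μ m T ℱ β (embed S κ' ρ),
        IsYoungConvolution S ℱ α η Y (mapPath (embed S κ ρ) Z) ∧ p η Y Z) :
    ∃ B : HolderPath T α e →ₗ[ℝ] ESpace μ m T ℱ β (embedE S e (γ - β) γ) →ₗ[ℝ]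
        ESpace μ m T ℱ β (embed S κ' ρ),
      ∀ (η : HolderPath T α e) (Y : ESpace μ m T ℱ β (embedE S e (γ - β) γ)),
        IsYoungConvolution S ℱ α η.1 Y.1 (mapPath (embed S κ ρ) (B η Y).1) ∧
          p η.1 Y.1 (B η Y).1 := by
  choose Z hZE hZ hp using fun (η : HolderPath T α e)
    (Y : ESpace μ m T ℱ β (embedE S e (γ - β) γ)) => hex η.1 η.2 Y.1 Y.2
  have hinj := mapPath_embed_injective (T := T) (μ := μ) (m := m) hS hν h
  refine ⟨LinearMap.mk₂ ℝ (fun η Y => ⟨Z η Y, hZE η Y⟩) (fun η η' Y => ?_) (fun c η Y => ?_)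
    (fun η Y Y' => ?_) (fun c η Y => ?_), fun η Y => ⟨hZ η Y, hp η Y⟩⟩
  -- Each linearity identity is checked in H_κ, where both sides are limits of the same Riemann
  -- sums.
  · refine Subtype.ext (hinj ?_)
    exact (hZ _ _).isRiemannLimit.unique (((hZ η Y).isRiemannLimit.add_left
      (hZ η' Y).isRiemannLimit).congr (mapPath_add _ _ _).symm)
  · refine Subtype.ext (hinj ?_)
    exact (hZ _ _).isRiemannLimit.unique (((hZ η Y).isRiemannLimit.smul_left
      c).congr (mapPath_smul _ _ _).symm)
  · refine Subtype.ext (hinj ?_)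
    exact (hZ _ _).isRiemannLimit.unique (((hZ η Y).isRiemannLimit.add_right
      (hZ η Y').isRiemannLimit).congr (mapPath_add _ _ _).symm)
  · refine Subtype.ext (hinj ?_)
    exact (hZ _ _).isRiemannLimit.unique (((hZ η Y).isRiemannLimit.smul_right
      c).congr (mapPath_smul _ _ _).symm)

end Existence

end YoungConv

end

open YoungConv

theorem proposition3p2
    -- the analytic semigroup `S` on the Hilbert space `H`, with generator `L`
    {H : Type*} [NormedAddCommGroup H] [InnerProductSpace ℝ H] [CompleteSpace H]
    (L : H →ₗ.[ℝ] H) (S : ℝ → H →L[ℝ] H) (hL : IsGenerator L S)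
    (hS : IsAnalyticSemigroup S) (hν : IsExpStable S)
    -- the filtered probability space with the usual conditions
    {Ω : Type*} {mΩ : MeasurableSpace Ω} (μ : Measure Ω) [IsProbabilityMeasure μ]
    (ℱ : Filtration ℝ≥0 mΩ) (hright : ℱ.IsRightContinuous)
    (hnull : ∀ N : Set Ω, μ N = 0 → MeasurableSet[ℱ 0] N)
    -- the exponents
    (m : ℝ≥0∞) [Fact (1 ≤ m)] (hm : 2 ≤ m) (e : ℕ) (α β γ : ℝ)
    (hα : α ∈ Ioo (1 / 2 : ℝ) 1) (hβ : β ∈ Ioo (1 - α) α) :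
    -- existence and uniqueness of the convolution in `Ĉ^α L_m H_{γ-β}`
    (∀ T : ℝ, 0 < T →
      ∀ η ∈ HolderPath T α e, ∀ Y ∈ ESpace μ m T ℱ β (embedE S e (γ - β) γ),
        ∃! Z : Icc (0 : ℝ) T → Lp (HScale S (γ - β)) m μ, IsYoungConvolution S ℱ α η Y Z) ∧
    -- regularity in `H_{γ+θ}`, bilinearity and bounds
    (∀ θ ∈ Ico (0 : ℝ) α, ∀ T₀ : ℝ, 0 < T₀ → ∃ C : ℝ, 0 < C ∧ ∀ T : ℝ, 0 < T → T ≤ T₀ →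
      ∃ B : HolderPath T α e →ₗ[ℝ] ESpace μ m T ℱ β (embedE S e (γ - β) γ) →ₗ[ℝ]
          ESpace μ m T ℱ β (embed S (γ + θ - β) (γ + θ)),
        ∀ (η : HolderPath T α e) (Y : ESpace μ m T ℱ β (embedE S e (γ - β) γ)),
          IsYoungConvolution S ℱ α η.1 Y.1 (mapPath (embed S (γ - β) (γ + θ)) (B η Y).1) ∧
          MemHatC S ℱ (α - θ) (B η Y).1 ∧
          holderNorm (α - θ) (hatIncr S (B η Y).1) ≤
            ENNReal.ofReal C * eSpaceNorm β (embedE S e (γ - β) γ) Y.1 *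
              holderNorm α (incr η.1) ∧
          eSpaceNorm β (embed S (γ + θ - β) (γ + θ)) (B η Y).1 ≤
            ENNReal.ofReal (C * T ^ (α - max β θ)) *
              eSpaceNorm β (embedE S e (γ - β) γ) Y.1 * holderNorm α (incr η.1)) := by
  obtain ⟨hα₁, hα₂⟩ := hα
  obtain ⟨hβ₁, hβ₂⟩ := hβ
  have hα : 0 < α := by linarith
  have hβ : 0 < β := by linarith
  have hαβ : 1 < α + β := by linarith
  refine ⟨fun T hT η hη Y hY => ?_, fun θ hθ T₀ hT₀ => ?_⟩
  -- Existence is the case θ = 0, T₀ = T, pushed into H_{γ-β}.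
  · obtain ⟨_, _, hex⟩ := exists_convolution (ℱ := ℱ) (μ := μ) (m := m) (e := e) (γ := γ)
      hS hν hα hβ hαβ hα₂ hβ₂ le_rfl hα hT
    obtain ⟨Z, -, hZ, -⟩ := hex T hT le_rfl η hη Y hY
    exact ⟨_, hZ, fun Z' hZ' => hZ'.isRiemannLimit.unique hZ.isRiemannLimit⟩
  · obtain ⟨C, hC, hex⟩ := exists_convolution (ℱ := ℱ) (μ := μ) (m := m) (e := e) (γ := γ)
      hS hν hα hβ hαβ hα₂ hβ₂ hθ.1 hθ.2 hT₀
    refine ⟨C, hC, fun T hT hTT₀ => ?_⟩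
    exact exists_bilinear_convolution hS hν (by linarith [hθ.1]) _ (hex T hT hTT₀)
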